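/- Let $n\ge 2$ be an even integer, $\Gamma=\mathrm{SL}_2(\mathbb Z)$, and let $\mathcal M_n^\flat\subset\mathbb Z[X_1,X_2]$ be the $\mathbb Z$-span of $e_\nu^\flat=(-1)^{n-\nu}\binom n\nu X_1^{n-\nu}X_2^{\nu}$ $(0\le\nu\le n)$, on which integral matrices $\gamma=\begin{pmatrix}a&b\\c&d\end{pmatrix}$ of positive determinant act by $(\gamma P)(X_1,X_2)=P(dX_1-bX_2,-cX_1+aX_2)$. Let $Y=\Gamma\backslash\mathbb H$, let $Y^{\mathrm{BS}}=\Gamma\backslash\mathbb H^{\mathrm{BS}}$ be its Borel--Serre compactification, where $\mathbb H^{\mathrm{BS}}=\mathbb H\sqcup\bigsqcup_{r\in\mathbb P^1(\mathbb Q)}\mathbb P^1(\mathbb R)\smallsetminus\{r\}$, and let $\partial Y^{\mathrm{BS}}=Y^{\mathrm{BS}}\smallsetminus Y$. For $X\in\{\mathbb H,\mathbb H^{\mathrm{BS}},\partial\mathbb H^{\mathrm{BS}}\}$ let $H^1(\Gamma\backslash X,\mathcal M)$ be the first cohomology of the complex $\mathrm{Hom}_{\mathbb Z}(S_\bullet(X),\mathcal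 M)^\Gamma$ of $\Gamma$-invariant singular cochains, with the Hecke operators $T_p'$ ($p$ prime) induced by $$(\phi|T_p')(\sigma)=\sum_{\alpha}\widetilde\alpha\,\phi(\alpha\sigma),\qquad \alpha\in\left\{\begin{pmatrix}p&0\\0&1\end{pmatrix},\ \begin{pmatrix}1&j\\0&p\end{pmatrix}\ (0\le j<p)\right\},$$ where $\widetilde\alpha$ is the adjugate of $\alpha$. Let $$E_{n+2}(z)=1+\frac{2}{\zeta(-1-n)}\sum_{k\ge1}\sigma_{n+1}(k)e^{2\pi ikz}\in M_{n+2}(\Gamma),$$ and let $r(E_{n+2})\in H^1(Y,\mathcal M_n^\flat\otimes\mathbb C)=H^1(Y^{\mathrm{BS}},\mathcal M_n^\flat\otimes\mathbb C)$ be the class of the cocycle that sends a path from $\alpha$ to $\beta$ in $\mathbb H$ to $\int_\alpha^\beta E_{n+2}(z)(X_1-zX_2)^n\,dz$. Then: (1) $r(E_{n+2})$ is rational: it lies in $H^1(Y^{\mathrm{BS}},\mathcal M_n^\flat)\otimes\mathbb Q$, that is, a positive integral multiple of it is the image of a class in $H^1(Y^{\mathrm{BS}},\mathcal M_n^\flat)$.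 (2) $r(E_{n+2})$ coincides with Harder's Eisenstein class: there is a unique section $s$ of the restriction map $H^1(Y^{\mathrm{BS}},\mathcal M_n^\flat\otimes\mathbb Q)\to H^1(\partial Y^{\mathrm{BS}},\mathcal M_n^\flat\otimes\mathbb Q)$ that commutes with all $T_p'$, and $r(E_{n+2})=s(\omega_n)$, where $\omega_n$ is the generator of $H^1(\partial Y^{\mathrm{BS}},\mathcal M_n^\flat)/(\text{torsion})$ (which is infinite cyclic) whose value on the path from $x$ to $x+1$ in the boundary component $\mathbb P^1(\mathbb R)\smallsetminus\{\infty\}$, $x\in\mathbb R$, has coefficient $1$ at $e_0^\flat$. -/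

import Mathlib

open scoped MatrixGroups UpperHalfPlane NNReal

noncomputable section

namespace EisensteinClass

/-! ### The monoid of integral matrices with positive determinant -/

/-- `M₂⁺(ℤ)`, the monoid of integral `2 × 2` matrices of positive determinant. -/
def M2pos : Submonoid (Matrix (Fin 2) (Fin 2) ℤ) where
  carrier := {γ | 0 < γ.det}
  one_mem' := by simp
  mul_mem' {a b} ha hb := by
    change 0 < a.det at ha
    change 0 < b.det at hb
    change 0 < (a * b).det
    rw [Matrix.det_mul]
    positivity

/-- The adjugate `(a, b; c, d) ↦ (d, -b; -c, a)`. -/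
def adj (γ : M2pos) : M2pos :=
  ⟨γ.1.adjugate, by
    have h : 0 < γ.1.det := γ.2
    change 0 < γ.1.adjugate.det
    simpa [Matrix.det_adjugate] using h⟩

theorem adj_mul (γ δ : M2pos) : adj (γ * δ) = adj δ * adj γ :=
  Subtype.ext (Matrix.adjugate_mul_distrib γ.1 δ.1)

/-- The inclusion of `Γ = SL₂(ℤ)` in `M₂⁺(ℤ)`. -/
def ofSL : SL(2, ℤ) →* M2pos where
  toFun γ := ⟨γ.1, by change 0 < γ.1.det; rw [γ.2]; exact one_pos⟩
  map_one' := rfl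
  map_mul' _ _ := rfl

theorem adj_ofSL (γ : SL(2, ℤ)) : adj (ofSL γ) = ofSL γ⁻¹ := by
  apply Subtype.ext
  simp [adj, ofSL, Matrix.SpecialLinearGroup.coe_inv]

/-- The map `M₂⁺(ℤ) → GL₂(K)` for a field `K` of characteristic zero. -/
def toGL (K : Type) [Field K] [CharZero K] : M2pos →* GL (Fin 2) K where
  toFun γ := Matrix.GeneralLinearGroup.mkOfDetNeZero (γ.1.map (Int.castRingHom K)) (by
    have h : 0 < γ.1.det := γ.2
    rw [← RingHom.mapMatrix_apply, ← RingHom.map_det]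
    simpa using h.ne')
  map_one' := by
    apply Units.ext
    simp [Matrix.GeneralLinearGroup.mkOfDetNeZero]
  map_mul' a b := by
    apply Units.ext
    exact Matrix.map_mul (f := Int.castRingHom K)

theorem toGL_apply (K : Type) [Field K] [CharZero K] (γ : M2pos) (i j : Fin 2) :
    toGL K γ i j = (γ.1 i j : K) := rfl

theorem map_toGL (γ : M2pos) : (toGL ℚ γ).map (Rat.castHom ℝ) = toGL ℝ γ := by
  ext i j
  simp [toGL_apply]

theorem toGL_det_pos (γ : M2pos) : 0 < (toGL ℝ γ).det.val := by
  have h : 0 < γ.1.det := γ.2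
  have h2 : (toGL ℝ γ).det.val = ((γ.1.det : ℤ) : ℝ) := by
    simp [Matrix.det_fin_two, toGL_apply]
  rw [h2]
  exact_mod_cast h

/-! ### The upper half plane and its Borel--Serre completion -/

/-- `M₂⁺(ℤ)` acts on the upper half plane by linear fractional transformations. -/
instance actH : MulAction M2pos ℍ := MulAction.compHom ℍ (toGL ℝ)

theorem smulH_def (γ : M2pos) (z : ℍ) : γ • z = toGL ℝ γ • z := rfl

instance contActH : ContinuousConstSMul M2pos ℍ :=
  ⟨fun γ => continuous_const_smul (toGL ℝ γ)⟩

/-- The boundary `⨆_{r ∈ ℙ¹(ℚ)} ℙ¹(ℝ) ∖ {r}` of the Borel--Serre completion, as a set: the points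
are the pairs `(r, x)` with `r ∈ ℙ¹(ℚ)` and `x ∈ ℙ¹(ℝ)`, `x ≠ r`. -/
@[ext]
structure BSBoundary where
  cusp : OnePoint ℚ
  pt : OnePoint ℝ
  pt_ne : pt ≠ OnePoint.map (Rat.castHom ℝ) cusp

/-- The action of `M₂⁺(ℤ)` on the boundary by linear fractional transformations. -/
instance actBoundary : MulAction M2pos BSBoundary where
  smul γ b := ⟨toGL ℚ γ • b.cusp, toGL ℝ γ • b.pt, by
    rw [OnePoint.map_smul, map_toGL]
    exact fun h => b.pt_ne (smul_left_cancel _ h)⟩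
  one_smul b := by
    apply BSBoundary.ext
    · change toGL ℚ 1 • b.cusp = b.cusp
      rw [map_one, one_smul]
    · change toGL ℝ 1 • b.pt = b.pt
      rw [map_one, one_smul]
  mul_smul γ δ b := by
    apply BSBoundary.ext
    · change toGL ℚ (γ * δ) • b.cusp = toGL ℚ γ • toGL ℚ δ • b.cusp
      rw [map_mul, mul_smul]
    · change toGL ℝ (γ * δ) • b.pt = toGL ℝ γ • toGL ℝ δ • b.pt
      rw [map_mul, mul_smul]

/-- The Borel--Serre completion `ℍ^BS = ℍ ⊔ ⨆_{r ∈ ℙ¹(ℚ)} ℙ¹(ℝ) ∖ {r}`, as a set. -/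
inductive HBS where
  | inner (z : ℍ) : HBS
  | bd (b : BSBoundary) : HBS

/-- The action of `M₂⁺(ℤ)` on `ℍ^BS`. -/
instance actHBS : MulAction M2pos HBS where
  smul γ z := match z with
    | .inner z => .inner (γ • z)
    | .bd b => .bd (γ • b)
  one_smul z := by
    cases z with
    | inner z => exact congrArg HBS.inner (one_smul _ z)
    | bd b => exact congrArg HBS.bd (one_smul _ b)
  mul_smul γ δ z := by
    cases z with
    | inner z => exact congrArg HBS.inner (mul_smul γ δ z)
    | bd b => exact congrArg HBS.bd (mul_smul γ δ b)

theorem smul_inner (γ : M2pos) (z : ℍ) : γ • HBS.inner z = HBS.inner (γ • z) := rfl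

theorem smul_bd (γ : M2pos) (b : BSBoundary) : γ • HBS.bd b = HBS.bd (γ • b) := rfl

/-- The boundary point `x ∈ ℝ = ℙ¹(ℝ) ∖ {∞}` of the boundary component of the cusp `∞`. -/
def bdInfty (x : ℝ) : BSBoundary :=
  ⟨OnePoint.infty, (x : OnePoint ℝ), by simp⟩

/-- The point `x + i/t` for `t > 0`, and the point `x` of the boundary component of `∞` (the limit
of `x + iy` for `y → ∞`) for `t = 0`. -/
def chartInfty (w : ℝ × ℝ≥0) : HBS :=
  if h : 0 < w.2 then .inner ⟨⟨w.1, ((w.2 : ℝ))⁻¹⟩, by simpa using h⟩ else .bd (bdInfty w.1)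

/-- The topology of `ℍ^BS`: it is glued from the charts `ℝ × [0, ∞) → ℍ^BS`,
`(x, t) ↦ γ (x + i/t)`, at the cusps `γ∞` (`γ ∈ M₂⁺(ℤ)`), i.e. a set is open
if and only if its preimage under each of these charts is open. -/
instance topHBS : TopologicalSpace HBS :=
  ⨆ γ : M2pos, TopologicalSpace.coinduced (fun w => γ • chartInfty w) inferInstance

theorem isOpen_HBS {U : Set HBS} :
    IsOpen U ↔ ∀ γ : M2pos, IsOpen ((fun w => γ • chartInfty w) ⁻¹' U) := by
  simp only [isOpen_iSup_iff, isOpen_coinduced]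

theorem continuous_chart (γ : M2pos) : Continuous (fun w => γ • chartInfty w) :=
  ⟨fun _ hU => isOpen_HBS.1 hU γ⟩

instance contActHBS : ContinuousConstSMul M2pos HBS where
  continuous_const_smul γ := ⟨fun U hU => isOpen_HBS.2 fun δ => by
    have h := isOpen_HBS.1 hU (γ * δ)
    simpa only [mul_smul, Set.preimage_preimage, ← Set.preimage_comp] using h⟩

/-- The boundary `∂ℍ^BS` carries the subspace topology. -/
instance topBoundary : TopologicalSpace BSBoundary := TopologicalSpace.induced HBS.bd inferInstance

instance contActBoundary : ContinuousConstSMul M2pos BSBoundary where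
  continuous_const_smul γ := by
    have h1 : Continuous HBS.bd := continuous_induced_dom
    have h2 : Continuous (fun z : HBS => γ • z) := continuous_const_smul γ
    exact continuous_induced_rng.2 (h2.comp h1)

/-- The inclusion `∂ℍ^BS → ℍ^BS`. -/
def inclBoundary : C(BSBoundary, HBS) := ⟨HBS.bd, continuous_induced_dom⟩

/-- The inclusion `ℍ → ℍ^BS`. -/
def inclInner : C(ℍ, HBS) where
  toFun := HBS.inner
  continuous_toFun := by
    have h : HBS.inner = (fun w => (1 : M2pos) • chartInfty w) ∘
        (fun z : ℍ => ((z.re, ⟨z.im⁻¹, (inv_pos.2 z.im_pos).le⟩) : ℝ × ℝ≥0)) := by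
      funext z
      have hz : (0 : ℝ≥0) < ⟨z.im⁻¹, (inv_pos.2 z.im_pos).le⟩ :=
        inv_pos.2 z.im_pos
      simp only [Function.comp_apply, one_smul, chartInfty, dif_pos hz]
      congr 1
      apply UpperHalfPlane.ext
      apply Complex.ext
      · simp
      · change z.im = (z.im⁻¹)⁻¹
        rw [inv_inv]
    rw [h]
    refine (continuous_chart 1).comp (Continuous.prodMk UpperHalfPlane.continuous_re ?_)
    exact Continuous.subtype_mk
      (UpperHalfPlane.continuous_im.inv₀ fun z => z.im_pos.ne') _

/-! ### Equivariant singular cohomology -/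

/-- Singular `q`-simplices of `X`. -/
abbrev Simplex (q : ℕ) (X : Type) [TopologicalSpace X] : Type :=
  C(stdSimplex ℝ (Fin (q + 1)), X)

/-- The `i`-th face of a singular simplex. -/
def face {X : Type} [TopologicalSpace X] {q : ℕ} (i : Fin (q + 2)) (σ : Simplex (q + 1) X) :
    Simplex q X :=
  σ.comp ⟨stdSimplex.map i.succAbove, stdSimplex.continuous_map _⟩

section Cohomology

variable {X : Type} [TopologicalSpace X] [MulAction M2pos X] [ContinuousConstSMul M2pos X]
variable {R : Type} [CommRing R] {V : Type} [AddCommGroup V] [Module R V]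

theorem face_smul {q : ℕ} (i : Fin (q + 2)) (γ : M2pos) (σ : Simplex (q + 1) X) :
    face i (γ • σ) = γ • face i σ := rfl

variable (X R V) in
/-- The coboundary `Hom(S_q(X), V) → Hom(S_{q+1}(X), V)`; here and below a homomorphism from the
free abelian group `S_q(X)` on the singular `q`-simplices to `V` is given by its values on the
simplices. -/
def coboundary (q : ℕ) : (Simplex q X → V) →ₗ[R] (Simplex (q + 1) X → V) where
  toFun φ σ := ∑ i : Fin (q + 2), (-1 : ℤ) ^ (i : ℕ) • φ (face i σ)
  map_add' φ ψ := by
    funext σ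
    simp [Finset.sum_add_distrib]
  map_smul' c φ := by
    funext σ
    simp only [Pi.smul_apply, RingHom.id_apply, Finset.smul_sum]
    exact Finset.sum_congr rfl fun i _ => smul_comm _ _ _

variable (X) in
/-- `Hom(S_q(X), V)^Γ`: the cochains `φ` with `γ (φ (γ⁻¹ σ)) = φ σ` for all `γ ∈ Γ = SL₂(ℤ)`. -/
def invariants (ρ : Representation R M2pos V) (q : ℕ) : Submodule R (Simplex q X → V) where
  carrier := {φ | ∀ (γ : SL(2, ℤ)) (σ : Simplex q X), φ (ofSL γ • σ) = ρ (ofSL γ) (φ σ)}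
  zero_mem' γ σ := by simp
  add_mem' {φ ψ} hφ hψ γ σ := by simp [hφ γ σ, hψ γ σ]
  smul_mem' c φ hφ γ σ := by simp [hφ γ σ]

variable (X) in
/-- `Γ`-invariant singular `1`-cocycles. -/
def Z1 (ρ : Representation R M2pos V) : Submodule R (Simplex 1 X → V) :=
  invariants X ρ 1 ⊓ LinearMap.ker (coboundary X R V 1)

variable (X) in
/-- Coboundaries of `Γ`-invariant singular `0`-cochains. -/
def B1 (ρ : Representation R M2pos V) : Submodule R (Simplex 1 X → V) :=
  (invariants X ρ 0).map (coboundary X R V 0)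

variable (X) in
/-- `H¹(Γ \ X, V)`, the first cohomology of the complex `Hom(S_•(X), V)^Γ`. -/
def H1 (ρ : Representation R M2pos V) : Type :=
  ↥(Z1 X ρ) ⧸ (B1 X ρ).comap (Z1 X ρ).subtype

instance (ρ : Representation R M2pos V) : AddCommGroup (H1 X ρ) :=
  inferInstanceAs (AddCommGroup (↥(Z1 X ρ) ⧸ (B1 X ρ).comap (Z1 X ρ).subtype))

instance (ρ : Representation R M2pos V) : Module R (H1 X ρ) :=
  inferInstanceAs (Module R (↥(Z1 X ρ) ⧸ (B1 X ρ).comap (Z1 X ρ).subtype))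

/-- The class of a cocycle. -/
def H1.mk (ρ : Representation R M2pos V) : ↥(Z1 X ρ) →ₗ[R] H1 X ρ :=
  ((B1 X ρ).comap (Z1 X ρ).subtype).mkQ

/-- A semilinear map between cochain modules that respects cocycles and coboundaries induces a
map on `H¹`. -/
def H1.map {X' : Type} [TopologicalSpace X'] [MulAction M2pos X'] [ContinuousConstSMul M2pos X']
    {R' : Type} [CommRing R'] {V' : Type} [AddCommGroup V'] [Module R' V'] {f : R →+* R'}
    (ρ : Representation R M2pos V) (ρ' : Representation R' M2pos V')
    (F0 : (Simplex 0 X → V) →ₛₗ[f] (Simplex 0 X' → V'))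
    (F1 : (Simplex 1 X → V) →ₛₗ[f] (Simplex 1 X' → V'))
    (hZ : ∀ φ ∈ Z1 X ρ, F1 φ ∈ Z1 X' ρ')
    (h0 : ∀ φ ∈ invariants X ρ 0, F0 φ ∈ invariants X' ρ' 0)
    (hd : ∀ φ, F1 (coboundary X R V 0 φ) = coboundary X' R' V' 0 (F0 φ)) :
    H1 X ρ →ₛₗ[f] H1 X' ρ' :=
  Submodule.mapQ _ _ (F1.restrict hZ) (by
    rintro φ ⟨ψ, hψ, h⟩
    exact ⟨F0 ψ, h0 ψ hψ, by rw [← hd, h]; rfl⟩)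

/-- The map on `H¹` induced by an equivariant continuous map of spaces. -/
def H1.pullback {X' : Type} [TopologicalSpace X'] [MulAction M2pos X']
    [ContinuousConstSMul M2pos X'] (f : C(X, X')) (hf : ∀ (γ : M2pos) (x : X), f (γ • x) = γ • f x)
    (ρ : Representation R M2pos V) : H1 X' ρ →ₗ[R] H1 X ρ :=
  have key : ∀ (q : ℕ) (γ : M2pos) (σ : Simplex q X), f.comp (γ • σ) = γ • f.comp σ :=
    fun q γ σ => ContinuousMap.ext fun x => hf γ (σ x)
  have hinv : ∀ (q : ℕ), ∀ φ ∈ invariants X' ρ q, (fun σ => φ (f.comp σ)) ∈ invariants X ρ q :=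
    fun q φ hφ γ σ => by
      change φ (f.comp (ofSL γ • σ)) = ρ (ofSL γ) (φ (f.comp σ))
      rw [key, hφ γ]
  H1.map ρ ρ (LinearMap.funLeft R V fun σ => f.comp σ) (LinearMap.funLeft R V fun σ => f.comp σ)
    (fun φ hφ => ⟨hinv 1 φ hφ.1, by
      have h2 : coboundary X' R V 1 φ = 0 := hφ.2
      change coboundary X R V 1 _ = 0
      funext σ
      exact congrFun h2 (f.comp σ)⟩)
    (hinv 0) (fun φ => rfl)

/-- Application of a semilinear map to the values of cochains. -/
def mapCochain {R' : Type} [CommRing R'] {V' : Type} [AddCommGroup V'] [Module R' V']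
    {f : R →+* R'} (g : V →ₛₗ[f] V') {q : ℕ} : (Simplex q X → V) →ₛₗ[f] (Simplex q X → V') where
  toFun φ σ := g (φ σ)
  map_add' φ ψ := by
    funext σ
    simp
  map_smul' c φ := by
    funext σ
    simp

/-- The map on `H¹` induced by an equivariant map of coefficients. -/
def H1.coeffMap {R' : Type} [CommRing R'] {V' : Type} [AddCommGroup V'] [Module R' V']
    {f : R →+* R'} (ρ : Representation R M2pos V) (ρ' : Representation R' M2pos V')
    (g : V →ₛₗ[f] V') (hg : ∀ γ v, g (ρ γ v) = ρ' γ (g v)) : H1 X ρ →ₛₗ[f] H1 X ρ' :=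
  have hd : ∀ (q : ℕ) (φ : Simplex q X → V),
      (fun σ => g (coboundary X R V q φ σ)) = coboundary X R' V' q (fun σ => g (φ σ)) :=
    fun q φ => by
      funext σ
      simp [coboundary, map_sum]
  have hinv : ∀ (q : ℕ), ∀ φ ∈ invariants X ρ q, (fun σ => g (φ σ)) ∈ invariants X ρ' q :=
    fun q φ hφ γ σ => by
      change g (φ (ofSL γ • σ)) = ρ' (ofSL γ) (g (φ σ))
      rw [hφ γ, hg]
  H1.map ρ ρ' (mapCochain g) (mapCochain g)
    (fun φ hφ => ⟨hinv 1 φ hφ.1, by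
      have h2 : coboundary X R V 1 φ = 0 := hφ.2
      change coboundary X R' V' 1 (fun σ => g (φ σ)) = 0
      rw [← hd, h2]
      funext σ
      exact map_zero g⟩)
    (hinv 0) (hd 0)

end Cohomology

/-! ### Hecke operators -/

/-- The representatives `(p, 0; 0, 1)` (for `none`) and `(1, j; 0, p)` (for `some j`,
`0 ≤ j < p`) of `Γ \ Γ (p, 0; 0, 1) Γ`. -/
def heckeRep (p : Nat.Primes) (i : Option (Fin p)) : M2pos :=
  match i with
  | none => ⟨!![(p : ℤ), 0; 0, 1], by
      change 0 < Matrix.det (R := ℤ) _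
      rw [Matrix.det_fin_two_of]
      have := p.2.pos
      simpa using this⟩
  | some j => ⟨!![1, (j : ℤ); 0, (p : ℤ)], by
      change 0 < Matrix.det (R := ℤ) _
      rw [Matrix.det_fin_two_of]
      have := p.2.pos
      simpa using this⟩

theorem heckeRep_det (p : Nat.Primes) (i : Option (Fin p)) : (heckeRep p i).1.det = p := by
  cases i <;> simp [heckeRep, Matrix.det_fin_two_of]

theorem exists_heckeRep (p : Nat.Primes) (A : FixedDetMatrix (Fin 2) ℤ (p : ℤ)) :
    ∃ (ε : SL(2, ℤ)) (j : Option (Fin p)), A.1 = ε.1 * (heckeRep p j).1 := by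
  have hp0 : (p : ℤ) ≠ 0 := by exact_mod_cast p.2.ne_zero
  refine FixedDetMatrices.induction_on (C := fun A => ∃ (ε : SL(2, ℤ)) (j : Option (Fin p)),
    A.1 = ε.1 * (heckeRep p j).1) hp0 ?_ ?_ ?_
  · intro A hc ha hb hlt
    have hdet : A.1 0 0 * A.1 1 1 = p := by
      have := A.2
      rw [Matrix.det_fin_two, hc] at this
      simpa using this
    have hd : 0 < A.1 1 1 := by
      have : (0 : ℤ) < p := by exact_mod_cast p.2.pos
      rw [← hdet] at this
      exact pos_of_mul_pos_right this ha.le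
    rw [abs_of_nonneg hb, abs_of_pos hd] at hlt
    refine ⟨1, ?_⟩
    obtain ⟨a, ha'⟩ := Int.eq_ofNat_of_zero_le ha.le
    obtain ⟨d, hd'⟩ := Int.eq_ofNat_of_zero_le hd.le
    obtain ⟨b, hb'⟩ := Int.eq_ofNat_of_zero_le hb
    have hadp : a * d = p := by
      rw [ha', hd'] at hdet
      exact_mod_cast hdet
    rcases (Nat.dvd_prime p.2).1 (Dvd.intro _ hadp) with h1 | h1
    · subst h1
      have hdp : d = p := by simpa using hadp
      have hbp : b < p := by
        rw [hb', hd', hdp] at hlt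
        exact_mod_cast hlt
      refine ⟨some ⟨b, hbp⟩, ?_⟩
      ext i j
      fin_cases i <;> fin_cases j <;> simp [heckeRep, hc, ha', hb', hd', hdp]
    · have hd1 : d = 1 := by
        rw [h1] at hadp
        exact Nat.eq_of_mul_eq_mul_left p.2.pos (by simpa using hadp)
      have hb0 : b = 0 := by
        rw [hb', hd', hd1] at hlt
        have : b < 1 := by exact_mod_cast hlt
        omega
      refine ⟨none, ?_⟩
      ext i j
      fin_cases i <;> fin_cases j <;> simp [heckeRep, hc, ha', hb', hd', hd1, hb0, h1]
  · intro B hB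
    obtain ⟨ε, j, h⟩ := hB
    exact ⟨ModularGroup.S * ε, j, by
      rw [FixedDetMatrices.smul_coe, h, Matrix.SpecialLinearGroup.coe_mul, mul_assoc]⟩
  · intro B hB
    obtain ⟨ε, j, h⟩ := hB
    exact ⟨ModularGroup.T * ε, j, by
      rw [FixedDetMatrices.smul_coe, h, Matrix.SpecialLinearGroup.coe_mul, mul_assoc]⟩

theorem heckeRep_unique (p : Nat.Primes) (i j : Option (Fin p)) (ε : SL(2, ℤ))
    (h : heckeRep p i = ofSL ε * heckeRep p j) : i = j := by
  have hp : (1 : ℤ) < p := by exact_mod_cast p.2.one_lt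
  have h' : (heckeRep p i).1 = ε.1 * (heckeRep p j).1 := congrArg Subtype.val h
  have hdet := ε.2
  rw [Matrix.det_fin_two] at hdet
  have h00 := congrFun (congrFun h' 0) 0
  have h01 := congrFun (congrFun h' 0) 1
  have h10 := congrFun (congrFun h' 1) 0
  have h11 := congrFun (congrFun h' 1) 1
  rw [Matrix.mul_apply, Fin.sum_univ_two] at h00 h01 h10 h11
  rcases i with _ | i <;> rcases j with _ | j
  · rfl
  · exfalso
    simp [heckeRep] at h00 h01 h10 h11
    rw [← h10] at h11
    simp at h11
    have : (p : ℤ) ∣ 1 := ⟨ε.1 1 1, by linarith⟩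
    have := Int.le_of_dvd one_pos this
    omega
  · exfalso
    simp [heckeRep] at h00 h01 h10 h11
    have : (p : ℤ) ∣ 1 := ⟨ε.1 0 0, by linarith⟩
    have := Int.le_of_dvd one_pos this
    omega
  · simp [heckeRep] at h00 h01 h10 h11
    rw [← h00] at h01
    have hi : (i : ℤ) < p := by exact_mod_cast i.2
    have hj : (j : ℤ) < p := by exact_mod_cast j.2
    have hdvd : (p : ℤ) ∣ (i : ℤ) - j := ⟨ε.1 0 1, by linarith⟩
    have h0 : (i : ℤ) - j = 0 := by
      apply Int.eq_zero_of_abs_lt_dvd hdvd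
      rw [abs_lt]
      constructor <;> omega
    congr 1
    apply Fin.ext
    omega

/-- Right multiplication by `γ ∈ Γ` permutes the cosets `Γ αᵢ`. -/
theorem heckeRep_perm (p : Nat.Primes) (γ : SL(2, ℤ)) :
    ∃ (π : Option (Fin p) → Option (Fin p)) (ε : Option (Fin p) → SL(2, ℤ)),
      Function.Bijective π ∧
      ∀ i, heckeRep p i * ofSL γ = ofSL (ε i) * heckeRep p (π i) := by
  have key : ∀ i, ∃ (ε : SL(2, ℤ)) (j : Option (Fin p)),
      heckeRep p i * ofSL γ = ofSL ε * heckeRep p j := fun i => by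
    obtain ⟨ε, j, h⟩ := exists_heckeRep p ⟨(heckeRep p i).1 * γ.1, by
      rw [Matrix.det_mul, heckeRep_det, γ.2, mul_one]⟩
    exact ⟨ε, j, Subtype.ext h⟩
  choose ε π h using key
  refine ⟨π, ε, Finite.injective_iff_bijective.1 fun i j hij => ?_, h⟩
  have h1 := h i
  rw [hij] at h1
  have h2 : heckeRep p (π j) = ofSL (ε j)⁻¹ * (heckeRep p j * ofSL γ) := by
    rw [h j, ← mul_assoc, ← map_mul, inv_mul_cancel, map_one, one_mul]
  rw [h2] at h1
  apply heckeRep_unique p i j (ε i * (ε j)⁻¹)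
  calc heckeRep p i = heckeRep p i * ofSL γ * ofSL γ⁻¹ := by
        rw [mul_assoc, ← map_mul, mul_inv_cancel, map_one, mul_one]
    _ = ofSL (ε i) * (ofSL (ε j)⁻¹ * (heckeRep p j * ofSL γ)) * ofSL γ⁻¹ := by rw [h1]
    _ = ofSL (ε i * (ε j)⁻¹) * heckeRep p j * (ofSL γ * ofSL γ⁻¹) := by
        rw [map_mul]; simp only [mul_assoc]
    _ = ofSL (ε i * (ε j)⁻¹) * heckeRep p j := by
        rw [← map_mul, mul_inv_cancel, map_one, mul_one]

section Hecke

variable {X : Type} [TopologicalSpace X] [MulAction M2pos X] [ContinuousConstSMul M2pos X]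
variable {R : Type} [CommRing R] {V : Type} [AddCommGroup V] [Module R V]

variable (X) in
/-- The Hecke operator `(φ | T_p')(σ) = ∑ᵢ α̃ᵢ φ(αᵢ σ)` on `Hom(S_q(X), V)`. -/
def heckeCochain (ρ : Representation R M2pos V) (p : Nat.Primes) (q : ℕ) :
    (Simplex q X → V) →ₗ[R] (Simplex q X → V) where
  toFun φ σ := ∑ i : Option (Fin p), ρ (adj (heckeRep p i)) (φ (heckeRep p i • σ))
  map_add' φ ψ := by
    funext σ
    simp only [Pi.add_apply, map_add, Finset.sum_add_distrib]
  map_smul' c φ := by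
    funext σ
    simp only [Pi.smul_apply, map_smul, RingHom.id_apply, Finset.smul_sum]

theorem heckeCochain_invariants (ρ : Representation R M2pos V) (p : Nat.Primes) (q : ℕ)
    (φ : Simplex q X → V) (hφ : φ ∈ invariants X ρ q) :
    heckeCochain X ρ p q φ ∈ invariants X ρ q := by
  intro γ σ
  obtain ⟨π, ε, hπ, h⟩ := heckeRep_perm p γ
  have step : ∀ i, ρ (adj (heckeRep p i)) (φ (heckeRep p i • ofSL γ • σ)) =
      ρ (ofSL γ) (ρ (adj (heckeRep p (π i))) (φ (heckeRep p (π i) • σ))) := fun i => by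
    have h1 : adj (heckeRep p i) * ofSL (ε i) = ofSL γ * adj (heckeRep p (π i)) := by
      have h2 := congrArg adj (h i)
      rw [adj_mul, adj_mul, adj_ofSL, adj_ofSL] at h2
      calc adj (heckeRep p i) * ofSL (ε i)
          = ofSL γ * (ofSL γ⁻¹ * adj (heckeRep p i)) * ofSL (ε i) := by
            rw [← mul_assoc, ← map_mul, mul_inv_cancel, map_one, one_mul]
        _ = ofSL γ * adj (heckeRep p (π i)) * (ofSL (ε i)⁻¹ * ofSL (ε i)) := by
            rw [h2]; simp only [mul_assoc]
        _ = ofSL γ * adj (heckeRep p (π i)) := by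
            rw [← map_mul, inv_mul_cancel, map_one, mul_one]
    rw [← mul_smul, h i, mul_smul, hφ (ε i), ← Module.End.mul_apply, ← map_mul, h1, map_mul,
      Module.End.mul_apply]
  change ∑ i, ρ (adj (heckeRep p i)) (φ (heckeRep p i • ofSL γ • σ)) =
    ρ (ofSL γ) (∑ i, ρ (adj (heckeRep p i)) (φ (heckeRep p i • σ)))
  rw [map_sum, Finset.sum_congr rfl fun i _ => step i]
  exact hπ.sum_comp (fun i => ρ (ofSL γ) (ρ (adj (heckeRep p i)) (φ (heckeRep p i • σ))))

theorem heckeCochain_coboundary (ρ : Representation R M2pos V) (p : Nat.Primes) (q : ℕ)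
    (φ : Simplex q X → V) :
    heckeCochain X ρ p (q + 1) (coboundary X R V q φ) =
      coboundary X R V q (heckeCochain X ρ p q φ) := by
  funext σ
  simp only [heckeCochain, coboundary, LinearMap.coe_mk, AddHom.coe_mk, face_smul, map_sum,
    Finset.smul_sum, map_zsmul]
  exact Finset.sum_comm

/-- The Hecke operator `T_p'` on `H¹(Γ \ X, V)`. -/
def hecke (ρ : Representation R M2pos V) (p : Nat.Primes) : H1 X ρ →ₗ[R] H1 X ρ :=
  H1.map ρ ρ (heckeCochain X ρ p 0) (heckeCochain X ρ p 1)
    (fun φ hφ => ⟨heckeCochain_invariants ρ p 1 φ hφ.1, by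
      have h2 : coboundary X R V 1 φ = 0 := hφ.2
      change coboundary X R V 1 _ = 0
      rw [← heckeCochain_coboundary, h2, map_zero]⟩)
    (heckeCochain_invariants ρ p 0) (heckeCochain_coboundary ρ p 0)

end Hecke

/-! ### The coefficient modules -/

section Coefficients

/-- The left action `(γ P)(X₁, X₂) = P(d X₁ - b X₂, -c X₁ + a X₂)` of `γ = (a, b; c, d)` on
`R[X₁, X₂]`. -/
def polyAct (R : Type) [CommRing R] (γ : M2pos) :
    MvPolynomial (Fin 2) R →ₐ[R] MvPolynomial (Fin 2) R :=
  MvPolynomial.aeval ![((γ.1 1 1 : ℤ) : MvPolynomial (Fin 2) R) * MvPolynomial.X 0 -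
      ((γ.1 0 1 : ℤ) : MvPolynomial (Fin 2) R) * MvPolynomial.X 1,
    -((γ.1 1 0 : ℤ) : MvPolynomial (Fin 2) R) * MvPolynomial.X 0 +
      ((γ.1 0 0 : ℤ) : MvPolynomial (Fin 2) R) * MvPolynomial.X 1]

theorem polyAct_one (R : Type) [CommRing R] : polyAct R 1 = AlgHom.id R _ := by
  apply MvPolynomial.algHom_ext
  intro i
  fin_cases i <;> simp [polyAct]

theorem polyAct_mul (R : Type) [CommRing R] (γ δ : M2pos) :
    polyAct R (γ * δ) = (polyAct R γ).comp (polyAct R δ) := by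
  apply MvPolynomial.algHom_ext
  intro i
  fin_cases i <;>
    simp [polyAct, Matrix.mul_apply, Fin.sum_univ_two] <;> ring

theorem polyAct_map {R S : Type} [CommRing R] [CommRing S] (f : R →+* S) (γ : M2pos)
    (P : MvPolynomial (Fin 2) R) :
    MvPolynomial.map f (polyAct R γ P) = polyAct S γ (MvPolynomial.map f P) := by
  induction P using MvPolynomial.induction_on with
  | C a => simp [polyAct]
  | add p q hp hq => simp only [map_add, hp, hq]
  | mul_X p i hp =>
    simp only [map_mul, hp]
    congr 1
    fin_cases i <;> simp [polyAct]

/-- The polynomial `binom(n, ν) X₁^(n-ν) X₂^ν`. -/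
def binomMonomial (R : Type) [CommRing R] (n ν : ℕ) : MvPolynomial (Fin 2) R :=
  (n.choose ν : MvPolynomial (Fin 2) R) * MvPolynomial.X 0 ^ (n - ν) * MvPolynomial.X 1 ^ ν

/-- `e_ν^♭ = (-1)^(n-ν) binom(n, ν) X₁^(n-ν) X₂^ν`. -/
def eFlat (R : Type) [CommRing R] (n ν : ℕ) : MvPolynomial (Fin 2) R :=
  (-1) ^ (n - ν) * binomMonomial R n ν

/-- `M_n^♭ ⊗ R`, the `R`-submodule of `R[X₁, X₂]` spanned by `e_0^♭, …, e_n^♭`. -/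
def Mflat (n : ℕ) (R : Type) [CommRing R] : Submodule R (MvPolynomial (Fin 2) R) :=
  Submodule.span R (Set.range fun ν : Fin (n + 1) => eFlat R n ν)

theorem neg_one_pow_mul_mem {n : ℕ} {R : Type} [CommRing R] (k : ℕ)
    (P : MvPolynomial (Fin 2) R) (hP : P ∈ Mflat n R) : (-1) ^ k * P ∈ Mflat n R := by
  rcases neg_one_pow_eq_or (MvPolynomial (Fin 2) R) k with h | h
  · rwa [h, one_mul]
  · rw [h, neg_one_mul]
    exact neg_mem hP

theorem binomMonomial_mem (R : Type) [CommRing R] {n ν : ℕ} (h : ν ≤ n) :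
    binomMonomial R n ν ∈ Mflat n R := by
  have h1 : eFlat R n ν ∈ Mflat n R :=
    Submodule.subset_span ⟨⟨ν, Nat.lt_succ_of_le h⟩, rfl⟩
  have h2 := neg_one_pow_mul_mem (n - ν) _ h1
  rwa [eFlat, ← mul_assoc, ← mul_pow, neg_one_mul, neg_neg, one_pow, one_mul] at h2

/-- The polynomial `(d - c s)^(n-μ) (a s - b)^μ` in `s`; its coefficients are the matrix entries
of the action of `γ` in the basis of the polynomials `binom(n, ν) X₁^(n-ν) X₂^ν`. -/
def actPoly (n : ℕ) (γ : M2pos) (μ : ℕ) : Polynomial ℤ :=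
  (Polynomial.C (γ.1 1 1) - Polynomial.C (γ.1 1 0) * Polynomial.X) ^ (n - μ) *
    (Polynomial.C (γ.1 0 0) * Polynomial.X - Polynomial.C (γ.1 0 1)) ^ μ

theorem actPoly_natDegree_le (n : ℕ) (γ : M2pos) {μ : ℕ} (h : μ ≤ n) :
    (actPoly n γ μ).natDegree ≤ n := by
  have h1 : (Polynomial.C (γ.1 1 1) - Polynomial.C (γ.1 1 0) * Polynomial.X).natDegree ≤ 1 := by
    compute_degree
  have h2 : (Polynomial.C (γ.1 0 0) * Polynomial.X - Polynomial.C (γ.1 0 1)).natDegree ≤ 1 := by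
    compute_degree
  have h3 := Polynomial.natDegree_pow_le_of_le (n - μ) h1
  have h4 := Polynomial.natDegree_pow_le_of_le μ h2
  refine (Polynomial.natDegree_mul_le_of_le h3 h4).trans ?_
  omega

theorem sum_binomMonomial (R : Type) [CommRing R] (n : ℕ) (x y : Polynomial (MvPolynomial (Fin 2) R)) :
    ∑ ν ∈ Finset.range (n + 1),
      Polynomial.C (binomMonomial R n ν) * (x ^ (n - ν) * y ^ ν) =
      (Polynomial.C (MvPolynomial.X 0) * x + Polynomial.C (MvPolynomial.X 1) * y) ^ n := by
  rw [add_comm (Polynomial.C (MvPolynomial.X 0) * x), add_pow]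
  refine Finset.sum_congr rfl fun ν _ => ?_
  simp only [binomMonomial, map_mul, map_pow, map_natCast]
  ring

theorem polyAct_binomMonomial (R : Type) [CommRing R] (n : ℕ) (γ : M2pos) {ν : ℕ} (h : ν ≤ n) :
    polyAct R γ (binomMonomial R n ν) = ∑ μ ∈ Finset.range (n + 1),
      ((actPoly n γ μ).coeff ν : R) • binomMonomial R n μ := by
  have h1 := congrArg (Polynomial.map (polyAct R γ).toRingHom)
    (sum_binomMonomial R n 1 Polynomial.X)
  simp only [one_pow, one_mul, mul_one, Polynomial.map_sum, Polynomial.map_mul, Polynomial.map_C,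
    Polynomial.map_pow, Polynomial.map_X, Polynomial.map_add] at h1
  have h2 := sum_binomMonomial R n
    (Polynomial.C ((γ.1 1 1 : ℤ) : MvPolynomial (Fin 2) R) -
      Polynomial.C ((γ.1 1 0 : ℤ) : MvPolynomial (Fin 2) R) * Polynomial.X)
    (Polynomial.C ((γ.1 0 0 : ℤ) : MvPolynomial (Fin 2) R) * Polynomial.X -
      Polynomial.C ((γ.1 0 1 : ℤ) : MvPolynomial (Fin 2) R))
  have h3 : (Polynomial.C ((polyAct R γ).toRingHom (MvPolynomial.X 0)) +
      Polynomial.C ((polyAct R γ).toRingHom (MvPolynomial.X 1)) *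
        Polynomial.X) =
      Polynomial.C (MvPolynomial.X 0) * (Polynomial.C ((γ.1 1 1 : ℤ) : MvPolynomial (Fin 2) R) -
      Polynomial.C ((γ.1 1 0 : ℤ) : MvPolynomial (Fin 2) R) * Polynomial.X) +
      Polynomial.C (MvPolynomial.X 1) * (Polynomial.C ((γ.1 0 0 : ℤ) : MvPolynomial (Fin 2) R) *
        Polynomial.X - Polynomial.C ((γ.1 0 1 : ℤ) : MvPolynomial (Fin 2) R)) := by
    simp only [polyAct, AlgHom.toRingHom_eq_coe, RingHom.coe_coe, MvPolynomial.aeval_X, Matrix.cons_val_zero,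
      Matrix.cons_val_one, map_sub, map_add, map_mul, map_neg]
    ring
  rw [h3, ← h2] at h1
  have h4 := congrArg (fun P => Polynomial.coeff P ν) h1
  simp only [Polynomial.finsetSum_coeff, Polynomial.coeff_C_mul, Polynomial.coeff_X_pow] at h4
  rw [Finset.sum_eq_single ν] at h4
  · rw [if_pos rfl, mul_one] at h4
    refine h4.trans (Finset.sum_congr rfl fun μ _ => ?_)
    have h5 : (Polynomial.C ((γ.1 1 1 : ℤ) : MvPolynomial (Fin 2) R) -
        Polynomial.C ((γ.1 1 0 : ℤ) : MvPolynomial (Fin 2) R) * Polynomial.X) ^ (n - μ) *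
        (Polynomial.C ((γ.1 0 0 : ℤ) : MvPolynomial (Fin 2) R) * Polynomial.X -
        Polynomial.C ((γ.1 0 1 : ℤ) : MvPolynomial (Fin 2) R)) ^ μ =
        (actPoly n γ μ).map (Int.castRingHom _) := by
      simp [actPoly]
    rw [h5, Polynomial.coeff_map, MvPolynomial.smul_eq_C_mul, mul_comm]
    simp
  · intro b _ hb
    rw [if_neg (Ne.symm hb), mul_zero]
  · intro hν
    exact absurd (Finset.mem_range.2 (Nat.lt_succ_of_le h)) hν

theorem polyAct_mem (n : ℕ) (R : Type) [CommRing R] (γ : M2pos) (P : MvPolynomial (Fin 2) R)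
    (hP : P ∈ Mflat n R) : polyAct R γ P ∈ Mflat n R := by
  induction hP using Submodule.span_induction with
  | mem x hx =>
    obtain ⟨ν, rfl⟩ := hx
    have hν : (ν : ℕ) ≤ n := Nat.lt_succ_iff.1 ν.2
    simp only [eFlat, map_mul, map_pow, map_neg, map_one]
    apply neg_one_pow_mul_mem
    rw [polyAct_binomMonomial R n γ hν]
    exact Submodule.sum_mem _ fun μ hμ => Submodule.smul_mem _ _
      (binomMonomial_mem R (Nat.lt_succ_iff.1 (Finset.mem_range.1 hμ)))
  | zero => simp
  | add x y _ _ hx hy =>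
    rw [map_add]
    exact add_mem hx hy
  | smul a x _ hx =>
    rw [map_smul]
    exact Submodule.smul_mem _ _ hx

/-- The action of `M₂⁺(ℤ)` on `M_n^♭ ⊗ R`. -/
def flatRep (n : ℕ) (R : Type) [CommRing R] : Representation R M2pos (Mflat n R) where
  toFun γ := (polyAct R γ).toLinearMap.restrict (polyAct_mem n R γ)
  map_one' := by
    ext P : 2
    change polyAct R 1 P.1 = P.1
    rw [polyAct_one]
    rfl
  map_mul' γ δ := by
    ext P : 2
    change polyAct R (γ * δ) P.1 = polyAct R γ (polyAct R δ P.1)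
    rw [polyAct_mul]
    rfl

theorem map_mem_Mflat (n : ℕ) {R S : Type} [CommRing R] [CommRing S] (f : R →+* S)
    (P : MvPolynomial (Fin 2) R) (hP : P ∈ Mflat n R) : MvPolynomial.map f P ∈ Mflat n S := by
  induction hP using Submodule.span_induction with
  | mem x hx =>
    obtain ⟨ν, rfl⟩ := hx
    exact Submodule.subset_span ⟨ν, by simp [eFlat, binomMonomial]⟩
  | zero => simp
  | add x y _ _ hx hy =>
    rw [map_add]
    exact add_mem hx hy
  | smul a x _ hx =>
    rw [MvPolynomial.smul_eq_C_mul, map_mul, MvPolynomial.map_C, ← MvPolynomial.smul_eq_C_mul]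
    exact Submodule.smul_mem _ _ hx

/-- The map `M_n^♭ ⊗ R → M_n^♭ ⊗ S` given by a ring homomorphism `R → S`. -/
def flatMap (n : ℕ) {R S : Type} [CommRing R] [CommRing S] (f : R →+* S) :
    Mflat n R →ₛₗ[f] Mflat n S where
  toFun P := ⟨MvPolynomial.map f P.1, map_mem_Mflat n f P.1 P.2⟩
  map_add' P Q := Subtype.ext (map_add _ _ _)
  map_smul' a P := by
    apply Subtype.ext
    simp [MvPolynomial.smul_eq_C_mul]

/-- The natural map `H¹(Γ \ X, M_n^♭ ⊗ R) → H¹(Γ \ X, M_n^♭ ⊗ S)`. -/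
def baseChange (X : Type) [TopologicalSpace X] [MulAction M2pos X] [ContinuousConstSMul M2pos X]
    (n : ℕ) {R S : Type} [CommRing R] [CommRing S] (f : R →+* S) :
    H1 X (flatRep n R) →ₛₗ[f] H1 X (flatRep n S) :=
  H1.coeffMap _ _ (flatMap n f) fun γ P => Subtype.ext (polyAct_map f γ P.1)

/-- The pairing `⟨P, e_0⟩` of `P ∈ M_n^♭ ⊗ R` with `e_0 = X₂^n`: since `⟨e_ν^♭, e_0⟩` is `1` for
`ν = 0` and `0` otherwise, it is the coefficient of `P` at `e_0^♭ = (-1)^n X₁^n`. -/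
def pairE0 (n : ℕ) {R : Type} [CommRing R] (P : Mflat n R) : R :=
  (-1) ^ n * MvPolynomial.coeff (Finsupp.single 0 n) P.1

/-- Restriction `H¹(Y^BS, M_n^♭ ⊗ R) → H¹(∂Y^BS, M_n^♭ ⊗ R)`. -/
def resBoundary (n : ℕ) (R : Type) [CommRing R] :
    H1 HBS (flatRep n R) →ₗ[R] H1 BSBoundary (flatRep n R) :=
  H1.pullback inclBoundary (fun _ _ => rfl) _

/-- Restriction `H¹(Y^BS, M_n^♭ ⊗ R) → H¹(Y, M_n^♭ ⊗ R)`. -/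
def resInner (n : ℕ) (R : Type) [CommRing R] :
    H1 HBS (flatRep n R) →ₗ[R] H1 ℍ (flatRep n R) :=
  H1.pullback inclInner (fun _ _ => rfl) _

end Coefficients

/-! ### The Eichler--Shimura homomorphism -/

section EichlerShimura

/-- `f(z) (-z)^ν`, as a function on the complex numbers of positive imaginary part. -/
def esIntegrand (f : ℍ → ℂ) (ν : ℕ) (z : ℂ) : ℂ := f (UpperHalfPlane.ofComplex z) * (-z) ^ ν

/-- The integral of `g(z) dz` along the segment from `α` to `β`. -/
def segmentIntegral (g : ℂ → ℂ) (α β : ℂ) : ℂ :=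
  ∫ t in (0 : ℝ)..1, g (α + t * (β - α)) * (β - α)

/-- For a path `σ` in `ℍ` from `α` to `β`, the polynomial
`∫_α^β f(z) (X₁ - z X₂)^n dz = ∑_ν (∫_α^β f(z) (-z)^ν dz) binom(n, ν) X₁^(n-ν) X₂^ν`.
The integrals are taken along the segment from `α` to `β`; for a holomorphic `f` they depend on
the end points only. -/
def esCochain (n : ℕ) (f : ℍ → ℂ) (σ : Simplex 1 ℍ) : Mflat n ℂ :=
  ∑ ν : Fin (n + 1), segmentIntegral (esIntegrand f ν) (σ (stdSimplex.vertex 0))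
    (σ (stdSimplex.vertex 1)) •
      (⟨binomMonomial ℂ n ν, binomMonomial_mem ℂ (Nat.lt_succ_iff.1 ν.2)⟩ : Mflat n ℂ)

theorem esIntegrand_differentiableOn {k : ℤ} (f : ModularForm 𝒮ℒ k) (ν : ℕ) :
    DifferentiableOn ℂ (esIntegrand f ν) {z : ℂ | 0 < z.im} := by
  have h := UpperHalfPlane.mdifferentiable_iff.1 f.holo'
  exact h.mul (by fun_prop)

/-- A primitive on the upper half plane. -/
theorem exists_primitive {k : ℤ} (f : ModularForm 𝒮ℒ k) (ν : ℕ) :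
    ∃ F : ℂ → ℂ, ∀ z : ℂ, 0 < z.im → HasDerivAt F (esIntegrand f ν z) z := by
  obtain ⟨F, hF⟩ := (convex_halfSpace_im_gt 0).exists_forall_hasDerivWithinAt
    (esIntegrand_differentiableOn f ν)
  exact ⟨F, fun z hz => (hF z hz).hasDerivAt
    ((isOpen_lt continuous_const Complex.continuous_im).mem_nhds hz)⟩

theorem segmentIntegral_eq {g F : ℂ → ℂ} (hg : ContinuousOn g {z : ℂ | 0 < z.im})
    (hF : ∀ z : ℂ, 0 < z.im → HasDerivAt F (g z) z) (α β : ℍ) :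
    segmentIntegral g α β = F β - F α := by
  have him : ∀ t ∈ Set.uIcc (0 : ℝ) 1, 0 < ((α : ℂ) + t * ((β : ℂ) - α)).im := by
    intro t ht
    rw [Set.uIcc_of_le zero_le_one] at ht
    have h1 : ((α : ℂ) + t * ((β : ℂ) - α)).im = (1 - t) * α.im + t * β.im := by
      simp
      ring
    rw [h1]
    have ha := α.im_pos
    have hb := β.im_pos
    rcases eq_or_lt_of_le ht.1 with h0 | h0
    · subst h0
      simpa using ha
    · have h2 : 0 ≤ (1 - t) * α.im := mul_nonneg (by linarith [ht.2]) ha.le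
      have h3 : 0 < t * β.im := mul_pos h0 hb
      linarith
  have hl : ∀ t : ℝ, HasDerivAt (fun t : ℝ => (α : ℂ) + t * ((β : ℂ) - α)) ((β : ℂ) - α) t := by
    intro t
    have h1 : HasDerivAt (fun t : ℝ => (t : ℂ)) 1 t := Complex.ofRealCLM.hasDerivAt
    simpa using (h1.mul_const ((β : ℂ) - α)).const_add (α : ℂ)
  have hd : ∀ t ∈ Set.uIcc (0 : ℝ) 1,
      HasDerivAt (fun t : ℝ => F ((α : ℂ) + t * ((β : ℂ) - α)))
        (g ((α : ℂ) + t * ((β : ℂ) - α)) * ((β : ℂ) - α)) t := by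
    intro t ht
    exact (hF _ (him t ht)).comp t (hl t)
  have hc : ContinuousOn (fun t : ℝ => g ((α : ℂ) + t * ((β : ℂ) - α)) * ((β : ℂ) - α))
      (Set.uIcc (0 : ℝ) 1) := by
    refine ContinuousOn.mul (hg.comp (Continuous.continuousOn (by fun_prop)) ?_)
      continuousOn_const
    intro t ht
    exact him t ht
  rw [segmentIntegral, intervalIntegral.integral_eq_sub_of_hasDerivAt hd hc.intervalIntegrable]
  simp

theorem esCochain_eq {n : ℕ} {k : ℤ} (f : ModularForm 𝒮ℒ k) :
    ∃ F : ℕ → ℂ → ℂ, (∀ ν, ∀ z : ℂ, 0 < z.im → HasDerivAt (F ν) (esIntegrand f ν z) z) ∧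
      ∀ σ : Simplex 1 ℍ, (esCochain n f σ).1 = ∑ ν ∈ Finset.range (n + 1),
        (F ν (σ (stdSimplex.vertex 1)) - F ν (σ (stdSimplex.vertex 0))) • binomMonomial ℂ n ν := by
  choose F hF using fun ν => exists_primitive f ν
  refine ⟨F, hF, fun σ => ?_⟩
  rw [Finset.sum_range]
  simp only [esCochain, Submodule.coe_sum, Submodule.coe_smul]
  refine Finset.sum_congr rfl fun ν _ => ?_
  rw [segmentIntegral_eq (esIntegrand_differentiableOn f ν).continuousOn (hF ν)]

theorem esCochain_closed {n : ℕ} {k : ℤ} (f : ModularForm 𝒮ℒ k) :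
    coboundary ℍ ℂ (Mflat n ℂ) 1 (esCochain n f) = 0 := by
  obtain ⟨F, -, h⟩ := esCochain_eq (n := n) f
  funext σ
  apply Subtype.ext
  have hv : ∀ (i : Fin 3) (j : Fin 2),
      face i σ (stdSimplex.vertex j) = σ (stdSimplex.vertex (i.succAbove j)) := fun i j => by
    change σ (stdSimplex.map i.succAbove (stdSimplex.vertex j)) = _
    rw [stdSimplex.map_vertex]
  change (∑ i : Fin 3, (-1 : ℤ) ^ (i : ℕ) • esCochain n f (face i σ)).1 = 0
  rw [Fin.sum_univ_three]
  have p0 : (-1 : ℤ) ^ ((0 : Fin 3) : ℕ) = 1 := rfl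
  have p1 : (-1 : ℤ) ^ ((1 : Fin 3) : ℕ) = -1 := rfl
  have p2 : (-1 : ℤ) ^ ((2 : Fin 3) : ℕ) = 1 := rfl
  rw [p0, p1, p2, one_smul, one_smul, neg_smul, one_smul, Submodule.coe_add, Submodule.coe_add,
    Submodule.coe_neg, h, h, h]
  simp only [hv, ← Finset.sum_neg_distrib, ← Finset.sum_add_distrib]
  refine Finset.sum_eq_zero fun ν _ => ?_
  have e1 : (0 : Fin 3).succAbove (0 : Fin 2) = 1 := rfl
  have e2 : (0 : Fin 3).succAbove (1 : Fin 2) = 2 := rfl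
  have e3 : (1 : Fin 3).succAbove (0 : Fin 2) = 0 := rfl
  have e4 : (1 : Fin 3).succAbove (1 : Fin 2) = 2 := rfl
  have e5 : (2 : Fin 3).succAbove (0 : Fin 2) = 0 := rfl
  have e6 : (2 : Fin 3).succAbove (1 : Fin 2) = 1 := rfl
  simp only [e1, e2, e3, e4, e5, e6, sub_smul]
  abel

theorem esCochain_invariant {n : ℕ} (f : ModularForm 𝒮ℒ ((n + 2 : ℕ) : ℤ)) :
    esCochain n f ∈ invariants ℍ (flatRep n ℂ) 1 := by
  obtain ⟨F, hF, h⟩ := esCochain_eq (n := n) f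
  intro γ σ
  apply Subtype.ext
  change (esCochain n f (ofSL γ • σ)).1 = polyAct ℂ (ofSL γ) (esCochain n f σ).1
  rw [h, h, map_sum]
  set a : ℤ := γ.1 0 0
  set b : ℤ := γ.1 0 1
  set c : ℤ := γ.1 1 0
  set d : ℤ := γ.1 1 1
  have hdet : (a : ℂ) * d - b * c = 1 := by
    have h1 := γ.2
    rw [Matrix.det_fin_two] at h1
    exact_mod_cast h1
  have hmob : ∀ z : ℍ, ((ofSL γ • z : ℍ) : ℂ) = (a * z + b) / (c * z + d) := fun z => by
    rw [smulH_def, UpperHalfPlane.coe_smul_of_det_pos (toGL_det_pos _)]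
    simp [UpperHalfPlane.num, UpperHalfPlane.denom, toGL_apply, ofSL, a, b, c, d]
  have hne : ∀ z : ℍ, (c : ℂ) * z + d ≠ 0 := fun z => by
    have h1 := UpperHalfPlane.denom_ne_zero (toGL ℝ (ofSL γ)) z
    simpa [UpperHalfPlane.denom, toGL_apply, ofSL, a, b, c, d] using h1
  have hmod : ∀ z : ℍ, f (ofSL γ • z) = (c * z + d) ^ (n + 2) * f z := fun z => by
    have h1 : (toGL ℝ (ofSL γ)) = Matrix.SpecialLinearGroup.mapGL ℝ γ := by
      ext i j
      simp [toGL_apply, ofSL]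
    have h2 := SlashInvariantForm.slash_action_eqn' f
      (show Matrix.SpecialLinearGroup.mapGL ℝ γ ∈ 𝒮ℒ from ⟨γ, rfl⟩) z
    rw [smulH_def, h1, h2, zpow_natCast]
    simp [c, d]
  -- the two primitives of the transformed integrand
  have hprim : ∀ μ ≤ n, ∀ α β : ℍ,
      F μ ((ofSL γ • β : ℍ) : ℂ) - F μ ((ofSL γ • α : ℍ) : ℂ) =
      ∑ ν ∈ Finset.range (n + 1), ((actPoly n (ofSL γ) μ).coeff ν : ℂ) * (F ν β - F ν α) := by
    intro μ hμ α β
    set D : ℂ → ℂ := fun z => F μ ((a * z + b) / (c * z + d)) -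
      ∑ ν ∈ Finset.range (n + 1), ((actPoly n (ofSL γ) μ).coeff ν : ℂ) * F ν z with hD
    have hderiv : ∀ z ∈ {z : ℂ | 0 < z.im}, HasDerivAt D 0 z := by
      intro z hz
      lift z to ℍ using hz
      have h1 : HasDerivAt (fun w : ℂ => (a * w + b) / (c * w + d)) (1 / (c * z + d) ^ 2) z := by
        have hn : HasDerivAt (fun w : ℂ => a * w + b) a (z : ℂ) := by
          simpa using ((hasDerivAt_id (z : ℂ)).const_mul (a : ℂ)).add_const (b : ℂ)
        have hd' : HasDerivAt (fun w : ℂ => c * w + d) c (z : ℂ) := by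
          simpa using ((hasDerivAt_id (z : ℂ)).const_mul (c : ℂ)).add_const (d : ℂ)
        have h3 := hn.div hd' (hne z)
        have h4 : ((a : ℂ) * (c * z + d) - (a * z + b) * c) = 1 := by
          linear_combination hdet
        rw [h4] at h3
        exact h3
      have h2 : HasDerivAt (F μ) (esIntegrand f μ ((ofSL γ • z : ℍ) : ℂ))
          ((a * (z : ℂ) + b) / (c * z + d)) := by
        rw [← hmob]
        exact hF μ _ (ofSL γ • z).im_pos
      have h3 := h2.comp (z : ℂ) h1
      have h4 : HasDerivAt (fun w => ∑ ν ∈ Finset.range (n + 1),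
          ((actPoly n (ofSL γ) μ).coeff ν : ℂ) * F ν w)
          (∑ ν ∈ Finset.range (n + 1),
          ((actPoly n (ofSL γ) μ).coeff ν : ℂ) * esIntegrand f ν z) z :=
        HasDerivAt.fun_sum fun ν _ => (hF ν z z.im_pos).const_mul _
      have h5 := h3.sub h4
      have h6 : esIntegrand f μ ((ofSL γ • z : ℍ) : ℂ) * (1 / (c * (z : ℂ) + d) ^ 2) =
          ∑ ν ∈ Finset.range (n + 1),
          ((actPoly n (ofSL γ) μ).coeff ν : ℂ) * esIntegrand f ν z := by
        have h7 : ∑ ν ∈ Finset.range (n + 1), ((actPoly n (ofSL γ) μ).coeff ν : ℂ) * (-(z : ℂ)) ^ ν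
            = ((d : ℂ) + c * z) ^ (n - μ) * (-(a * z) - b) ^ μ := by
          have h8 := Polynomial.eval₂_eq_sum_range' (Int.castRingHom ℂ)
            (Nat.lt_succ_of_le (actPoly_natDegree_le n (ofSL γ) hμ)) (-(z : ℂ))
          simp only [eq_intCast] at h8
          rw [← h8]
          simp only [actPoly, Polynomial.eval₂_mul, Polynomial.eval₂_pow, Polynomial.eval₂_sub,
            Polynomial.eval₂_C, Polynomial.eval₂_X]
          simp only [eq_intCast]
          congr 2
          · change (d : ℂ) - c * (-z) = d + c * z
            ring
          · change (a : ℂ) * (-z) - b = -(a * z) - b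
            ring
        simp only [esIntegrand, UpperHalfPlane.ofComplex_apply]
        have h9 : ∑ ν ∈ Finset.range (n + 1),
            ((actPoly n (ofSL γ) μ).coeff ν : ℂ) * (f z * (-(z : ℂ)) ^ ν) =
            f z * (((d : ℂ) + c * z) ^ (n - μ) * (-(a * z) - b) ^ μ) := by
          rw [← h7, Finset.mul_sum]
          exact Finset.sum_congr rfl fun ν _ => by ring
        rw [h9, hmod, hmob]
        have hz := hne z
        obtain ⟨m, rfl⟩ := Nat.exists_eq_add_of_le hμ
        rw [Nat.add_sub_cancel_left, ← neg_div, div_pow]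
        field_simp
        ring
      rw [h6, sub_self] at h5
      exact h5
    have hconst : D β = D α := by
      have hconv := convex_halfSpace_im_gt 0
      refine hconv.is_const_of_fderivWithin_eq_zero (𝕜 := ℂ)
        (fun z hz => (hderiv z hz).differentiableAt.differentiableWithinAt) ?_ β.im_pos α.im_pos
      intro z hz
      have h1 := ((hderiv z hz).hasFDerivAt.hasFDerivWithinAt (s := {z : ℂ | 0 < z.im})).fderivWithin
        ((isOpen_lt continuous_const Complex.continuous_im).uniqueDiffWithinAt hz)
      rw [h1]
      ext
      simp
    simp only [hD] at hconst
    rw [hmob, hmob]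
    simp only [mul_sub, Finset.sum_sub_distrib]
    linear_combination hconst
  change ∑ μ ∈ Finset.range (n + 1),
    (F μ ((ofSL γ • σ (stdSimplex.vertex 1) : ℍ) : ℂ) -
      F μ ((ofSL γ • σ (stdSimplex.vertex 0) : ℍ) : ℂ)) • binomMonomial ℂ n μ = _
  have hR : ∀ ν ∈ Finset.range (n + 1),
      polyAct ℂ (ofSL γ) ((F ν (σ (stdSimplex.vertex 1)) - F ν (σ (stdSimplex.vertex 0))) •
        binomMonomial ℂ n ν) = ∑ μ ∈ Finset.range (n + 1),
      (((actPoly n (ofSL γ) μ).coeff ν : ℂ) *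
        (F ν (σ (stdSimplex.vertex 1)) - F ν (σ (stdSimplex.vertex 0)))) • binomMonomial ℂ n μ := by
    intro ν hν
    rw [map_smul, polyAct_binomMonomial ℂ n _ (Nat.lt_succ_iff.1 (Finset.mem_range.1 hν)),
      Finset.smul_sum]
    refine Finset.sum_congr rfl fun μ _ => ?_
    rw [smul_smul, mul_comm]
  rw [Finset.sum_congr rfl hR, Finset.sum_comm]
  refine Finset.sum_congr rfl fun μ hμ => ?_
  rw [hprim μ (Nat.lt_succ_iff.1 (Finset.mem_range.1 hμ)), Finset.sum_smul]

/-- The Eichler--Shimura map `r : M_{n+2}(Γ) → H¹(Y, M_n^♭ ⊗ ℂ)`. -/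
def eichlerShimura (n : ℕ) (f : ModularForm 𝒮ℒ ((n + 2 : ℕ) : ℤ)) : H1 ℍ (flatRep n ℂ) :=
  H1.mk _ ⟨esCochain n f, esCochain_invariant f, esCochain_closed f⟩

/-- The Eisenstein series `E_{n+2}(z) = 1 + (2 / ζ(-1-n)) ∑_{k ≥ 1} σ_{n+1}(k) e^{2 π i k z}` for
an even integer `n ≥ 2`. -/
def eisenstein (n : ℕ) (hn : 2 ≤ n) (heven : Even n) : ModularForm 𝒮ℒ ((n + 2 : ℕ) : ℤ) :=
  (ModularForm.E (show 3 ≤ n + 2 by omega)).copy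
    (fun z => 1 + 2 / riemannZeta (-1 - n) *
      ∑' k : ℕ+, (ArithmeticFunction.sigma (n + 1) k : ℂ) *
        Complex.exp (2 * Real.pi * Complex.I * k * z))
    (by
      funext z
      rw [EisensteinSeries.q_expansion_bernoulli (show 3 ≤ n + 2 by omega)
        (heven.add even_two) z]
      have h1 : riemannZeta (-1 - n) = -(bernoulli (n + 2) : ℂ) / (n + 2) := by
        have h2 := riemannZeta_neg_nat_eq_bernoulli (n + 1)
        rw [heven.add_one.neg_one_pow] at h2
        have h3 : (-1 - n : ℂ) = -((n + 1 : ℕ) : ℂ) := by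
          push_cast
          ring
        rw [h3, h2]
        push_cast
        ring
      have h4 : (2 : ℂ) / riemannZeta (-1 - n) =
          -(2 * ((n + 2 : ℕ) : ℂ) / bernoulli (n + 2)) := by
        rw [h1, neg_div, div_neg, div_div_eq_mul_div]
        push_cast
        rfl
      rw [h4, sub_eq_add_neg, neg_mul]
      congr 3
      refine tsum_congr fun k => ?_
      rw [zpow_natCast, ← Complex.exp_nat_mul]
      congr 2
      ring)

end EichlerShimura

/-! ### The boundary generator and the Hecke-equivariant section -/

/-- The path `t ↦ x + t`, `0 ≤ t ≤ 1`, from `x` to `x + 1` in the boundary component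
`ℝ = ℙ¹(ℝ) ∖ {∞}` of the cusp `∞`. -/
def boundaryPath (x : ℝ) : Simplex 1 BSBoundary where
  toFun t := bdInfty (x + t 1)
  continuous_toFun := by
    have h : (HBS.bd ∘ fun t : stdSimplex ℝ (Fin 2) => bdInfty (x + t 1)) =
        (fun w => (1 : M2pos) • chartInfty w) ∘
          (fun t : stdSimplex ℝ (Fin 2) => ((x + t 1, 0) : ℝ × ℝ≥0)) := by
      funext t
      simp [chartInfty]
    refine continuous_induced_rng.2 ?_
    rw [h]
    refine (continuous_chart 1).comp (Continuous.prodMk (continuous_const.add ?_) continuous_const)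
    exact (continuous_apply 1).comp continuous_subtype_val

/-- `ω ∈ H¹(∂Y^BS, M_n^♭)` is the natural generator of `H¹(∂Y^BS, M_n^♭)/(torsion)`: it generates
this group, and its pairing with the cycle `{x, x+1} ⊗ e_0` on the boundary is `1`. -/
def IsBoundaryGenerator (n : ℕ) (ω : H1 BSBoundary (flatRep n ℤ)) : Prop :=
  (∀ c : H1 BSBoundary (flatRep n ℤ), ∃ k m : ℤ, m ≠ 0 ∧ m • (c - k • ω) = 0) ∧
  ∀ φ : Z1 BSBoundary (flatRep n ℤ), H1.mk _ φ = ω →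
    ∀ x : ℝ, pairE0 n (φ.1 (boundaryPath x)) = 1

/-- `s` is a Hecke-equivariant section of the restriction map
`H¹(Y^BS, M_n^♭ ⊗ ℚ) → H¹(∂Y^BS, M_n^♭ ⊗ ℚ)`. -/
def IsHeckeSection (n : ℕ)
    (s : H1 BSBoundary (flatRep n ℚ) →ₗ[ℚ] H1 HBS (flatRep n ℚ)) : Prop :=
  (∀ c, resBoundary n ℚ (s c) = c) ∧
  ∀ (p : Nat.Primes) (c : H1 BSBoundary (flatRep n ℚ)),
    s (hecke (flatRep n ℚ) p c) = hecke (flatRep n ℚ) p (s c)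

/-- A class in `H¹(Y^BS, M_n^♭ ⊗ ℂ)` is rational if it lies in `H¹(Y^BS, M_n^♭) ⊗ ℚ`, i.e. if it
is the image of an integral class divided by a positive integer. -/
def IsRational (n : ℕ) (e : H1 HBS (flatRep n ℂ)) : Prop :=
  ∃ N : ℕ, N ≠ 0 ∧ ∃ c : H1 HBS (flatRep n ℤ),
    (N : ℂ) • e = baseChange HBS n (Int.castRingHom ℂ) c

end EisensteinClass

end

open EisensteinClass

/-! Singular classes are first translated into group cocycles. Singular one-cocycles on `ℍ` and on
`ℍ^BS` have primitives, so an invariant cocycle is the variation `dPrim ψ` of a function on points,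
and its invariance says `ψ(γx) = γψ(x) + c(γ)` for a group cocycle `c` (`exists_dPrim_HBS`,
`hasCocycle_of_mem`). The class vanishes exactly when `c` is a coboundary (`cls_eq_zero_iff`).
Conversely, stabilizers in `ℍ^BS` are finite of bounded order, so after multiplication by one
integer every group cocycle is realised on `ℍ^BS` (`exists_hasCocycle`). These facts take the place
of the homotopy equivalence between `ℍ` and `ℍ^BS`.

On the boundary everything is induced from the component of `∞`, where only `±T^k` acts. Up to
torsion the class is measured by the value at `(1, 0)` of the period of the cocycle along `x → x +
1`, because the kernel of this value is, up to multiples, the image of `T - 1`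
(`exists_smul_eq_transT_sub`, `bdPairing_injective`, `isBoundaryGenerator_iff`).

The class of `E_{n+2}` has eigenvalue `1 + p^(n+1)` under `T_p'`, by the identity for divisor sums
`sigma_prime_mul`, and boundary value `1`, since `E_{n+2}` tends to `1` at `i∞`
(`ev_period_eq_one`).

The heart is uniqueness, `eq_zero_of_resBoundary_eq_zero`: over `ℂ`, a class with these eigenvalues
that vanishes on the boundary is zero. Its cocycle may be taken to vanish at `T`. Averaging over
short primitive vectors then gives `ψ` on `ℍ` whose variation between nearby points is at most `M
Q_x(w)^m` at each integral vector `w`, where `n = 2m` and `Q_x(w) = |w₀ - w₁x|² / Im x`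
(`exists_variationBound`). The Hecke operator enlarges this bound by at most `(p + 1)p^m`
(`VariationBound.heckeFun`), less than the eigenvalue already for `p = 2`. Iterating the operator
divided by the eigenvalue gives functions in the same class with variation tending to zero, and
closedness of a finite-dimensional subspace turns this into an exact coboundary
(`exists_ofSL_S_eq`).

Rationality follows without computing a period. A `ℚ`-linear retraction `ℂ → ℚ`, applied to
coefficients, commutes with integral matrices (`flatProj_flatRep`), so it carries the Eisenstein
cocycle to a rational one with the same eigenvalues and boundary value. Its class becomes
`r(E_{n+2})` over `ℂ` by uniqueness. The section sends a boundary class to its pairing times this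
rational class, and uniqueness of the section is the same vanishing statement again. -/

noncomputable section
namespace EisensteinClass

/-! ### Primitives of singular one-cocycles -/

section Primitives

variable {X : Type} [TopologicalSpace X] {R : Type} [CommRing R] {V : Type} [AddCommGroup V]
  [Module R V]

/-- The one-cochain `σ ↦ ψ (σ(v₁)) - ψ (σ(v₀))`. -/
def dPrim (ψ : X → V) : Simplex 1 X → V :=
  fun σ => ψ (σ (stdSimplex.vertex 1)) - ψ (σ (stdSimplex.vertex 0))

theorem dPrim_sub (ψ ψ' : X → V) : dPrim (fun x => ψ x - ψ' x) = dPrim ψ - dPrim ψ' := by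
  funext σ
  simp only [dPrim, Pi.sub_apply]
  abel

theorem dPrim_smul (a : R) (ψ : X → V) : dPrim (fun x => a • ψ x) = a • dPrim ψ := by
  funext σ
  simp only [dPrim, Pi.smul_apply, smul_sub]

theorem dPrim_sub_const (ψ : X → V) (v : V) : dPrim (fun x => ψ x - v) = dPrim ψ := by
  funext σ
  simp [dPrim]

/-- The singular simplex `t ↦ F (∑ tᵢ pᵢ)`. -/
def affineSimplex {E : Type} [AddCommGroup E] [Module ℝ E] [TopologicalSpace E]
    [ContinuousAdd E] [ContinuousSMul ℝ E] {q : ℕ} (F : C(E, X)) (p : Fin (q + 1) → E) :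
    Simplex q X where
  toFun t := F (∑ i, t i • p i)
  continuous_toFun := by
    refine F.continuous.comp (continuous_finsetSum _ fun i _ => Continuous.smul ?_ continuous_const)
    exact (continuous_apply i).comp continuous_subtype_val

theorem affineSimplex_apply {E : Type} [AddCommGroup E] [Module ℝ E] [TopologicalSpace E]
    [ContinuousAdd E] [ContinuousSMul ℝ E] {q : ℕ} (F : C(E, X)) (p : Fin (q + 1) → E)
    (t : stdSimplex ℝ (Fin (q + 1))) : affineSimplex F p t = F (∑ i, t i • p i) := rfl

theorem affineSimplex_vertex {E : Type} [AddCommGroup E] [Module ℝ E] [TopologicalSpace E]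
    [ContinuousAdd E] [ContinuousSMul ℝ E] {q : ℕ} (F : C(E, X)) (p : Fin (q + 1) → E)
    (i : Fin (q + 1)) : affineSimplex F p (stdSimplex.vertex i) = F (p i) := by
  rw [affineSimplex_apply]
  congr 1
  rw [Finset.sum_eq_single i]
  · simp
  · intro j _ hj
    simp [hj]
  · simp

theorem face_affineSimplex {E : Type} [AddCommGroup E] [Module ℝ E] [TopologicalSpace E]
    [ContinuousAdd E] [ContinuousSMul ℝ E] {q : ℕ} (F : C(E, X)) (p : Fin (q + 2) → E)
    (i : Fin (q + 2)) : face i (affineSimplex F p) = affineSimplex F (p ∘ i.succAbove) := by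
  ext t
  change F (∑ j, stdSimplex.map i.succAbove t j • p j) = F (∑ j, t j • p (i.succAbove j))
  congr 1
  simp only [stdSimplex.map_coe, FunOnFinite.linearMap_apply_apply, Finset.sum_smul]
  rw [← Finset.sum_fiberwise Finset.univ i.succAbove fun j => t j • p (i.succAbove j)]
  refine Finset.sum_congr rfl fun j _ => Finset.sum_congr rfl fun k hk => ?_
  rw [(Finset.mem_filter.1 hk).2]

theorem face_vertex {q : ℕ} (i : Fin (q + 2)) (j : Fin (q + 1)) (σ : Simplex (q + 1) X) :
    face i σ (stdSimplex.vertex j) = σ (stdSimplex.vertex (i.succAbove j)) := by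
  change σ (stdSimplex.map i.succAbove (stdSimplex.vertex j)) = _
  rw [stdSimplex.map_vertex]

theorem coboundary_one_apply (φ : Simplex 1 X → V) (σ : Simplex 2 X) :
    coboundary X R V 1 φ σ = φ (face 0 σ) - φ (face 1 σ) + φ (face 2 σ) := by
  change ∑ i : Fin 3, (-1 : ℤ) ^ (i : ℕ) • φ (face i σ) = _
  rw [Fin.sum_univ_three]
  simp [sub_eq_add_neg]

theorem coboundary_zero_apply (φ : Simplex 0 X → V) (σ : Simplex 1 X) :
    coboundary X R V 0 φ σ = φ (face 0 σ) - φ (face 1 σ) := by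
  change ∑ i : Fin 2, (-1 : ℤ) ^ (i : ℕ) • φ (face i σ) = _
  rw [Fin.sum_univ_two]
  simp [sub_eq_add_neg]

theorem simplex_zero_eq_const (σ : Simplex 0 X) :
    σ = ContinuousMap.const _ (σ (stdSimplex.vertex 0)) := by
  ext t
  have : t = stdSimplex.vertex 0 := Subsingleton.elim _ _
  rw [this]
  rfl

theorem coboundary_zero_eq_dPrim (φ : Simplex 0 X → V) :
    coboundary X R V 0 φ = dPrim fun x => φ (ContinuousMap.const _ x) := by
  funext σ
  rw [coboundary_zero_apply, simplex_zero_eq_const (face 0 σ), simplex_zero_eq_const (face 1 σ),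
    face_vertex, face_vertex]
  rfl

theorem coboundary_dPrim (ψ : X → V) : coboundary X R V 1 (dPrim ψ) = 0 := by
  funext σ
  rw [coboundary_one_apply]
  simp only [dPrim, face_vertex]
  have e1 : (0 : Fin 3).succAbove (0 : Fin 2) = 1 := rfl
  have e2 : (0 : Fin 3).succAbove (1 : Fin 2) = 2 := rfl
  have e3 : (1 : Fin 3).succAbove (0 : Fin 2) = 0 := rfl
  have e4 : (1 : Fin 3).succAbove (1 : Fin 2) = 2 := rfl
  have e5 : (2 : Fin 3).succAbove (0 : Fin 2) = 0 := rfl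
  have e6 : (2 : Fin 3).succAbove (1 : Fin 2) = 1 := rfl
  simp only [e1, e2, e3, e4, e5, e6, Pi.zero_apply]
  abel

/-- A cocycle is additive along the edges of an affine triangle. -/
theorem cocycle_affineSimplex {E : Type} [AddCommGroup E] [Module ℝ E] [TopologicalSpace E]
    [ContinuousAdd E] [ContinuousSMul ℝ E] {φ : Simplex 1 X → V}
    (hφ : coboundary X R V 1 φ = 0) (F : C(E, X)) (a b c : E) :
    φ (affineSimplex F ![a, c]) = φ (affineSimplex F ![a, b]) + φ (affineSimplex F ![b, c]) := by
  have h := congrFun hφ (affineSimplex F ![a, b, c])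
  rw [coboundary_one_apply, face_affineSimplex, face_affineSimplex, face_affineSimplex] at h
  have e0 : (![a, b, c] : Fin 3 → E) ∘ (0 : Fin 3).succAbove = ![b, c] := by
    funext i; fin_cases i <;> rfl
  have e1 : (![a, b, c] : Fin 3 → E) ∘ (1 : Fin 3).succAbove = ![a, c] := by
    funext i; fin_cases i <;> rfl
  have e2 : (![a, b, c] : Fin 3 → E) ∘ (2 : Fin 3).succAbove = ![a, b] := by
    funext i; fin_cases i <;> rfl
  rw [e0, e1, e2, Pi.zero_apply] at h
  rw [← sub_eq_zero, ← neg_eq_zero, ← h]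
  abel

theorem cocycle_affineSimplex_self {E : Type} [AddCommGroup E] [Module ℝ E] [TopologicalSpace E]
    [ContinuousAdd E] [ContinuousSMul ℝ E] {φ : Simplex 1 X → V}
    (hφ : coboundary X R V 1 φ = 0) (F : C(E, X)) (a : E) :
    φ (affineSimplex F ![a, a]) = 0 := by
  have h := cocycle_affineSimplex hφ F a a a
  simpa using h

/-- The point `(1 - t, t)` of the standard one-simplex, with `t` clamped to `[0, 1]`. -/
def clampSimplex : C(ℝ, stdSimplex ℝ (Fin 2)) where
  toFun t := ⟨![1 - max 0 (min t 1), max 0 (min t 1)], by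
    constructor
    · intro i
      fin_cases i <;> simp
    · simp⟩
  continuous_toFun := by
    refine Continuous.subtype_mk (continuous_pi fun i => ?_) _
    fin_cases i
    · change Continuous fun t : ℝ => 1 - max 0 (min t 1)
      fun_prop
    · change Continuous fun t : ℝ => max 0 (min t 1)
      fun_prop

theorem clampSimplex_apply_one (t : stdSimplex ℝ (Fin 2)) : clampSimplex (t 1) = t := by
  have h0 := stdSimplex.zero_le t 1
  have h1 := stdSimplex.le_one t 1
  have h2 := stdSimplex.add_eq_one t
  ext i
  change (![1 - max 0 (min (t 1) 1), max 0 (min (t 1) 1)] : Fin 2 → ℝ) i = t i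
  rw [min_eq_left h1, max_eq_right h0]
  fin_cases i
  · change 1 - t 1 = t 0
    linarith
  · rfl

theorem clampSimplex_zero : clampSimplex 0 = stdSimplex.vertex 0 := by
  have := clampSimplex_apply_one (stdSimplex.vertex 0)
  simpa using this

theorem clampSimplex_one : clampSimplex 1 = stdSimplex.vertex 1 := by
  have := clampSimplex_apply_one (stdSimplex.vertex 1)
  simpa using this

theorem affineSimplex_clampSimplex (σ : Simplex 1 X) :
    affineSimplex (σ.comp clampSimplex) ![(0 : ℝ), 1] = σ := by
  ext t
  rw [affineSimplex_apply]
  simp [Fin.sum_univ_two, clampSimplex_apply_one]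

/-- Every singular one-cocycle on a contractible space has a primitive. -/
theorem exists_primitive_of_contraction (H : C(ℝ × X, X)) (x₀ : X) (h0 : ∀ x, H (0, x) = x₀)
    (h1 : ∀ x, H (1, x) = x) {φ : Simplex 1 X → V} (hφ : coboundary X R V 1 φ = 0) :
    ∃ ψ : X → V, φ = dPrim ψ := by
  -- The primitive at `x` is the value of `φ` on the path `t ↦ H(t, x)` from `x₀` to `x`.
  let ray : X → C(ℝ, X) := fun x => H.comp ((ContinuousMap.id ℝ).prodMk (ContinuousMap.const ℝ x))
  refine ⟨fun x => φ (affineSimplex (ray x) ![0, 1]), ?_⟩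
  funext σ
  -- The square `(s, t) ↦ H(s, σ(t))`: the edge `s = 1` is `σ`, the edge `s = 0` is constant, and
  -- the edges `t = 0` and `t = 1` are rays. The cocycle relation on the two triangles cut off by
  -- the diagonal gives the claim.
  let G : C(ℝ × ℝ, X) := H.comp ((ContinuousMap.fst).prodMk
    ((σ.comp clampSimplex).comp ContinuousMap.snd))
  have hG : ∀ s t, G (s, t) = H (s, σ (clampSimplex t)) := fun s t => rfl
  have e1 : affineSimplex G ![(1, 0), (1, 1)] = σ := by
    ext t
    rw [affineSimplex_apply, Fin.sum_univ_two]
    have h2 := stdSimplex.add_eq_one t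
    have : t 0 • (![(1, 0), (1, 1)] : Fin 2 → ℝ × ℝ) 0 + t 1 • (![(1, 0), (1, 1)] : Fin 2 → ℝ × ℝ) 1 =
        (1, t 1) := by
      ext <;> simp [h2]
    rw [this, hG, h1, clampSimplex_apply_one]
  have e2 : ∀ s : ℝ, affineSimplex G ![(0, s), (1, s)] =
      affineSimplex (ray (σ (clampSimplex s))) ![0, 1] := by
    intro s
    ext t
    rw [affineSimplex_apply, affineSimplex_apply, Fin.sum_univ_two, Fin.sum_univ_two]
    have h2 := stdSimplex.add_eq_one t
    have : t 0 • (![(0, s), (1, s)] : Fin 2 → ℝ × ℝ) 0 + t 1 • (![(0, s), (1, s)] : Fin 2 → ℝ × ℝ) 1 =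
        (t 1, s) := by
      ext
      · simp
      · simp [← add_mul, h2]
    rw [this, hG]
    change _ = H (_, _)
    simp
  have e3 : affineSimplex G ![(0, 0), (0, 1)] = affineSimplex G ![(0, 0), (0, 0)] := by
    ext t
    rw [affineSimplex_apply, affineSimplex_apply, Fin.sum_univ_two, Fin.sum_univ_two]
    have : t 0 • (![(0, 0), (0, 1)] : Fin 2 → ℝ × ℝ) 0 + t 1 • (![(0, 0), (0, 1)] : Fin 2 → ℝ × ℝ) 1 =
        (0, t 1) := by
      ext <;> simp
    have h' : t 0 • (![(0, 0), (0, 0)] : Fin 2 → ℝ × ℝ) 0 + t 1 • (![(0, 0), (0, 0)] : Fin 2 → ℝ × ℝ) 1 =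
        (0, 0) := by
      ext <;> simp
    rw [this, h', hG, hG, h0, h0]
  have t1 := cocycle_affineSimplex hφ G (0, 0) (1, 0) (1, 1)
  have t2 := cocycle_affineSimplex hφ G (0, 0) (0, 1) (1, 1)
  rw [e1, e2] at t1
  rw [e2, e3, cocycle_affineSimplex_self hφ, zero_add] at t2
  rw [clampSimplex_zero] at t1
  rw [clampSimplex_one] at t2
  rw [dPrim, ← t2, t1]
  abel

/-- A locally exact singular one-cocycle is exact. -/
theorem eq_dPrim_of_local {φ : Simplex 1 X → V} (hφ : coboundary X R V 1 φ = 0) (ψ : X → V)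
    (hloc : ∀ x : X, ∃ U : Set X, IsOpen U ∧ x ∈ U ∧
      ∀ σ : Simplex 1 X, (∀ t, σ t ∈ U) → φ σ = dPrim ψ σ) : φ = dPrim ψ := by
  funext σ
  choose U hU hxU hφU using hloc
  let f : C(ℝ, X) := σ.comp clampSimplex
  -- A Lebesgue subdivision of the interval: each piece of `σ` lies in one of the open sets. The
  -- values of `φ` on the pieces add up by the cocycle relation on triangles that `f` flattens onto
  -- the path.
  obtain ⟨t, ht0, hmono, ⟨N, hN⟩, hsub⟩ := exists_monotone_Icc_subset_open_cover_unitInterval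
    (c := fun x : X => {s : unitInterval | f s ∈ U x})
    (fun x => (hU x).preimage (f.continuous.comp continuous_subtype_val))
    (fun s _ => Set.mem_iUnion.2 ⟨f s, hxU _⟩)
  have key : ∀ k, φ (affineSimplex f ![0, (t k : ℝ)]) = ψ (f (t k)) - ψ (f 0) := by
    intro k
    induction k with
    | zero =>
      rw [ht0]
      simp [cocycle_affineSimplex_self hφ f 0]
    | succ k ih =>
      rw [cocycle_affineSimplex hφ f 0 (t k) (t (k + 1)), ih]
      obtain ⟨x, hx⟩ := hsub k
      rw [hφU x, dPrim, affineSimplex_vertex, affineSimplex_vertex]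
      · simp
      · intro s
        rw [affineSimplex_apply, Fin.sum_univ_two]
        have hle : (t k : ℝ) ≤ t (k + 1) := hmono (Nat.le_succ k)
        have h2 := stdSimplex.add_eq_one s
        have h3 := stdSimplex.zero_le s 0
        have h4 := stdSimplex.zero_le s 1
        simp only [Matrix.cons_val_zero, Matrix.cons_val_one, smul_eq_mul]
        have hl : (t k : ℝ) ≤ s 0 * t k + s 1 * t (k + 1) := by
          have : s 0 = 1 - s 1 := by linarith
          rw [this]
          nlinarith
        have hr : s 0 * t k + s 1 * t (k + 1) ≤ (t (k + 1) : ℝ) := by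
          have : s 1 = 1 - s 0 := by linarith
          rw [this]
          nlinarith
        exact hx (a := ⟨s 0 * t k + s 1 * t (k + 1),
          ⟨(t k).2.1.trans hl, hr.trans (t (k + 1)).2.2⟩⟩) ⟨hl, hr⟩
  have h := key N
  rw [hN N le_rfl] at h
  simp only [Set.Icc.coe_one] at h
  rw [affineSimplex_clampSimplex] at h
  rw [h, dPrim]
  simp [f, clampSimplex_zero, clampSimplex_one]

end Primitives

/-! ### Charts of the Borel--Serre completion -/

section Charts

theorem coe_smulH (γ : M2pos) (z : ℍ) :
    ((γ • z : ℍ) : ℂ) = (γ.1 0 0 * z + γ.1 0 1) / (γ.1 1 0 * z + γ.1 1 1) := by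
  rw [smulH_def, UpperHalfPlane.coe_smul_of_det_pos (toGL_det_pos _)]
  simp [UpperHalfPlane.num, UpperHalfPlane.denom, toGL_apply]

theorem denomH_ne_zero (γ : M2pos) (z : ℍ) : (γ.1 1 0 * z + γ.1 1 1 : ℂ) ≠ 0 := by
  simpa [UpperHalfPlane.denom, toGL_apply] using UpperHalfPlane.denom_ne_zero (toGL ℝ γ) z

theorem smul_infty (γ : M2pos) (K : Type) [Field K] [CharZero K] [DecidableEq K] :
    toGL K γ • (OnePoint.infty : OnePoint K) =
      if γ.1 1 0 = 0 then OnePoint.infty else (((γ.1 0 0 : K) / γ.1 1 0 : K) : OnePoint K) := by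
  rw [OnePoint.smul_infty_eq_ite]
  simp [toGL_apply]

theorem smul_coe (γ : M2pos) (x : ℝ) :
    toGL ℝ γ • (x : OnePoint ℝ) = if (γ.1 1 0 * x + γ.1 1 1 : ℝ) = 0 then OnePoint.infty else
      (((γ.1 0 0 * x + γ.1 0 1) / (γ.1 1 0 * x + γ.1 1 1) : ℝ) : OnePoint ℝ) := by
  rw [OnePoint.smul_some_eq_ite]
  simp only [toGL_apply]
  congr

theorem det_eq_of_lower_zero {γ : M2pos} (h : γ.1 1 0 = 0) : 0 < γ.1 0 0 * γ.1 1 1 := by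
  have h1 : 0 < γ.1.det := γ.2
  rw [Matrix.det_fin_two, h] at h1
  simpa using h1

theorem lower_right_ne_zero {γ : M2pos} (h : γ.1 1 0 = 0) : γ.1 1 1 ≠ 0 := fun h1 => by
  have := det_eq_of_lower_zero h
  simp [h1] at this

theorem smul_bdInfty {γ : M2pos} (h : γ.1 1 0 = 0) (x : ℝ) :
    γ • bdInfty x = bdInfty ((γ.1 0 0 * x + γ.1 0 1) / γ.1 1 1) := by
  apply BSBoundary.ext
  · change toGL ℚ γ • (OnePoint.infty : OnePoint ℚ) = OnePoint.infty
    rw [smul_infty, if_pos h]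
  · change toGL ℝ γ • (x : OnePoint ℝ) = _
    have h1 : ((γ.1 1 1 : ℤ) : ℝ) ≠ 0 := by exact_mod_cast lower_right_ne_zero h
    rw [smul_coe, if_neg (by simpa [h] using h1)]
    simp [h, bdInfty]

theorem cusp_smul_bdInfty_eq_infty_iff (γ : M2pos) (x : ℝ) :
    (γ • bdInfty x).cusp = OnePoint.infty ↔ γ.1 1 0 = 0 := by
  change toGL ℚ γ • (OnePoint.infty : OnePoint ℚ) = OnePoint.infty ↔ _
  rw [smul_infty]
  split_ifs with h <;> simp [h]

theorem bdInfty_injective : Function.Injective bdInfty := fun x y h => by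
  simpa [bdInfty] using congrArg BSBoundary.pt h

/-- The inverse of the chart at infinity, on the upper half plane. -/
def coordInner (z : ℍ) : ℝ × ℝ≥0 := (z.re, ⟨z.im⁻¹, (inv_pos.2 z.im_pos).le⟩)

theorem continuous_coordInner : Continuous coordInner := by
  refine Continuous.prodMk UpperHalfPlane.continuous_re ?_
  exact Continuous.subtype_mk
    (UpperHalfPlane.continuous_im.inv₀ fun z => z.im_pos.ne') _

theorem chartInfty_coordInner (z : ℍ) : chartInfty (coordInner z) = HBS.inner z := by
  have hz : (0 : ℝ≥0) < (coordInner z).2 := inv_pos.2 z.im_pos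
  rw [chartInfty, dif_pos hz]
  congr 1
  apply UpperHalfPlane.ext
  apply Complex.ext
  · rfl
  · change (z.im⁻¹)⁻¹ = z.im
    rw [inv_inv]

theorem chartInfty_zero (x : ℝ) : chartInfty (x, 0) = HBS.bd (bdInfty x) := by
  simp [chartInfty]

theorem chartInfty_of_pos {w : ℝ × ℝ≥0} (h : 0 < w.2) :
    ∃ z : ℍ, chartInfty w = HBS.inner z ∧ w = coordInner z := by
  refine ⟨⟨⟨w.1, ((w.2 : ℝ))⁻¹⟩, by simpa using h⟩, by rw [chartInfty, dif_pos h], ?_⟩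
  refine Prod.ext rfl (NNReal.coe_injective ?_)
  exact (inv_inv _).symm

theorem chartInfty_injective : Function.Injective chartInfty := by
  intro w w' h
  rcases eq_or_ne w.2 0 with h1 | h1 <;> rcases eq_or_ne w'.2 0 with h2 | h2
  · have e1 : w = (w.1, 0) := Prod.ext rfl h1
    have e2 : w' = (w'.1, 0) := Prod.ext rfl h2
    rw [e1, e2, chartInfty_zero, chartInfty_zero] at h
    injection h with h
    rw [e1, e2, bdInfty_injective h]
  · have e1 : w = (w.1, 0) := Prod.ext rfl h1
    obtain ⟨z, hz, -⟩ := chartInfty_of_pos (pos_iff_ne_zero.2 h2)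
    rw [e1, chartInfty_zero, hz] at h
    cases h
  · have e2 : w' = (w'.1, 0) := Prod.ext rfl h2
    obtain ⟨z, hz, -⟩ := chartInfty_of_pos (pos_iff_ne_zero.2 h1)
    rw [e2, chartInfty_zero, hz] at h
    cases h
  · obtain ⟨z, hz, e⟩ := chartInfty_of_pos (pos_iff_ne_zero.2 h1)
    obtain ⟨z', hz', e'⟩ := chartInfty_of_pos (pos_iff_ne_zero.2 h2)
    rw [hz, hz'] at h
    injection h with h
    rw [e, e', h]

/-- An upper triangular `γ` acts as `z ↦ (az + b)/d`, which multiplies `Im z` by `a/d` and hence `t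
= 1/Im z` by `d/a`. As `ad > 0`, `Real.toNNReal` truncates nothing, and the formula persists at `t =
0`. -/
theorem smul_chartInfty_of_lower_zero {γ : M2pos} (h : γ.1 1 0 = 0) (w : ℝ × ℝ≥0) :
    γ • chartInfty w = chartInfty ((γ.1 0 0 * w.1 + γ.1 0 1) / γ.1 1 1,
      w.2 * Real.toNNReal (γ.1 1 1 / γ.1 0 0)) := by
  have hd : ((γ.1 1 1 : ℤ) : ℝ) ≠ 0 := by exact_mod_cast lower_right_ne_zero h
  have hdet : (0 : ℝ) < γ.1 0 0 * γ.1 1 1 := by exact_mod_cast det_eq_of_lower_zero h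
  have ha : ((γ.1 0 0 : ℤ) : ℝ) ≠ 0 := fun h1 => by simp [h1] at hdet
  have hq : (0 : ℝ) < γ.1 1 1 / γ.1 0 0 := by
    have : (γ.1 1 1 / γ.1 0 0 : ℝ) = (γ.1 0 0 * γ.1 1 1) / (γ.1 0 0) ^ 2 := by
      field_simp
    rw [this]
    positivity
  rcases eq_or_ne w.2 0 with h1 | h1
  · have e1 : w = (w.1, 0) := Prod.ext rfl h1
    rw [h1, zero_mul, chartInfty_zero, e1, chartInfty_zero, smul_bd, smul_bdInfty h]
  · obtain ⟨z, hz, e⟩ := chartInfty_of_pos (pos_iff_ne_zero.2 h1)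
    rw [hz, smul_inner, ← chartInfty_coordInner]
    have hz' : ((γ • z : ℍ) : ℂ) = ((γ.1 0 0 / γ.1 1 1 : ℝ) : ℂ) * z + ((γ.1 0 1 / γ.1 1 1 : ℝ) : ℂ) := by
      rw [coe_smulH, h]
      push_cast
      have : ((γ.1 1 1 : ℤ) : ℂ) ≠ 0 := by exact_mod_cast lower_right_ne_zero h
      rw [zero_mul, zero_add]
      field_simp
    have hre : (γ • z).re = γ.1 0 0 / γ.1 1 1 * z.re + γ.1 0 1 / γ.1 1 1 := by
      rw [← UpperHalfPlane.coe_re, hz', Complex.add_re, Complex.re_ofReal_mul, Complex.ofReal_re,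
        UpperHalfPlane.coe_re]
    have him : (γ • z).im = γ.1 0 0 / γ.1 1 1 * z.im := by
      rw [← UpperHalfPlane.coe_im, hz', Complex.add_im, Complex.im_ofReal_mul, Complex.ofReal_im,
        UpperHalfPlane.coe_im, add_zero]
    congr 1
    refine Prod.ext ?_ (NNReal.coe_injective ?_)
    · change (γ • z).re = _
      rw [hre, e]
      simp only [coordInner]
      ring
    · change (γ • z).im⁻¹ = w.2 * (Real.toNNReal (γ.1 1 1 / γ.1 0 0) : ℝ)
      rw [him, Real.coe_toNNReal _ hq.le, e]
      change _ = z.im⁻¹ * _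
      rw [mul_inv, inv_div]
      ring

/-- Openness has to be tested in every chart `δ`. If `δ` fixes `∞`, the transition map is the affine
one above. Otherwise the two charts meet only over `ℍ`, that is for `t > 0`, and the transition map
factors through the continuous action on `ℍ`. -/
theorem isOpenMap_chartInfty : IsOpenMap chartInfty := by
  intro W hW
  rw [isOpen_HBS]
  intro δ
  by_cases h : δ.1 1 0 = 0
  · have h1 : (fun w => δ • chartInfty w) ⁻¹' (chartInfty '' W) =
        (fun w : ℝ × ℝ≥0 => ((δ.1 0 0 * w.1 + δ.1 0 1) / δ.1 1 1,
          w.2 * Real.toNNReal (δ.1 1 1 / δ.1 0 0))) ⁻¹' W := by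
      ext w
      simp only [Set.mem_preimage, smul_chartInfty_of_lower_zero h,
        chartInfty_injective.mem_set_image]
    rw [h1]
    exact hW.preimage (by fun_prop)
  · let U : Set (ℝ × ℝ≥0) := {w | 0 < w.2}
    have hU : IsOpen U := isOpen_lt continuous_const continuous_snd
    let g : U → ℍ := fun w => ⟨⟨w.1.1, ((w.1.2 : ℝ))⁻¹⟩, by
      have h3 : (0 : ℝ) < w.1.2 := w.2
      exact inv_pos.2 h3⟩
    have hg : Continuous g := by
      rw [UpperHalfPlane.isEmbedding_coe.continuous_iff]
      have h2 : ∀ w : U, (w.1.2 : ℝ) ≠ 0 := fun w => by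
        have : 0 < w.1.2 := w.2
        exact_mod_cast this.ne'
      have h3 : Continuous fun w : U => (w.1.1 : ℂ) + (((w.1.2 : ℝ)⁻¹ : ℝ) : ℂ) * Complex.I := by
        have h4 : Continuous fun w : U => (w.1.2 : ℝ)⁻¹ := by
          refine Continuous.inv₀ ?_ h2
          exact NNReal.continuous_coe.comp (continuous_snd.comp continuous_subtype_val)
        have h5 : Continuous fun w : U => w.1.1 := continuous_fst.comp continuous_subtype_val
        fun_prop
      convert h3 using 1
      funext w
      apply Complex.ext <;> simp [g]
    have hval : ∀ w : U, chartInfty w.1 = HBS.inner (g w) := fun w => by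
      rw [chartInfty, dif_pos (show 0 < w.1.2 from w.2)]
    have h1 : (fun w => δ • chartInfty w) ⁻¹' (chartInfty '' W) =
        Subtype.val '' ((fun w : U => coordInner (δ • g w)) ⁻¹' W) := by
      ext w
      constructor
      · rintro ⟨v, hv, hvw⟩
        change chartInfty v = δ • chartInfty w at hvw
        have hw : 0 < w.2 := by
          rw [pos_iff_ne_zero]
          intro h0
          have e1 : w = (w.1, 0) := Prod.ext rfl h0
          rw [e1, chartInfty_zero, smul_bd] at hvw
          rcases eq_or_ne v.2 0 with h3 | h3
          · have e2 : v = (v.1, 0) := Prod.ext rfl h3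
            rw [e2, chartInfty_zero] at hvw
            injection hvw with hvw
            exact h ((cusp_smul_bdInfty_eq_infty_iff δ w.1).1 (by rw [← hvw]; rfl))
          · obtain ⟨z, hz, -⟩ := chartInfty_of_pos (pos_iff_ne_zero.2 h3)
            rw [hz] at hvw
            cases hvw
        refine ⟨⟨w, hw⟩, ?_, rfl⟩
        have h3 := hval ⟨w, hw⟩
        simp only at h3
        rw [h3, smul_inner, ← chartInfty_coordInner] at hvw
        rw [Set.mem_preimage, ← chartInfty_injective hvw]
        exact hv
      · rintro ⟨v, hv, rfl⟩
        exact ⟨_, hv, by simp only [chartInfty_coordInner, hval, smul_inner]⟩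
    rw [h1]
    refine hU.isOpenMap_subtype_val _ (hW.preimage ?_)
    have h2 : Continuous fun z : ℍ => δ • z := continuous_const_smul δ
    exact continuous_coordInner.comp (h2.comp hg)

/-! #### The action of the adjugate -/

/-- Scalar matrices act trivially on `ℍ` and on the boundary, so `adj γ` acts as the inverse of `γ`
although `M2pos` is only a monoid. This transports statements about the chart at `∞` to all charts.
-/
theorem adj_mul_self_apply (γ : M2pos) (i j : Fin 2) :
    (adj γ * γ).1 i j = if i = j then γ.1.det else 0 := by
  change (γ.1.adjugate * γ.1) i j = _
  rw [Matrix.adjugate_mul, Matrix.smul_apply, Matrix.one_apply]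
  simp

theorem smulH_of_scalar {γ : M2pos} {k : ℤ} (hk : k ≠ 0)
    (h : ∀ i j, γ.1 i j = if i = j then k else 0) (z : ℍ) : γ • z = z := by
  apply UpperHalfPlane.ext
  have hk' : (k : ℂ) ≠ 0 := by exact_mod_cast hk
  rw [coe_smulH, h, h, h, h]
  simp [hk']

theorem smul_boundary_of_scalar {γ : M2pos} {k : ℤ} (hk : k ≠ 0)
    (h : ∀ i j, γ.1 i j = if i = j then k else 0) (b : BSBoundary) : γ • b = b := by
  have key : ∀ (K : Type) [Field K] [CharZero K] [DecidableEq K] (x : OnePoint K),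
      toGL K γ • x = x := by
    intro K _ _ _ x
    have hk' : (k : K) ≠ 0 := by exact_mod_cast hk
    cases x with
    | infty => rw [smul_infty, if_pos (by rw [h]; simp)]
    | coe x =>
      rw [OnePoint.smul_some_eq_ite]
      simp [toGL_apply, h, hk']
  apply BSBoundary.ext
  · exact key ℚ b.cusp
  · exact key ℝ b.pt

theorem adj_smul_smulH (γ : M2pos) (z : ℍ) : adj γ • γ • z = z := by
  rw [← mul_smul]
  have h : 0 < γ.1.det := γ.2
  exact smulH_of_scalar h.ne' (adj_mul_self_apply γ) z

theorem adj_smul_smul_boundary (γ : M2pos) (b : BSBoundary) : adj γ • γ • b = b := by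
  rw [← mul_smul]
  have h : 0 < γ.1.det := γ.2
  exact smul_boundary_of_scalar h.ne' (adj_mul_self_apply γ) b

theorem adj_adj (γ : M2pos) : adj (adj γ) = γ := by
  apply Subtype.ext
  change γ.1.adjugate.adjugate = γ.1
  rw [Matrix.adjugate_adjugate _ (by simp)]
  simp

theorem adj_smul_smulHBS (γ : M2pos) (z : HBS) : adj γ • γ • z = z := by
  cases z with
  | inner z => exact congrArg HBS.inner (adj_smul_smulH γ z)
  | bd b => exact congrArg HBS.bd (adj_smul_smul_boundary γ b)

theorem smul_adj_smulHBS (γ : M2pos) (z : HBS) : γ • adj γ • z = z := by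
  conv_lhs => rw [← adj_adj γ]
  rw [adj_adj (adj γ)]
  exact adj_smul_smulHBS (adj γ) z

theorem isOpenEmbedding_chart (γ : M2pos) :
    Topology.IsOpenEmbedding fun w => γ • chartInfty w := by
  refine .of_continuous_injective_isOpenMap (continuous_chart γ) ?_ ?_
  · intro w w' h
    have h1 := congrArg (adj γ • ·) h
    simp only [adj_smul_smulHBS] at h1
    exact chartInfty_injective h1
  · intro W hW
    have h1 : (fun w => γ • chartInfty w) '' W = (adj γ • ·) ⁻¹' (chartInfty '' W) := by
      ext z
      constructor
      · rintro ⟨w, hw, rfl⟩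
        exact ⟨w, hw, (adj_smul_smulHBS γ _).symm⟩
      · rintro ⟨w, hw, h⟩
        exact ⟨w, hw, by simp only [h, smul_adj_smulHBS]⟩
    rw [h1]
    exact (isOpenMap_chartInfty W hW).preimage (continuous_const_smul (adj γ))

theorem exists_lift_chart (γ : M2pos) {Y : Type} [TopologicalSpace Y] (σ : C(Y, HBS))
    (h : ∀ t, σ t ∈ Set.range fun w => γ • chartInfty w) :
    ∃ τ : C(Y, ℝ × ℝ≥0), ∀ t, σ t = γ • chartInfty (τ t) := by
  choose τ hτ using h
  refine ⟨⟨τ, ?_⟩, fun t => (hτ t).symm⟩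
  rw [(isOpenEmbedding_chart γ).isInducing.continuous_iff]
  convert σ.continuous using 1
  funext t
  exact hτ t

end Charts

/-! ### Vanishing of the first cohomology of the covering spaces -/

section Exactness

variable {X : Type} [TopologicalSpace X] {R : Type} [CommRing R] {V : Type} [AddCommGroup V]
  [Module R V]

theorem exists_simplex [PathConnectedSpace X] (x y : X) :
    ∃ σ : Simplex 1 X, σ (stdSimplex.vertex 0) = x ∧ σ (stdSimplex.vertex 1) = y := by
  obtain ⟨p⟩ := PathConnectedSpace.joined x y
  refine ⟨affineSimplex ⟨p.extend, p.continuous_extend⟩ ![(0 : ℝ), 1], ?_, ?_⟩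
  · rw [affineSimplex_vertex]
    simp
  · rw [affineSimplex_vertex]
    simp

theorem coboundary_comp {Y : Type} [TopologicalSpace Y] (f : C(Y, X)) {φ : Simplex 1 X → V}
    (hφ : coboundary X R V 1 φ = 0) :
    coboundary Y R V 1 (fun σ => φ (f.comp σ)) = 0 := by
  funext σ
  exact congrFun hφ (f.comp σ)

/-- The contraction to `i` is `(s, x + iy) ↦ sx + i y^s`, which makes sense for every real `s`. -/
theorem exists_dPrim_upperHalfPlane {φ : Simplex 1 ℍ → V} (hφ : coboundary ℍ R V 1 φ = 0) :
    ∃ ψ : ℍ → V, φ = dPrim ψ := by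
  let H : C(ℝ × ℍ, ℍ) :=
    { toFun := fun w => ⟨⟨w.1 * w.2.re, Real.exp (w.1 * Real.log w.2.im)⟩, Real.exp_pos _⟩
      continuous_toFun := by
        rw [UpperHalfPlane.isEmbedding_coe.continuous_iff]
        have h1 : Continuous fun w : ℝ × ℍ => w.2.re :=
          UpperHalfPlane.continuous_re.comp continuous_snd
        have h2 : Continuous fun w : ℝ × ℍ => Real.log w.2.im :=
          (UpperHalfPlane.continuous_im.comp continuous_snd).log fun w => w.2.im_pos.ne'
        have h3 : Continuous fun w : ℝ × ℍ => ((w.1 * w.2.re : ℝ) : ℂ) +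
            ((Real.exp (w.1 * Real.log w.2.im) : ℝ) : ℂ) * Complex.I := by
          fun_prop
        convert h3 using 1
        funext w
        apply Complex.ext <;>
          simp only [Complex.add_re, Complex.add_im, Complex.mul_re, Complex.mul_im,
            Complex.ofReal_re, Complex.ofReal_im, Complex.I_re, Complex.I_im,
            mul_zero, mul_one, zero_add, add_zero, sub_zero] <;> rfl }
  refine exists_primitive_of_contraction (R := R) H UpperHalfPlane.I (fun z => ?_) (fun z => ?_) hφ
  · apply UpperHalfPlane.ext
    apply Complex.ext <;> simp [H]
  · apply UpperHalfPlane.ext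
    apply Complex.ext
    · simp [H]
    · simp [H, Real.exp_log z.im_pos]

theorem exists_dPrim_halfPlane {φ : Simplex 1 (ℝ × ℝ≥0) → V}
    (hφ : coboundary (ℝ × ℝ≥0) R V 1 φ = 0) : ∃ ψ : ℝ × ℝ≥0 → V, φ = dPrim ψ := by
  -- Scaling to the origin. The parameter runs through all of `ℝ`, so in the second coordinate it is
  -- cut off at `0`.
  let H : C(ℝ × (ℝ × ℝ≥0), ℝ × ℝ≥0) :=
    ⟨fun w => (w.1 * w.2.1, Real.toNNReal w.1 * w.2.2), by fun_prop⟩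
  refine exists_primitive_of_contraction (R := R) H (0, 0) (fun z => ?_) (fun z => ?_) hφ
  · simp [H]
  · simp [H]

theorem exists_dPrim_real {φ : Simplex 1 ℝ → V} (hφ : coboundary ℝ R V 1 φ = 0) :
    ∃ ψ : ℝ → V, φ = dPrim ψ := by
  let H : C(ℝ × ℝ, ℝ) := ⟨fun w => w.1 * w.2, by fun_prop⟩
  exact exists_primitive_of_contraction (R := R) H 0 (fun z => by simp [H]) (fun z => by simp [H]) hφ

theorem exists_cusp_eq (r : OnePoint ℚ) :
    ∃ g : SL(2, ℤ), toGL ℚ (ofSL g) • (OnePoint.infty : OnePoint ℚ) = r := by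
  obtain ⟨g, hg⟩ := r.exists_mem_SL2 ℤ
  refine ⟨g, ?_⟩
  rw [← hg]
  congr 1
  ext i j
  simp [toGL_apply, ofSL]

/-- An element of `SL₂(ℤ)` that maps `∞` to a given cusp. -/
def cuspRep (r : OnePoint ℚ) : SL(2, ℤ) := (exists_cusp_eq r).choose

theorem cuspRep_smul (r : OnePoint ℚ) :
    toGL ℚ (ofSL (cuspRep r)) • (OnePoint.infty : OnePoint ℚ) = r := (exists_cusp_eq r).choose_spec

theorem cusp_cuspRep_smul (r : OnePoint ℚ) (x : ℝ) : (ofSL (cuspRep r) • bdInfty x).cusp = r :=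
  cuspRep_smul r

theorem exists_bdInfty_of_cusp {b : BSBoundary} (hb : b.cusp = OnePoint.infty) :
    ∃ x : ℝ, b = bdInfty x := by
  obtain ⟨r, x, hx⟩ := b
  change r = OnePoint.infty at hb
  subst hb
  cases x with
  | infty => exact absurd rfl hx
  | coe x => exact ⟨x, rfl⟩

theorem ofSL_inv_smul_smul {Y : Type} [MulAction M2pos Y] (g : SL(2, ℤ)) (b : Y) :
    ofSL g⁻¹ • ofSL g • b = b := by
  rw [← mul_smul, ← map_mul, inv_mul_cancel, map_one, one_smul]

theorem ofSL_smul_inv_smul {Y : Type} [MulAction M2pos Y] (g : SL(2, ℤ)) (b : Y) :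
    ofSL g • ofSL g⁻¹ • b = b := by
  rw [← mul_smul, ← map_mul, mul_inv_cancel, map_one, one_smul]

theorem exists_cuspRep_smul (b : BSBoundary) :
    ∃ x : ℝ, b = ofSL (cuspRep b.cusp) • bdInfty x := by
  obtain ⟨x, hx⟩ := exists_bdInfty_of_cusp (b := ofSL (cuspRep b.cusp)⁻¹ • b) (by
    have h1 : (ofSL (cuspRep b.cusp)⁻¹ • b).cusp = toGL ℚ (ofSL (cuspRep b.cusp)⁻¹) • b.cusp := rfl
    have h2 : toGL ℚ (ofSL (cuspRep b.cusp)⁻¹) = (toGL ℚ (ofSL (cuspRep b.cusp)))⁻¹ :=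
      map_inv ((toGL ℚ).comp ofSL) _
    rw [h1, h2, inv_smul_eq_iff]
    exact (cuspRep_smul b.cusp).symm)
  refine ⟨x, ?_⟩
  rw [← hx, ofSL_smul_inv_smul]

/-- The coordinate of a boundary point on its component. -/
def bdCoord (b : BSBoundary) : ℝ := (exists_cuspRep_smul b).choose

theorem bdCoord_spec (b : BSBoundary) : ofSL (cuspRep b.cusp) • bdInfty (bdCoord b) = b :=
  (exists_cuspRep_smul b).choose_spec.symm

theorem bdCoord_smul (r : OnePoint ℚ) (x : ℝ) : bdCoord (ofSL (cuspRep r) • bdInfty x) = x := by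
  have h := bdCoord_spec (ofSL (cuspRep r) • bdInfty x)
  rw [cusp_cuspRep_smul] at h
  have h1 := congrArg (ofSL (cuspRep r)⁻¹ • ·) h
  simp only [ofSL_inv_smul_smul] at h1
  exact bdInfty_injective h1

/-! ### The components of the boundary and their coordinates -/

/-- A chart meets the boundary in the component of its own cusp only. Hence the components are open,
and a path in the boundary stays over one cusp. -/
theorem chart_mem_iff (r : OnePoint ℚ) (b : BSBoundary) :
    HBS.bd b ∈ Set.range (fun w => ofSL (cuspRep r) • chartInfty w) ↔ b.cusp = r := by
  constructor
  · rintro ⟨w, hw⟩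
    rcases eq_or_ne w.2 0 with h1 | h1
    · have e1 : w = (w.1, 0) := Prod.ext rfl h1
      change ofSL (cuspRep r) • chartInfty w = _ at hw
      rw [e1, chartInfty_zero, smul_bd] at hw
      injection hw with hw
      rw [← hw, cusp_cuspRep_smul]
    · obtain ⟨z, hz, -⟩ := chartInfty_of_pos (pos_iff_ne_zero.2 h1)
      change ofSL (cuspRep r) • chartInfty w = _ at hw
      rw [hz, smul_inner] at hw
      cases hw
  · rintro rfl
    refine ⟨(bdCoord b, 0), ?_⟩
    change ofSL (cuspRep b.cusp) • chartInfty (bdCoord b, 0) = _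
    rw [chartInfty_zero, smul_bd, bdCoord_spec]

theorem isOpen_cusp_eq (r : OnePoint ℚ) : IsOpen {b : BSBoundary | b.cusp = r} := by
  have h : {b : BSBoundary | b.cusp = r} =
      inclBoundary ⁻¹' Set.range (fun w => ofSL (cuspRep r) • chartInfty w) := by
    ext b
    exact (chart_mem_iff r b).symm
  rw [h]
  exact (isOpenEmbedding_chart _).isOpen_range.preimage inclBoundary.continuous

theorem isLocallyConstant_cusp : IsLocallyConstant BSBoundary.cusp :=
  (IsLocallyConstant.iff_isOpen_fiber).2 isOpen_cusp_eq

theorem cusp_eq_of_simplex (σ : Simplex 1 BSBoundary) (s t : stdSimplex ℝ (Fin 2)) :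
    (σ s).cusp = (σ t).cusp :=
  (isLocallyConstant_cusp.comp_continuous σ.continuous).apply_eq_of_preconnectedSpace s t

theorem continuous_bdInfty : Continuous bdInfty := by
  have h : HBS.bd ∘ bdInfty = (fun w => (1 : M2pos) • chartInfty w) ∘ fun x => (x, 0) := by
    funext x
    simp [chartInfty_zero]
  refine continuous_induced_rng.2 ?_
  rw [h]
  exact (continuous_chart 1).comp (by fun_prop)

/-- The parametrisation of the boundary component of the cusp `γ∞`. -/
def bdChart (γ : M2pos) : C(ℝ, BSBoundary) :=
  ⟨fun x => γ • bdInfty x, (continuous_const_smul γ).comp continuous_bdInfty⟩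

theorem bdChart_apply (γ : M2pos) (x : ℝ) : bdChart γ x = γ • bdInfty x := rfl

theorem exists_lift_bdChart {r : OnePoint ℚ} (σ : Simplex 1 BSBoundary)
    (h : ∀ t, (σ t).cusp = r) :
    ∃ τ : Simplex 1 ℝ, σ = (bdChart (ofSL (cuspRep r))).comp τ := by
  obtain ⟨τ, hτ⟩ := exists_lift_chart (ofSL (cuspRep r)) (inclBoundary.comp σ)
    (fun t => (chart_mem_iff r (σ t)).2 (h t))
  refine ⟨⟨fun t => (τ t).1, continuous_fst.comp τ.continuous⟩, ?_⟩
  ext1 t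
  have h1 : HBS.bd (σ t) = ofSL (cuspRep r) • chartInfty (τ t) := hτ t
  rcases eq_or_ne (τ t).2 0 with h2 | h2
  · have e1 : τ t = ((τ t).1, 0) := Prod.ext rfl h2
    rw [e1, chartInfty_zero, smul_bd] at h1
    injection h1
  · obtain ⟨z, hz, -⟩ := chartInfty_of_pos (pos_iff_ne_zero.2 h2)
    rw [hz, smul_inner] at h1
    cases h1

/-- Each component is a line, and no path joins two components, so primitives chosen independently
on the components need no matching. -/
theorem exists_dPrim_boundary {φ : Simplex 1 BSBoundary → V}
    (hφ : coboundary BSBoundary R V 1 φ = 0) : ∃ ψ : BSBoundary → V, φ = dPrim ψ := by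
  choose ψ hψ using fun r => exists_dPrim_real (R := R)
    (coboundary_comp (bdChart (ofSL (cuspRep r))) hφ)
  refine ⟨fun b => ψ b.cusp (bdCoord b), ?_⟩
  funext σ
  obtain ⟨τ, hτ⟩ := exists_lift_bdChart σ (fun t => cusp_eq_of_simplex σ t (stdSimplex.vertex 0))
  have h1 := congrFun (hψ (σ (stdSimplex.vertex 0)).cusp) τ
  rw [← hτ] at h1
  rw [h1, dPrim, dPrim, cusp_eq_of_simplex σ (stdSimplex.vertex 1) (stdSimplex.vertex 0)]
  have h2 : ∀ t, bdCoord (σ t) = τ t := fun t => by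
    conv_lhs => rw [hτ]
    exact bdCoord_smul _ _
  rw [h2, h2]

/-- The chart at the cusp `γ∞` as a continuous map. -/
def chartMap (γ : M2pos) : C(ℝ × ℝ≥0, HBS) := ⟨fun w => γ • chartInfty w, continuous_chart γ⟩

theorem chartMap_apply (γ : M2pos) (w : ℝ × ℝ≥0) : chartMap γ w = γ • chartInfty w := rfl

theorem chartMap_coordInner (g : SL(2, ℤ)) (z : ℍ) :
    chartMap (ofSL g) (coordInner (ofSL g⁻¹ • z)) = HBS.inner z := by
  rw [chartMap_apply, chartInfty_coordInner, smul_inner, ofSL_smul_inv_smul]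

/-- Primitives exist on `ℍ` and on each chart. On the overlap of a chart with `ℍ`, which is all of
`ℍ` and path connected, they differ by a constant, `base r`, measured at `i`. After this shift they
glue to a function that is a primitive on each chart, hence globally by `eq_dPrim_of_local`. -/
theorem exists_dPrim_HBS {φ : Simplex 1 HBS → V}
    (hφ : coboundary HBS R V 1 φ = 0) : ∃ ψ : HBS → V, φ = dPrim ψ := by
  choose ψ hψ using fun r => exists_dPrim_halfPlane (R := R)
    (coboundary_comp (chartMap (ofSL (cuspRep r))) hφ)
  obtain ⟨ψ₀, hψ₀⟩ := exists_dPrim_upperHalfPlane (R := R) (coboundary_comp inclInner hφ)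
  let base : OnePoint ℚ → V := fun r =>
    ψ₀ UpperHalfPlane.I - ψ r (coordInner (ofSL (cuspRep r)⁻¹ • UpperHalfPlane.I))
  let Ψ : HBS → V := fun z => match z with
    | .inner z => ψ₀ z
    | .bd b => ψ b.cusp (bdCoord b, 0) + base b.cusp
  have hinner : ∀ (r : OnePoint ℚ) (z : ℍ),
      ψ₀ z = ψ r (coordInner (ofSL (cuspRep r)⁻¹ • z)) + base r := by
    intro r z
    obtain ⟨σ, h0, h1⟩ := exists_simplex UpperHalfPlane.I z
    let τ : Simplex 1 (ℝ × ℝ≥0) :=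
      (⟨fun z => coordInner (ofSL (cuspRep r)⁻¹ • z), continuous_coordInner.comp
        (continuous_const_smul (ofSL (cuspRep r)⁻¹))⟩ : C(ℍ, ℝ × ℝ≥0)).comp σ
    have h2 : inclInner.comp σ = (chartMap (ofSL (cuspRep r))).comp τ := by
      ext1 t
      exact (chartMap_coordInner (cuspRep r) (σ t)).symm
    have h3 := congrFun (hψ r) τ
    have h4 := congrFun hψ₀ σ
    rw [← h2, h4, dPrim, dPrim, h0, h1] at h3
    change _ = ψ r (coordInner (ofSL (cuspRep r)⁻¹ • σ _)) -
      ψ r (coordInner (ofSL (cuspRep r)⁻¹ • σ _)) at h3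
    rw [h0, h1] at h3
    simp only [base]
    rw [← sub_eq_zero] at h3 ⊢
    rw [← h3]
    abel
  have hΨ : ∀ (r : OnePoint ℚ) (w : ℝ × ℝ≥0),
      Ψ (chartMap (ofSL (cuspRep r)) w) = ψ r w + base r := by
    intro r w
    rw [chartMap_apply]
    rcases eq_or_ne w.2 0 with h1 | h1
    · have e1 : w = (w.1, 0) := Prod.ext rfl h1
      rw [e1, chartInfty_zero, smul_bd]
      change ψ (ofSL (cuspRep r) • bdInfty w.1).cusp (bdCoord (ofSL (cuspRep r) • bdInfty w.1), 0) +
        base (ofSL (cuspRep r) • bdInfty w.1).cusp = _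
      rw [bdCoord_smul, cusp_cuspRep_smul]
    · obtain ⟨z, hz, e⟩ := chartInfty_of_pos (pos_iff_ne_zero.2 h1)
      rw [hz, smul_inner]
      change ψ₀ (ofSL (cuspRep r) • z) = _
      rw [hinner r, ofSL_inv_smul_smul, e]
  refine ⟨Ψ, eq_dPrim_of_local hφ Ψ fun x => ?_⟩
  have hx : ∃ r, x ∈ Set.range (chartMap (ofSL (cuspRep r))) := by
    cases x with
    | inner z => exact ⟨OnePoint.infty, _, chartMap_coordInner _ z⟩
    | bd b => exact ⟨b.cusp, (chart_mem_iff b.cusp b).2 rfl⟩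
  obtain ⟨r, hr⟩ := hx
  refine ⟨_, (isOpenEmbedding_chart (ofSL (cuspRep r))).isOpen_range, hr, fun σ hσ => ?_⟩
  obtain ⟨τ, hτ⟩ := exists_lift_chart _ σ hσ
  have h1 : σ = (chartMap (ofSL (cuspRep r))).comp τ := by
    ext1 t
    exact hτ t
  have h2 := congrFun (hψ r) τ
  rw [h1, h2, dPrim, dPrim]
  simp only [ContinuousMap.comp_apply, hΨ]
  abel

theorem eq_of_dPrim_eq_zero [PathConnectedSpace X] {f : X → V} (h : dPrim f = 0) (x y : X) :
    f x = f y := by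
  obtain ⟨σ, h0, h1⟩ := exists_simplex x y
  have h2 := congrFun h σ
  rw [dPrim, h0, h1, Pi.zero_apply, sub_eq_zero] at h2
  exact h2.symm

instance : PathConnectedSpace ℝ≥0 :=
  isPathConnected_iff_pathConnectedSpace.1 ((convex_Ici (0 : ℝ)).isPathConnected Set.nonempty_Ici)

instance : PathConnectedSpace HBS := by
  have key : ∀ x : HBS, Joined (HBS.inner UpperHalfPlane.I) x := by
    have h1 : ∀ z : ℍ, Joined (HBS.inner UpperHalfPlane.I) (HBS.inner z) := fun z =>
      (PathConnectedSpace.joined UpperHalfPlane.I z).map inclInner.continuous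
    intro x
    cases x with
    | inner z => exact h1 z
    | bd b =>
      have h2 : Joined (chartMap (ofSL (cuspRep b.cusp)) (coordInner UpperHalfPlane.I))
          (chartMap (ofSL (cuspRep b.cusp)) (bdCoord b, 0)) :=
        (PathConnectedSpace.joined _ _).map (chartMap _).continuous
      rw [chartMap_apply, chartMap_apply, chartInfty_coordInner, chartInfty_zero, smul_inner,
        smul_bd, bdCoord_spec] at h2
      exact (h1 _).trans h2
  exact ⟨⟨HBS.inner UpperHalfPlane.I⟩, fun x y => (key x).symm.trans (key y)⟩

end Exactness

/-! ### Cohomology classes of functions with a cocycle of automorphy -/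

section Cocycles

variable {X : Type} [MulAction M2pos X]
variable {R : Type} [CommRing R] {V : Type} [AddCommGroup V] [Module R V]
variable (ρ : Representation R M2pos V)

/-- `ψ` is equivariant up to the translations `c`. -/
def HasCocycle (ψ : X → V) (c : SL(2, ℤ) → V) : Prop :=
  ∀ γ x, ψ (ofSL γ • x) = ρ (ofSL γ) (ψ x) + c γ

variable {ρ}

theorem HasCocycle.mul [Nonempty X] {ψ : X → V} {c : SL(2, ℤ) → V} (h : HasCocycle ρ ψ c)
    (γ δ : SL(2, ℤ)) : c (γ * δ) = c γ + ρ (ofSL γ) (c δ) := by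
  obtain ⟨x⟩ := ‹Nonempty X›
  have h1 := h (γ * δ) x
  rw [map_mul, mul_smul, h, h, map_mul, Module.End.mul_apply, map_add] at h1
  rw [← add_right_inj (ρ (ofSL γ) (ρ (ofSL δ) (ψ x))), ← h1]
  abel

theorem HasCocycle.sub {ψ ψ' : X → V} {c c' : SL(2, ℤ) → V} (h : HasCocycle ρ ψ c)
    (h' : HasCocycle ρ ψ' c') : HasCocycle ρ (fun x => ψ x - ψ' x) (fun γ => c γ - c' γ) :=
  fun γ x => by
    simp only [h γ x, h' γ x, map_sub]
    abel

theorem HasCocycle.smul {ψ : X → V} {c : SL(2, ℤ) → V} (a : R) (h : HasCocycle ρ ψ c) :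
    HasCocycle ρ (fun x => a • ψ x) (fun γ => a • c γ) :=
  fun γ x => by simp only [h γ x, map_smul, smul_add]

theorem HasCocycle.sub_const {ψ : X → V} {c : SL(2, ℤ) → V} (h : HasCocycle ρ ψ c) (v : V) :
    HasCocycle ρ (fun x => ψ x - v) (fun γ => c γ - (v - ρ (ofSL γ) v)) :=
  fun γ x => by
    simp only [h γ x, map_sub]
    abel

end Cocycles

section Classes

variable {X : Type} [TopologicalSpace X] [MulAction M2pos X] [ContinuousConstSMul M2pos X]
variable {R : Type} [CommRing R] {V : Type} [AddCommGroup V] [Module R V]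
variable (ρ : Representation R M2pos V)

/-- A singular zero-simplex is a point, so zero-cochains are functions on points. -/
theorem mem_B1_iff {φ : Simplex 1 X → V} : φ ∈ B1 X ρ ↔
    ∃ ψ : X → V, (∀ γ x, ψ (ofSL γ • x) = ρ (ofSL γ) (ψ x)) ∧ φ = dPrim ψ := by
  constructor
  · rintro ⟨η, hη, rfl⟩
    exact ⟨fun x => η (ContinuousMap.const _ x), fun γ x => hη γ (ContinuousMap.const _ x),
      coboundary_zero_eq_dPrim η⟩
  · rintro ⟨ψ, hψ, rfl⟩
    refine ⟨fun σ => ψ (σ (stdSimplex.vertex 0)), fun γ σ => hψ γ _, ?_⟩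
    rw [coboundary_zero_eq_dPrim]
    rfl

variable {ρ}

theorem HasCocycle.dPrim_mem {ψ : X → V} {c : SL(2, ℤ) → V} (h : HasCocycle ρ ψ c) :
    dPrim ψ ∈ Z1 X ρ := by
  refine ⟨fun γ σ => ?_, coboundary_dPrim ψ⟩
  change ψ (ofSL γ • σ _) - ψ (ofSL γ • σ _) = ρ (ofSL γ) (ψ _ - ψ _)
  rw [h, h, map_sub]
  abel

/-- Invariance of `dPrim ψ` says that `x ↦ ψ(γx) - γψ(x)` has no variation along paths, so it is
constant. Connectedness is essential here; on the boundary only differences within a component are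
controlled. -/
theorem hasCocycle_of_mem [PathConnectedSpace X] {ψ : X → V} (h : dPrim ψ ∈ Z1 X ρ) :
    ∃ c, HasCocycle ρ ψ c := by
  obtain ⟨x₀⟩ := (inferInstance : Nonempty X)
  refine ⟨fun γ => ψ (ofSL γ • x₀) - ρ (ofSL γ) (ψ x₀), fun γ x => ?_⟩
  have h1 : dPrim (fun x => ψ (ofSL γ • x) - ρ (ofSL γ) (ψ x)) = 0 := by
    funext σ
    have h2 : ψ (ofSL γ • σ (stdSimplex.vertex 1)) - ψ (ofSL γ • σ (stdSimplex.vertex 0)) =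
        ρ (ofSL γ) (ψ _ - ψ _) := h.1 γ σ
    rw [map_sub] at h2
    simp only [dPrim, Pi.zero_apply]
    rw [sub_sub_sub_comm, h2, sub_self]
  exact sub_eq_iff_eq_add'.1 (eq_of_dPrim_eq_zero h1 x x₀)

variable (ρ) in
/-- The class of the cocycle `dPrim ψ`. -/
def cls (ψ : X → V) (h : dPrim ψ ∈ Z1 X ρ) : H1 X ρ := H1.mk ρ ⟨dPrim ψ, h⟩

theorem mk_surjective : Function.Surjective (H1.mk (X := X) ρ) :=
  Submodule.mkQ_surjective _

theorem mk_eq_zero_iff (φ : Z1 X ρ) : H1.mk ρ φ = 0 ↔ φ.1 ∈ B1 X ρ :=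
  Submodule.Quotient.mk_eq_zero _

theorem mk_eq_mk_iff (φ φ' : Z1 X ρ) : H1.mk ρ φ = H1.mk ρ φ' ↔ φ.1 - φ'.1 ∈ B1 X ρ := by
  rw [← sub_eq_zero, ← map_sub, mk_eq_zero_iff]
  rfl

theorem cls_congr {ψ ψ' : X → V} {h : dPrim ψ ∈ Z1 X ρ} {h' : dPrim ψ' ∈ Z1 X ρ}
    (e : dPrim ψ = dPrim ψ') : cls ρ ψ h = cls ρ ψ' h' :=
  congrArg (H1.mk ρ) (Subtype.ext e)

/-- Functions with the same cocycle have the same class. -/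
theorem cls_eq_cls_of_hasCocycle {ψ ψ' : X → V} {c : SL(2, ℤ) → V} (h : HasCocycle ρ ψ c)
    (h' : HasCocycle ρ ψ' c) : cls ρ ψ h.dPrim_mem = cls ρ ψ' h'.dPrim_mem := by
  refine (mk_eq_mk_iff _ _).2 ((mem_B1_iff ρ).2 ⟨fun x => ψ x - ψ' x, fun γ x => ?_,
    (dPrim_sub ψ ψ').symm⟩)
  have := h.sub h' γ x
  simp only [sub_self, add_zero] at this
  exact this

/-- Two primitives of one cocycle differ by a constant vector `v`, which alters `c` by `v - γv`. So
a class is determined by the class of `c` in group cohomology, whichever path-connected space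
carries it. -/
theorem cls_eq_zero_iff [PathConnectedSpace X] {ψ : X → V} {c : SL(2, ℤ) → V}
    (h : HasCocycle ρ ψ c) :
    cls ρ ψ h.dPrim_mem = 0 ↔ ∃ v, ∀ γ, c γ = v - ρ (ofSL γ) v := by
  obtain ⟨x₀⟩ := (inferInstance : Nonempty X)
  rw [cls, mk_eq_zero_iff, mem_B1_iff]
  constructor
  · rintro ⟨η, hη, e⟩
    have h1 : dPrim (fun x => ψ x - η x) = 0 := by
      rw [dPrim_sub, sub_eq_zero]
      exact e
    refine ⟨ψ x₀ - η x₀, fun γ => ?_⟩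
    have h2 := eq_of_dPrim_eq_zero h1 (ofSL γ • x₀) x₀
    simp only [h γ x₀, hη γ x₀] at h2
    rw [map_sub, ← h2]
    abel
  · rintro ⟨v, hv⟩
    refine ⟨fun x => ψ x - v, fun γ x => ?_, (dPrim_sub_const ψ v).symm⟩
    have := h.sub_const v γ x
    simp only [hv, sub_self, add_zero] at this
    exact this

theorem cls_smul {ψ : X → V} {c : SL(2, ℤ) → V} (a : R) (h : HasCocycle ρ ψ c) :
    cls ρ _ (h.smul a).dPrim_mem = a • cls ρ ψ h.dPrim_mem := by
  rw [cls, cls, ← map_smul]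
  exact congrArg (H1.mk ρ) (Subtype.ext (dPrim_smul a ψ))

theorem exists_cls_HBS (u : H1 HBS ρ) :
    ∃ (ψ : HBS → V) (c : SL(2, ℤ) → V) (h : HasCocycle ρ ψ c), u = cls ρ ψ h.dPrim_mem := by
  obtain ⟨φ, rfl⟩ := mk_surjective u
  obtain ⟨ψ, hψ⟩ := exists_dPrim_HBS φ.2.2
  have h1 : dPrim ψ ∈ Z1 HBS ρ := hψ ▸ φ.2
  obtain ⟨c, hc⟩ := hasCocycle_of_mem h1
  exact ⟨ψ, c, hc, congrArg (H1.mk ρ) (Subtype.ext hψ)⟩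

/-! #### Hecke operators on functions -/

variable (ρ) in
/-- The Hecke operator on functions. -/
def heckeFun (p : Nat.Primes) (ψ : X → V) : X → V :=
  fun x => ∑ i : Option (Fin p), ρ (adj (heckeRep p i)) (ψ (heckeRep p i • x))

theorem heckeCochain_dPrim (p : Nat.Primes) (ψ : X → V) :
    heckeCochain X ρ p 1 (dPrim ψ) = dPrim (heckeFun ρ p ψ) := by
  funext σ
  change ∑ i : Option (Fin p), ρ (adj (heckeRep p i)) (ψ (heckeRep p i • σ _) -
    ψ (heckeRep p i • σ _)) = _
  simp only [map_sub, Finset.sum_sub_distrib]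
  rfl

theorem dPrim_heckeFun_mem (p : Nat.Primes) {ψ : X → V} (h : dPrim ψ ∈ Z1 X ρ) :
    dPrim (heckeFun ρ p ψ) ∈ Z1 X ρ := by
  rw [← heckeCochain_dPrim]
  refine ⟨heckeCochain_invariants ρ p 1 _ h.1, ?_⟩
  have h2 : coboundary X R V 1 (dPrim ψ) = 0 := h.2
  change coboundary X R V 1 _ = 0
  rw [← heckeCochain_coboundary, h2, map_zero]

theorem hecke_cls (p : Nat.Primes) {ψ : X → V} (h : dPrim ψ ∈ Z1 X ρ) :
    hecke ρ p (cls ρ ψ h) = cls ρ (heckeFun ρ p ψ) (dPrim_heckeFun_mem p h) := by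
  change H1.mk ρ _ = H1.mk ρ _
  exact congrArg (H1.mk ρ) (Subtype.ext (heckeCochain_dPrim p ψ))

theorem pullback_hecke {X' : Type} [TopologicalSpace X'] [MulAction M2pos X']
    [ContinuousConstSMul M2pos X'] (f : C(X, X')) (hf : ∀ (γ : M2pos) (x : X), f (γ • x) = γ • f x)
    (p : Nat.Primes) (u : H1 X' ρ) :
    H1.pullback f hf ρ (hecke ρ p u) = hecke ρ p (H1.pullback f hf ρ u) := by
  obtain ⟨φ, rfl⟩ := mk_surjective u
  change H1.mk ρ _ = H1.mk ρ _
  refine congrArg (H1.mk ρ) (Subtype.ext ?_)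
  funext σ
  change ∑ i : Option (Fin p), ρ (adj (heckeRep p i)) (φ.1 (heckeRep p i • f.comp σ)) =
    ∑ i : Option (Fin p), ρ (adj (heckeRep p i)) (φ.1 (f.comp (heckeRep p i • σ)))
  exact Finset.sum_congr rfl fun i _ => congrArg (fun τ => ρ _ (φ.1 τ))
    (ContinuousMap.ext fun t => (hf _ _).symm)

theorem coeffMap_hecke {R' : Type} [CommRing R'] {V' : Type} [AddCommGroup V'] [Module R' V']
    {f : R →+* R'} (ρ' : Representation R' M2pos V')
    (g : V →ₛₗ[f] V') (hg : ∀ γ v, g (ρ γ v) = ρ' γ (g v)) (p : Nat.Primes) (u : H1 X ρ) :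
    H1.coeffMap ρ ρ' g hg (hecke ρ p u) = hecke ρ' p (H1.coeffMap ρ ρ' g hg u) := by
  obtain ⟨φ, rfl⟩ := mk_surjective u
  change H1.mk ρ' _ = H1.mk ρ' _
  refine congrArg (H1.mk ρ') (Subtype.ext ?_)
  funext σ
  change g (∑ i : Option (Fin p), ρ (adj (heckeRep p i)) (φ.1 (heckeRep p i • σ))) =
    ∑ i : Option (Fin p), ρ' (adj (heckeRep p i)) (g (φ.1 (heckeRep p i • σ)))
  rw [map_sum]
  exact Finset.sum_congr rfl fun i _ => hg _ _

end Classes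

/-! ### Realising group cocycles -/

section Stabilizers

/-- A multiple of a group cocycle is realised by a function on any set on which the group acts with
finite stabilizers of bounded order. -/
theorem exists_function_of_cocycle {G Y R V : Type*} [Group G] [MulAction G Y] [CommRing R]
    [AddCommGroup V] [Module R V] (ρ : Representation R G V) (c : G → V)
    (hc : ∀ g h, c (g * h) = c g + ρ g (c h)) (M : ℕ)
    (hfin : ∀ y : Y, Finite (MulAction.stabilizer G y))
    (hM : ∀ y : Y, Nat.card (MulAction.stabilizer G y) ∣ M) :
    ∃ ψ : Y → V, ∀ g y, ψ (g • y) = ρ g (ψ y) + M • c g := by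
  classical
  have hv : ∀ y : Y, ∃ v : V, ∀ δ ∈ MulAction.stabilizer G y, ρ δ v + M • c δ = v := by
    intro y
    have := hfin y
    have := Fintype.ofFinite (MulAction.stabilizer G y)
    obtain ⟨k, hk⟩ := hM y
    -- With `M = |Stab y| · k`, the sum of `c` over the stabilizer trivialises `|Stab y| • c` there.
    -- Summing instead of averaging avoids division, so this works over `ℤ`.
    refine ⟨k • ∑ ε : MulAction.stabilizer G y, c ε, fun δ hδ => ?_⟩
    have h1 : ∑ ε : MulAction.stabilizer G y, ρ δ (c ε) =
        (∑ ε : MulAction.stabilizer G y, c ε) - Nat.card (MulAction.stabilizer G y) • c δ := by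
      rw [← Equiv.sum_comp (Equiv.mulLeft (⟨δ, hδ⟩ : MulAction.stabilizer G y))
        fun ε => c ε, Nat.card_eq_fintype_card, ← Finset.card_univ, ← Finset.sum_const,
        ← Finset.sum_sub_distrib]
      refine Finset.sum_congr rfl fun ε _ => ?_
      change _ = c (δ * ε) - c δ
      rw [hc, add_sub_cancel_left]
    rw [map_nsmul, map_sum, h1, hk, smul_sub, smul_smul, mul_comm k, sub_add_cancel]
  choose v hv using hv
  let r : Y → Y := fun y => (Quotient.mk (MulAction.orbitRel G Y) y).out
  have hr : ∀ y, ∃ g : G, g • r y = y := fun y =>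
    (MulAction.orbitRel G Y).symm (Quotient.exact (Quotient.out_eq (Quotient.mk (MulAction.orbitRel G Y) y)))
  have hrs : ∀ (g : G) y, r (g • y) = r y := fun g y => by
    refine congrArg Quotient.out (Quotient.sound ?_)
    exact ⟨g, rfl⟩
  choose t ht using hr
  -- The value carried from an orbit representative by a group element depends only on the point
  -- that is reached.
  have key : ∀ (y : Y) (g h : G), g • y = h • y → ρ g (v y) + M • c g = ρ h (v y) + M • c h := by
    intro y g h hgh
    have h1 : g⁻¹ * h ∈ MulAction.stabilizer G y := by
      rw [MulAction.mem_stabilizer_iff, mul_smul, ← hgh, inv_smul_smul]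
    have h2 := congrArg (ρ g) (hv y _ h1)
    have h3 := hc g (g⁻¹ * h)
    rw [mul_inv_cancel_left] at h3
    rw [map_add, ← Module.End.mul_apply, ← map_mul, mul_inv_cancel_left, map_nsmul] at h2
    rw [← h2, h3, smul_add]
    abel
  refine ⟨fun y => ρ (t y) (v (r y)) + M • c (t y), fun g y => ?_⟩
  simp only [hrs]
  have h1 := key (r y) (t (g • y)) (g * t y) (by
    rw [mul_smul, ht y]
    have := ht (g • y)
    rwa [hrs] at this)
  rw [h1, hc, map_mul, Module.End.mul_apply, map_add, map_nsmul, smul_add]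
  abel

/-- Reduction modulo `3`. -/
def redThree : SL(2, ℤ) →* SL(2, ZMod 3) := Matrix.SpecialLinearGroup.map (Int.castRingHom (ZMod 3))

theorem exists_of_redThree_eq_one {γ : SL(2, ℤ)} (h : redThree γ = 1) :
    ∃ a b c d : ℤ, γ.1 0 0 = 1 + 3 * a ∧ γ.1 0 1 = 3 * b ∧ γ.1 1 0 = 3 * c ∧ γ.1 1 1 = 1 + 3 * d := by
  have key : ∀ i j, ((γ.1 i j : ℤ) : ZMod 3) = (1 : SL(2, ZMod 3)).1 i j := fun i j => by
    rw [← h]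
    rfl
  have h3 : ∀ m : ℤ, (m : ZMod 3) = 0 → (3 : ℤ) ∣ m := fun m hm =>
    (ZMod.intCast_zmod_eq_zero_iff_dvd m 3).1 hm
  obtain ⟨a, ha⟩ := h3 (γ.1 0 0 - 1) (by have := key 0 0; push_cast; rw [this]; simp)
  obtain ⟨b, hb⟩ := h3 (γ.1 0 1) (by have := key 0 1; rw [this]; simp)
  obtain ⟨c, hc⟩ := h3 (γ.1 1 0) (by have := key 1 0; rw [this]; simp)
  obtain ⟨d, hd⟩ := h3 (γ.1 1 1 - 1) (by have := key 1 1; push_cast; rw [this]; simp)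
  exact ⟨a, b, c, d, by linarith, hb, hc, by linarith⟩

theorem eq_one_of_entries {γ : SL(2, ℤ)} (h0 : γ.1 0 0 = 1) (h1 : γ.1 0 1 = 0) (h2 : γ.1 1 0 = 0)
    (h3 : γ.1 1 1 = 1) : γ = 1 := by
  ext i j
  fin_cases i <;> fin_cases j
  · exact h0
  · exact h1
  · exact h2
  · exact h3

/-- An element of `SL₂(ℤ)` with a fixed point in `ℍ` has trace at most `2` in absolute value.
Writing `γ = 1 + 3(a, b; c, d)`, the determinant forces `3 ∣ a + d`, so the trace `2 + 3(a + d)`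
must be `2`, and then `γ` is the identity. -/
theorem eq_one_of_fix_inner {γ : SL(2, ℤ)} (h : redThree γ = 1) {z : ℍ} (hz : ofSL γ • z = z) :
    γ = 1 := by
  obtain ⟨a, b, c, d, ha, hb, hc, hd⟩ := exists_of_redThree_eq_one h
  have hdet := γ.2
  rw [Matrix.det_fin_two, ha, hb, hc, hd] at hdet
  have h1 := congrArg UpperHalfPlane.coe hz
  rw [coe_smulH, div_eq_iff (denomH_ne_zero _ z)] at h1
  change ((γ.1 0 0 : ℤ) : ℂ) * z + (γ.1 0 1 : ℤ) = z * (((γ.1 1 0 : ℤ) : ℂ) * z + (γ.1 1 1 : ℤ)) at h1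
  rw [ha, hb, hc, hd] at h1
  have hre := congrArg Complex.re h1
  have him := congrArg Complex.im h1
  simp at hre him
  have hy := z.im_pos
  have e1 : (a : ℝ) = 2 * z.re * c + d := by
    have : z.im * (3 * ((a : ℝ) - (2 * z.re * c + d))) = 0 := by linear_combination him
    rcases mul_eq_zero.1 this with h2 | h2
    · exact absurd h2 hy.ne'
    · linarith
  have e2 : (b : ℝ) = - c * (z.re ^ 2 + z.im ^ 2) := by
    rw [e1] at hre
    linear_combination hre / 3
  have hdet' : (a : ℝ) + d + 3 * (a * d - b * c) = 0 := by
    have : ((1 + 3 * a) * (1 + 3 * d) - 3 * b * (3 * c) : ℝ) = 1 := by exact_mod_cast hdet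
    linear_combination this / 3
  -- This is `tr² - 4 = -4 (γ₁₀ Im z)²`, the discriminant of the fixed point equation.
  have e3 : (2 + 3 * ((a : ℝ) + d)) ^ 2 + 36 * (c * z.im) ^ 2 = 4 := by
    have : (a : ℝ) - d = 2 * z.re * c := by linarith
    have h5 : ((a : ℝ) - d) ^ 2 = (2 * z.re * c) ^ 2 := by rw [this]
    linear_combination 12 * hdet' + 9 * h5 + 36 * c * e2
  have e4 : a + d = 3 * (b * c - a * d) := by
    have : (a : ℤ) + d + 3 * (a * d - b * c) = 0 := by exact_mod_cast hdet'
    linarith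
  have hsum : (2 + 3 * (a + d)) ^ 2 ≤ 4 := by
    have : (2 + 3 * ((a : ℝ) + d)) ^ 2 ≤ 4 := by nlinarith [sq_nonneg (c * z.im)]
    exact_mod_cast this
  -- The bounds leave `a + d = 0` or `-1`; divisibility by `3` excludes `-1`.
  have hk : a + d = 0 := by
    have h6 : 2 + 3 * (a + d) ≤ 2 := by nlinarith
    have h7 : -2 ≤ 2 + 3 * (a + d) := by nlinarith
    omega
  have hc0 : c = 0 := by
    have h8 : (a : ℝ) + d = 0 := by exact_mod_cast hk
    rw [h8] at e3
    have h9 : (c * z.im : ℝ) ^ 2 = 0 := by linarith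
    have h10 := pow_eq_zero_iff (two_ne_zero) |>.1 h9
    rcases mul_eq_zero.1 h10 with h11 | h11
    · exact_mod_cast h11
    · exact absurd h11 hy.ne'
  have hb0 : b = 0 := by
    have : (b : ℝ) = 0 := by rw [e2, hc0]; simp
    exact_mod_cast this
  have had : a = d := by
    have : (a : ℝ) = d := by rw [e1, hc0]; simp
    exact_mod_cast this
  exact eq_one_of_entries (by rw [ha]; omega) (by rw [hb]; omega) (by rw [hc]; omega)
    (by rw [hd]; omega)

/-- After conjugation the cusp is `∞`, where the stabilizer is `±T^k`. The congruence modulo `3`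
excludes the sign, and `T^k` is a translation by `k`, so a fixed point gives `k = 0`. -/
theorem eq_one_of_fix_boundary {γ : SL(2, ℤ)} (h : redThree γ = 1) {b : BSBoundary}
    (hb : ofSL γ • b = b) : γ = 1 := by
  set g := cuspRep b.cusp
  have hb' := bdCoord_spec b
  set x := bdCoord b
  have h1 : ofSL (g⁻¹ * γ * g) • bdInfty x = bdInfty x := by
    rw [map_mul, map_mul, mul_smul, mul_smul, hb', hb]
    rw [← hb', ofSL_inv_smul_smul]
  have h2 : redThree (g⁻¹ * γ * g) = 1 := by
    rw [map_mul, map_mul, h, mul_one, ← map_mul, inv_mul_cancel, map_one]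
  have h3 : g⁻¹ * γ * g = 1 := by
    set δ := g⁻¹ * γ * g
    obtain ⟨a, b, c, d, ha, hb, hc, hd⟩ := exists_of_redThree_eq_one h2
    have h4 : (ofSL δ).1 1 0 = 0 := by
      rw [← cusp_smul_bdInfty_eq_infty_iff (ofSL δ) x, h1]
      rfl
    have h5 : δ.1 1 0 = 0 := h4
    have hdet := δ.2
    rw [Matrix.det_fin_two, h5, mul_zero, sub_zero] at hdet
    have h6 : δ.1 0 0 = 1 ∧ δ.1 1 1 = 1 := by
      rcases Int.eq_one_or_neg_one_of_mul_eq_one' hdet with h7 | h7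
      · exact h7
      · omega
    rw [smul_bdInfty h4] at h1
    have h7 := bdInfty_injective h1
    change ((δ.1 0 0 : ℤ) * x + (δ.1 0 1 : ℤ)) / ((δ.1 1 1 : ℤ) : ℝ) = x at h7
    rw [h6.1, h6.2] at h7
    have h8 : ((δ.1 0 1 : ℤ) : ℝ) = 0 := by
      simpa using h7
    exact eq_one_of_entries h6.1 (by exact_mod_cast h8) h5 h6.2
  have h4 : γ = g * (g⁻¹ * γ * g) * g⁻¹ := by group
  rw [h4, h3]
  group

theorem eq_one_of_fix {γ : SL(2, ℤ)} (h : redThree γ = 1) {x : HBS} (hx : ofSL γ • x = x) :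
    γ = 1 := by
  cases x with
  | inner z =>
    rw [smul_inner] at hx
    injection hx with hx
    exact eq_one_of_fix_inner h hx
  | bd b =>
    rw [smul_bd] at hx
    injection hx with hx
    exact eq_one_of_fix_boundary h hx

/-- The order of `SL₂(ℤ/3)`; the orders of the stabilizers in `SL₂(ℤ)` of the points of `ℍ^BS`
divide it. -/
def stabBound : ℕ := Nat.card SL(2, ZMod 3)

theorem stabBound_ne_zero : stabBound ≠ 0 := Nat.card_pos.ne'

/-- Reduction modulo `3` is injective on every stabilizer, so all their orders divide `stabBound`.
No continuity of `ψ` is asked for, which is why defining it orbit by orbit suffices. -/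
theorem exists_hasCocycle {R V : Type} [CommRing R] [AddCommGroup V] [Module R V]
    (ρ : Representation R M2pos V) (c : SL(2, ℤ) → V)
    (hc : ∀ γ δ, c (γ * δ) = c γ + ρ (ofSL γ) (c δ)) :
    ∃ ψ : HBS → V, HasCocycle ρ ψ fun γ => stabBound • c γ := by
  let _ : MulAction SL(2, ℤ) HBS := MulAction.compHom HBS ofSL
  have hinj : ∀ y : HBS, Function.Injective
      (redThree.comp (MulAction.stabilizer SL(2, ℤ) y).subtype) := fun y => by
    rw [injective_iff_map_eq_one]
    rintro ⟨γ, hγ⟩ h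
    exact Subtype.ext (eq_one_of_fix h hγ)
  exact exists_function_of_cocycle (ρ.comp ofSL) c hc stabBound
    (fun y => Finite.of_injective _ (hinj y)) (fun y => Subgroup.card_dvd_of_injective _ (hinj y))

theorem exists_hasCocycle_field {K V : Type} [Field K] [CharZero K] [AddCommGroup V] [Module K V]
    (ρ : Representation K M2pos V) (c : SL(2, ℤ) → V)
    (hc : ∀ γ δ, c (γ * δ) = c γ + ρ (ofSL γ) (c δ)) :
    ∃ ψ : HBS → V, HasCocycle ρ ψ c := by
  obtain ⟨ψ, hψ⟩ := exists_hasCocycle ρ c hc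
  refine ⟨fun x => (stabBound : K)⁻¹ • ψ x, ?_⟩
  have h1 := hψ.smul (stabBound : K)⁻¹
  have h2 : (stabBound : K) ≠ 0 := Nat.cast_ne_zero.2 stabBound_ne_zero
  have h3 : (fun γ => (stabBound : K)⁻¹ • stabBound • c γ) = c := by
    funext γ
    rw [← Nat.cast_smul_eq_nsmul K, smul_smul, inv_mul_cancel₀ h2, one_smul]
  rwa [h3] at h1

end Stabilizers

/-! ### The coefficient modules -/

section CoefficientModules

variable (n : ℕ) (R : Type) [CommRing R]

/-- The polynomial `binom(n, ν) X₁^(n-ν) X₂^ν` as an element of `M_n^♭ ⊗ R`. -/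
def flatVec (ν : Fin (n + 1)) : Mflat n R :=
  ⟨binomMonomial R n ν, binomMonomial_mem R (Nat.lt_succ_iff.1 ν.2)⟩

theorem binomMonomial_eq_monomial (ν : ℕ) : binomMonomial R n ν =
    MvPolynomial.monomial (Finsupp.single 0 (n - ν) + Finsupp.single 1 ν) (n.choose ν : R) := by
  rw [binomMonomial, ← mul_one (n.choose ν : R), ← MvPolynomial.C_mul_monomial,
    ← mul_one (1 : R), ← MvPolynomial.monomial_mul, MvPolynomial.X_pow_eq_monomial,
    MvPolynomial.X_pow_eq_monomial]
  simp [mul_assoc]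

variable {n R}

theorem span_flatVec : Submodule.span R (Set.range (flatVec n R)) = ⊤ := by
  rw [eq_top_iff]
  rintro ⟨P, hP⟩ -
  induction hP using Submodule.span_induction with
  | mem x hx =>
    obtain ⟨ν, rfl⟩ := hx
    rcases neg_one_pow_eq_or (MvPolynomial (Fin 2) R) (n - ν) with h | h
    · refine Submodule.subset_span ⟨ν, Subtype.ext ?_⟩
      change binomMonomial R n ν = eFlat R n ν
      rw [eFlat, h, one_mul]
    · rw [← neg_mem_iff]
      refine Submodule.subset_span ⟨ν, Subtype.ext ?_⟩
      change binomMonomial R n ν = - eFlat R n ν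
      rw [eFlat, h, neg_one_mul, neg_neg]
  | zero => exact zero_mem _
  | add x y hx hy h1 h2 => exact add_mem h1 h2
  | smul a x hx h => exact Submodule.smul_mem _ a h

theorem exists_eq_sum_flatVec (P : Mflat n R) :
    ∃ a : Fin (n + 1) → R, P = ∑ ν, a ν • flatVec n R ν := by
  have h : P ∈ Submodule.span R (Set.range (flatVec n R)) := by
    rw [span_flatVec]
    trivial
  obtain ⟨a, ha⟩ := (Submodule.mem_span_range_iff_exists_fun R).1 h
  exact ⟨a, ha.symm⟩

theorem coeff_flatVec (μ ν : Fin (n + 1)) :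
    MvPolynomial.coeff (Finsupp.single 0 (n - μ) + Finsupp.single 1 (μ : ℕ)) (flatVec n R ν).1 =
      if ν = μ then (n.choose ν : R) else 0 := by
  change MvPolynomial.coeff _ (binomMonomial R n ν) = _
  rw [binomMonomial_eq_monomial, MvPolynomial.coeff_monomial]
  congr 1
  rw [eq_iff_iff]
  constructor
  · intro h
    have h1 := DFunLike.congr_fun h 1
    simp at h1
    exact Fin.ext h1
  · rintro rfl
    rfl

theorem linearIndependent_flatVec [IsDomain R] [CharZero R] :
    LinearIndependent R (flatVec n R) := by
  rw [Fintype.linearIndependent_iff]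
  intro a ha μ
  have h1 := congrArg (fun P : Mflat n R =>
    MvPolynomial.coeff (Finsupp.single 0 (n - μ) + Finsupp.single 1 (μ : ℕ)) P.1) ha
  simp only [Submodule.coe_sum, Submodule.coe_smul, MvPolynomial.coeff_sum, MvPolynomial.coeff_smul,
    coeff_flatVec, ZeroMemClass.coe_zero, MvPolynomial.coeff_zero] at h1
  simp only [smul_eq_mul, mul_ite, mul_zero, Finset.sum_ite_eq', Finset.mem_univ, if_true] at h1
  have h2 : (n.choose μ : R) ≠ 0 :=
    Nat.cast_ne_zero.2 (Nat.choose_pos (Nat.lt_succ_iff.1 μ.2)).ne'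
  exact (mul_eq_zero.1 h1).resolve_right h2

/-- The basis of the polynomials `binom(n, ν) X₁^(n-ν) X₂^ν` of `M_n^♭ ⊗ R`. -/
def flatBasis (n : ℕ) (R : Type) [CommRing R] [IsDomain R] [CharZero R] :
    Module.Basis (Fin (n + 1)) R (Mflat n R) :=
  Module.Basis.mk linearIndependent_flatVec span_flatVec.ge

theorem flatBasis_apply [IsDomain R] [CharZero R] (ν : Fin (n + 1)) :
    flatBasis n R ν = flatVec n R ν := Module.Basis.mk_apply _ _ ν

theorem flatRep_flatVec (γ : M2pos) (ν : Fin (n + 1)) : flatRep n R γ (flatVec n R ν) =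
    ∑ μ : Fin (n + 1), ((actPoly n γ μ).coeff ν : R) • flatVec n R μ := by
  apply Subtype.ext
  change polyAct R γ (binomMonomial R n ν) = _
  rw [polyAct_binomMonomial R n γ (Nat.lt_succ_iff.1 ν.2), Finset.sum_range]
  simp only [Submodule.coe_sum, Submodule.coe_smul]
  rfl

/-- Evaluation at an integral vector. -/
def ev (n : ℕ) (R : Type) [CommRing R] (w : Fin 2 → ℤ) : Mflat n R →ₗ[R] R :=
  (MvPolynomial.aeval (R := R) fun i => ((w i : ℤ) : R)).toLinearMap ∘ₗ (Mflat n R).subtype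

theorem ev_flatVec (w : Fin 2 → ℤ) (ν : Fin (n + 1)) :
    ev n R w (flatVec n R ν) = n.choose ν * (w 0 : R) ^ (n - ν) * (w 1 : R) ^ (ν : ℕ) := by
  change MvPolynomial.aeval _ (binomMonomial R n ν) = _
  simp [binomMonomial]

/-- Evaluation turns the action on polynomials into a move of the vector, so identities and
estimates in `Mflat` become scalar ones. In a Hecke operator the coefficient is acted on by `adj α`,
and the vector is then moved by `α` itself. -/
theorem ev_flatRep (w : Fin 2 → ℤ) (γ : M2pos) (P : Mflat n R) :
    ev n R w (flatRep n R γ P) = ev n R ((adj γ).1.mulVec w) P := by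
  have h : (MvPolynomial.aeval (R := R) fun i => ((w i : ℤ) : R)).comp (polyAct R γ) =
      MvPolynomial.aeval (R := R) fun i => ((((adj γ).1.mulVec w) i : ℤ) : R) := by
    apply MvPolynomial.algHom_ext
    intro i
    fin_cases i
    · simp [polyAct, adj, Matrix.adjugate_fin_two, Matrix.mulVec, dotProduct, Fin.sum_univ_two]
      ring
    · simp [polyAct, adj, Matrix.adjugate_fin_two, Matrix.mulVec, dotProduct, Fin.sum_univ_two]
  exact congrArg (fun f => f P.1) h

theorem ev_flatRep_adj (w : Fin 2 → ℤ) (γ : M2pos) (P : Mflat n R) :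
    ev n R w (flatRep n R (adj γ) P) = ev n R (γ.1.mulVec w) P := by
  rw [ev_flatRep, adj_adj]

/-- The vectors `(1, k)` already suffice: they give infinitely many roots of a polynomial in `k`,
and the binomial coefficients are nonzero in `R`. -/
theorem eq_zero_of_ev_eq_zero [IsDomain R] [CharZero R] {P : Mflat n R}
    (h : ∀ w, ev n R w P = 0) : P = 0 := by
  obtain ⟨a, rfl⟩ := exists_eq_sum_flatVec P
  have h1 : ∑ ν : Fin (n + 1), Polynomial.monomial (ν : ℕ) (a ν * n.choose ν) = 0 := by
    refine Polynomial.eq_zero_of_infinite_isRoot _ (Set.Infinite.mono ?_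
      (Set.infinite_range_of_injective (Nat.cast_injective (R := R))))
    rintro _ ⟨k, rfl⟩
    have h2 := h ![1, k]
    rw [map_sum] at h2
    simp only [map_smul, ev_flatVec] at h2
    change Polynomial.eval _ _ = 0
    rw [Polynomial.eval_finsetSum, ← h2]
    refine Finset.sum_congr rfl fun ν _ => ?_
    simp [mul_assoc]
  have h2 : ∀ ν, a ν = 0 := fun μ => by
    have h3 := congrArg (fun p => Polynomial.coeff p μ) h1
    simp only [Polynomial.finsetSum_coeff, Polynomial.coeff_monomial, Polynomial.coeff_zero] at h3
    rw [Finset.sum_eq_single μ] at h3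
    · rw [if_pos rfl] at h3
      exact (mul_eq_zero.1 h3).resolve_right
        (Nat.cast_ne_zero.2 (Nat.choose_pos (Nat.lt_succ_iff.1 μ.2)).ne')
    · intro ν _ hν
      exact if_neg fun h4 => hν (Fin.ext h4)
    · simp
  simp [h2]

theorem flatMap_flatVec {S : Type} [CommRing S] (f : R →+* S) (ν : Fin (n + 1)) :
    flatMap n f (flatVec n R ν) = flatVec n S ν := by
  apply Subtype.ext
  change MvPolynomial.map f (binomMonomial R n ν) = binomMonomial S n ν
  simp [binomMonomial]

theorem ev_flatMap {S : Type} [CommRing S] (f : R →+* S) (w : Fin 2 → ℤ) (P : Mflat n R) :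
    ev n S w (flatMap n f P) = f (ev n R w P) := by
  obtain ⟨a, rfl⟩ := exists_eq_sum_flatVec P
  rw [map_sum, map_sum, map_sum, map_sum]
  refine Finset.sum_congr rfl fun ν _ => ?_
  rw [map_smulₛₗ, flatMap_flatVec, map_smul, map_smul, ev_flatVec, ev_flatVec]
  simp

/-- The coefficient at `X₁^n` is the value at `(1, 0)`, and the sign in `e_0^♭` is trivial for even
`n`. -/
theorem pairE0_eq_ev (hn : Even n) (P : Mflat n R) : pairE0 n P = ev n R ![1, 0] P := by
  obtain ⟨a, rfl⟩ := exists_eq_sum_flatVec P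
  rw [pairE0, hn.neg_one_pow, one_mul, map_sum, Submodule.coe_sum, MvPolynomial.coeff_sum]
  refine Finset.sum_congr rfl fun ν _ => ?_
  have h1 := coeff_flatVec (R := R) (0 : Fin (n + 1)) ν
  simp only [Fin.val_zero, Finsupp.single_zero, add_zero, Nat.sub_zero] at h1
  rw [Submodule.coe_smul, MvPolynomial.coeff_smul, map_smul, h1, ev_flatVec]
  rcases eq_or_ne ν 0 with rfl | h2
  · simp
  · have h3 : (ν : ℕ) ≠ 0 := fun h => h2 (Fin.ext h)
    simp [h2, h3]

theorem flatMap_flatRep {S : Type} [CommRing S] (f : R →+* S) (γ : M2pos) (P : Mflat n R) :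
    flatMap n f (flatRep n R γ P) = flatRep n S γ (flatMap n f P) :=
  Subtype.ext (polyAct_map f γ P.1)

theorem flatMap_injective {S : Type} [CommRing S] {f : R →+* S} (hf : Function.Injective f) :
    Function.Injective (flatMap n f) := fun _ _ h =>
  Subtype.ext (MvPolynomial.map_injective f hf (congrArg Subtype.val h))

/-- The stabilizer of a cusp contains `-1` besides the translations, and `-1` fixes the component
pointwise. Its trivial action on coefficients lets functions on the component of `∞` be induced to
the whole boundary. -/
theorem flatRep_neg_one (hn : Even n) (P : Mflat n R) : flatRep n R (ofSL (-1)) P = P := by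
  apply Subtype.ext
  change polyAct R (ofSL (-1)) P.1 = P.1
  obtain ⟨a, rfl⟩ := exists_eq_sum_flatVec P
  simp only [Submodule.coe_sum, Submodule.coe_smul, map_sum, map_smul]
  refine Finset.sum_congr rfl fun ν _ => ?_
  congr 1
  change polyAct R (ofSL (-1)) (binomMonomial R n ν) = binomMonomial R n ν
  have h : (-1 : MvPolynomial (Fin 2) R) ^ (n - ν) * (-1) ^ (ν : ℕ) = 1 := by
    rw [← pow_add, Nat.sub_add_cancel (Nat.lt_succ_iff.1 ν.2), hn.neg_one_pow]
  have h0 : polyAct R (ofSL (-1)) (MvPolynomial.X 0) = -1 * MvPolynomial.X 0 := by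
    simp [polyAct, ofSL]
  have h1 : polyAct R (ofSL (-1)) (MvPolynomial.X 1) = -1 * MvPolynomial.X 1 := by
    simp [polyAct, ofSL]
  rw [binomMonomial, map_mul, map_mul, map_pow, map_pow, h0, h1, map_natCast, mul_pow, mul_pow]
  linear_combination (n.choose ν : MvPolynomial (Fin 2) R) * MvPolynomial.X 0 ^ (n - ν) *
    MvPolynomial.X 1 ^ (ν : ℕ) * h

/-- The translation `T`, as an element of `M₂⁺(ℤ)`. -/
abbrev transT : M2pos := ofSL ModularGroup.T

theorem actPoly_transT_coeff (μ ν : ℕ) :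
    (actPoly n transT μ).coeff ν = (-1) ^ (μ - ν) * (μ.choose ν : ℤ) := by
  have h1 : actPoly n transT μ = (Polynomial.X + Polynomial.C (-1)) ^ μ := by
    simp [actPoly, transT, ofSL, ModularGroup.T, sub_eq_add_neg]
  rw [h1, Polynomial.coeff_X_add_C_pow]

/-- The vector `(1, 0)` is fixed by `T`. This invariance makes the boundary pairing independent of
the primitive and of the base point. -/
theorem ev_transT (P : Mflat n R) :
    ev n R ![1, 0] (flatRep n R transT P) = ev n R ![1, 0] P := by
  rw [ev_flatRep]
  congr 1
  congr 1
  funext i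
  fin_cases i <;> simp [adj, transT, ofSL, ModularGroup.T, Matrix.adjugate_fin_two, Matrix.mulVec,
    dotProduct, Fin.sum_univ_two]

/-- Up to a nonzero multiple, the kernel of the coefficient at `X₁^n` is the image of `T - 1`. -/
theorem exists_smul_eq_transT_sub {P : Mflat n R} (hP : ev n R ![1, 0] P = 0) :
    ∃ m : ℕ, m ≠ 0 ∧ ∃ Q : Mflat n R, m • P = flatRep n R transT Q - Q := by
  -- Induction on the number `k` of admissible coefficients, those with index at least `n + 1 - k`;
  -- each step removes the lowest one.
  have key : ∀ k, k ≤ n → ∀ a : Fin (n + 1) → R, (∀ μ : Fin (n + 1), (μ : ℕ) < n + 1 - k → a μ = 0) →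
      ∃ m : ℕ, m ≠ 0 ∧ ∃ Q : Mflat n R,
        m • (∑ μ, a μ • flatVec n R μ) = flatRep n R transT Q - Q := by
    intro k
    induction k with
    | zero =>
      intro _ a ha
      refine ⟨1, one_ne_zero, 0, ?_⟩
      have h1 : ∀ μ, a μ = 0 := fun μ => ha μ (by have := μ.2; omega)
      simp [h1]
    | succ k ih =>
      intro hk a ha
      let j : ℕ := n - k
      have hj : 1 ≤ j := by omega
      let jF : Fin (n + 1) := ⟨j, by omega⟩
      let iF : Fin (n + 1) := ⟨j - 1, by omega⟩
      -- Since `(T - 1)` applied to the vector of index `j - 1` is `-j` times that of index `j` plus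
      -- higher terms, adding `a_j` times it to `j` times the given vector cancels index `j`. The
      -- factor `j` is the source of torsion. The truncated exponent is harmless, as the binomial
      -- coefficient vanishes for `μ < j - 1`.
      let a' : Fin (n + 1) → R := fun μ => j * a μ + a jF *
        ((((-1) ^ ((μ : ℕ) - (j - 1)) * ((μ : ℕ).choose (j - 1) : ℤ) : ℤ) : R) -
          if μ = iF then 1 else 0)
      obtain ⟨m, hm, Q, hQ⟩ := ih (by omega) a' (by
        intro μ hμ
        have hμ' : (μ : ℕ) ≤ j := by omega
        rcases lt_trichotomy (μ : ℕ) (j - 1) with h1 | h1 | h1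
        · have h2 : μ ≠ iF := fun h => by
            rw [h] at h1
            exact lt_irrefl _ h1
          simp only [a']
          rw [ha μ (by omega), if_neg h2, Nat.choose_eq_zero_of_lt h1]
          simp
        · have h2 : μ = iF := Fin.ext h1
          simp only [a']
          rw [ha μ (by omega), if_pos h2, h1]
          simp
        · have h3 : μ = jF := Fin.ext (by change (μ : ℕ) = j; omega)
          have h2 : μ ≠ iF := fun h => by
            rw [h] at h1
            exact lt_irrefl _ h1
          simp only [a']
          rw [if_neg h2, h3]
          have h4 : j.choose (j - 1) = j := by
            obtain ⟨i, hi⟩ := Nat.exists_eq_add_of_le' hj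
            rw [hi, Nat.add_sub_cancel, Nat.choose_succ_self_right]
          change (j : R) * a jF + a jF * ((((-1) ^ (j - (j - 1)) * (j.choose (j - 1) : ℤ) : ℤ) : R) - 0) = 0
          rw [h4, show j - (j - 1) = 1 by omega]
          push_cast
          ring)
      refine ⟨m * j, mul_ne_zero hm (by omega), Q - (m * a jF : R) • flatVec n R iF, ?_⟩
      have h5 : ∑ μ, a' μ • flatVec n R μ = (j : R) • (∑ μ, a μ • flatVec n R μ) +
          a jF • (flatRep n R transT (flatVec n R iF) - flatVec n R iF) := by
        rw [flatRep_flatVec]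
        simp only [actPoly_transT_coeff]
        have h6 : flatVec n R iF = ∑ μ, (if μ = iF then (1 : R) else 0) • flatVec n R μ := by
          simp
        conv_rhs => rw [h6]
        simp only [a', add_smul, mul_smul, sub_smul, Finset.sum_add_distrib, Finset.smul_sum,
          Finset.sum_sub_distrib, smul_sub]
        rfl
      rw [h5, smul_add] at hQ
      rw [map_sub, map_smul, sub_sub_sub_comm, ← hQ]
      simp only [← Nat.cast_smul_eq_nsmul R, Nat.cast_mul]
      module
  obtain ⟨a, rfl⟩ := exists_eq_sum_flatVec P
  -- For `k = n` the only requirement is that the coefficient of index `0` vanish, which is the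
  -- hypothesis on the value at `(1, 0)`.
  refine key n le_rfl a fun μ hμ => ?_
  have h0 : μ = 0 := Fin.ext (by change (μ : ℕ) = 0; omega)
  rw [map_sum, Finset.sum_eq_single 0] at hP
  · rw [map_smul, ev_flatVec] at hP
    rw [h0]
    simpa using hP
  · intro ν _ hν
    have h3 : (ν : ℕ) ≠ 0 := fun h => hν (Fin.ext h)
    rw [map_smul, ev_flatVec]
    simp [h3]
  · simp

theorem exists_smul_mem_range_flatMap (P : Mflat n ℚ) :
    ∃ N : ℕ, N ≠ 0 ∧ ∃ Q : Mflat n ℤ, N • P = flatMap n (Int.castRingHom ℚ) Q := by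
  obtain ⟨a, rfl⟩ := exists_eq_sum_flatVec P
  obtain ⟨N, hN⟩ := IsLocalization.exist_integer_multiples (nonZeroDivisors ℤ) Finset.univ a
  refine ⟨N.1.natAbs, Int.natAbs_ne_zero.2 (nonZeroDivisors.coe_ne_zero N), ?_⟩
  have h1 : ∀ ν, ∃ k : ℤ, (N.1.natAbs : ℚ) * a ν = k := fun ν => by
    obtain ⟨k, hk⟩ := hN ν (Finset.mem_univ ν)
    rcases Int.natAbs_eq N.1 with h | h
    · refine ⟨k, ?_⟩
      rw [zsmul_eq_mul, h] at hk
      simpa using hk.symm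
    · refine ⟨-k, ?_⟩
      rw [zsmul_eq_mul, h] at hk
      push_cast
      rw [← neg_eq_iff_eq_neg]
      simpa using hk.symm
  choose k hk using h1
  refine ⟨∑ ν, k ν • flatVec n ℤ ν, ?_⟩
  rw [map_sum, Finset.smul_sum]
  refine Finset.sum_congr rfl fun ν _ => ?_
  rw [map_smulₛₗ, flatMap_flatVec, ← Nat.cast_smul_eq_nsmul ℚ, smul_smul, hk]
  rfl

/-- The map `M_n^♭ ⊗ ℂ → M_n^♭ ⊗ ℚ` induced by an additive map `ℂ → ℚ`. -/
def flatProj (n : ℕ) (l : ℂ →+ ℚ) : Mflat n ℂ →+ Mflat n ℚ where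
  toFun P := ∑ ν, l ((flatBasis n ℂ).repr P ν) • flatVec n ℚ ν
  map_zero' := by simp
  map_add' P Q := by simp [add_smul, Finset.sum_add_distrib]

theorem flatProj_smul_flatVec (l : ℂ →+ ℚ) (z : ℂ) (ν : Fin (n + 1)) :
    flatProj n l (z • flatVec n ℂ ν) = l z • flatVec n ℚ ν := by
  change ∑ μ, l ((flatBasis n ℂ).repr (z • flatVec n ℂ ν) μ) • flatVec n ℚ μ = _
  rw [← flatBasis_apply, map_smul, Module.Basis.repr_self, Finset.sum_eq_single ν]
  · simp
  · intro μ _ hμ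
    simp [Ne.symm hμ]
  · simp

/-- The matrices of the action in the basis `flatVec` have integral entries, and an additive map
commutes with integer multiples. Hence a retraction `ℂ → ℚ` preserves both the cocycle relation and
the Hecke operators. -/
theorem flatProj_flatRep (l : ℂ →+ ℚ) (γ : M2pos) (P : Mflat n ℂ) :
    flatProj n l (flatRep n ℂ γ P) = flatRep n ℚ γ (flatProj n l P) := by
  obtain ⟨a, rfl⟩ := exists_eq_sum_flatVec P
  simp only [map_sum, map_smul, flatRep_flatVec, flatProj_smul_flatVec, Finset.smul_sum, smul_smul]
  refine Finset.sum_congr rfl fun ν _ => Finset.sum_congr rfl fun μ _ => ?_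
  rw [mul_comm (a ν), ← zsmul_eq_mul, map_zsmul, zsmul_eq_mul,
    mul_comm (l (a ν))]

theorem flatProj_flatMap (l : ℂ →+ ℚ) (hl : ∀ q : ℚ, l q = q) (P : Mflat n ℚ) :
    flatProj n l (flatMap n (Rat.castHom ℂ) P) = P := by
  obtain ⟨a, rfl⟩ := exists_eq_sum_flatVec P
  simp only [map_sum, map_smulₛₗ, flatMap_flatVec, flatProj_smul_flatVec]
  exact Finset.sum_congr rfl fun ν _ => by rw [Rat.coe_castHom, hl]

theorem ev_flatProj (l : ℂ →+ ℚ) (w : Fin 2 → ℤ) (P : Mflat n ℂ) :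
    ev n ℚ w (flatProj n l P) = l (ev n ℂ w P) := by
  obtain ⟨a, rfl⟩ := exists_eq_sum_flatVec P
  simp only [map_sum, map_smul, flatProj_smul_flatVec, ev_flatVec]
  refine Finset.sum_congr rfl fun ν _ => ?_
  have h1 : ∀ (k : ℤ) (z : ℂ), l (z * k) = l z * k := fun k z => by
    rw [mul_comm, ← zsmul_eq_mul, map_zsmul, zsmul_eq_mul, mul_comm]
  have h2 := h1 (n.choose ν * (w 0) ^ (n - ν) * (w 1) ^ (ν : ℕ)) (a ν)
  push_cast at h2
  simp only [smul_eq_mul]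
  exact h2.symm

theorem exists_retraction : ∃ l : ℂ →+ ℚ, ∀ q : ℚ, l q = q := by
  obtain ⟨l, hl⟩ := (Algebra.linearMap ℚ ℂ).exists_leftInverse_of_injective
    (LinearMap.ker_eq_bot.2 (algebraMap ℚ ℂ).injective)
  exact ⟨l.toAddMonoidHom, fun q => congrArg (fun f => f q) hl⟩

end CoefficientModules

/-! ### The cohomology of the boundary -/

section BoundaryCohomology

theorem transT_smul_bdInfty (x : ℝ) : transT • bdInfty x = bdInfty (x + 1) := by
  rw [smul_bdInfty (by simp [transT, ofSL, ModularGroup.T])]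
  simp [transT, ofSL, ModularGroup.T]

theorem boundaryPath_zero (x : ℝ) : boundaryPath x (stdSimplex.vertex 0) = bdInfty x := by
  change bdInfty (x + (stdSimplex.vertex (S := ℝ) (0 : Fin 2)) 1) = _
  simp

theorem boundaryPath_one (x : ℝ) : boundaryPath x (stdSimplex.vertex 1) = bdInfty (x + 1) := by
  change bdInfty (x + (stdSimplex.vertex (S := ℝ) (1 : Fin 2)) 1) = _
  simp

theorem dPrim_boundaryPath {V : Type} [AddCommGroup V] (ψ : BSBoundary → V) (x : ℝ) :
    dPrim ψ (boundaryPath x) = ψ (bdInfty (x + 1)) - ψ (bdInfty x) := by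
  rw [dPrim, boundaryPath_zero, boundaryPath_one]

theorem exists_eq_zpow_T {δ : SL(2, ℤ)} (h : δ.1 1 0 = 0) :
    ∃ k : ℤ, δ = ModularGroup.T ^ k ∨ δ = -1 * ModularGroup.T ^ k := by
  have hdet := δ.2
  rw [Matrix.det_fin_two, h, mul_zero, sub_zero] at hdet
  rcases Int.eq_one_or_neg_one_of_mul_eq_one' hdet with ⟨h0, h1⟩ | ⟨h0, h1⟩
  · refine ⟨δ.1 0 1, Or.inl ?_⟩
    apply Subtype.ext
    rw [ModularGroup.coe_T_zpow]
    ext i j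
    fin_cases i <;> fin_cases j <;> simp [h, h0, h1]
  · refine ⟨-δ.1 0 1, Or.inr ?_⟩
    apply Subtype.ext
    rw [Matrix.SpecialLinearGroup.coe_mul, ModularGroup.coe_T_zpow]
    ext i j
    fin_cases i <;> fin_cases j <;> simp [h, h0, h1]

theorem smul_zpow_T (k : ℤ) (x : ℝ) : ofSL (ModularGroup.T ^ k) • bdInfty x = bdInfty (x + k) := by
  have h : (ofSL (ModularGroup.T ^ k)).1 = !![1, k; 0, 1] := ModularGroup.coe_T_zpow k
  rw [smul_bdInfty (by rw [h]; rfl), h]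
  simp

theorem smul_neg_one_bdInfty (x : ℝ) : ofSL (-1) • bdInfty x = bdInfty x := by
  rw [smul_bdInfty (by simp [ofSL])]
  simp [ofSL]

/-! ### Functions on the boundary induced from the component of `∞` -/

section Induced

variable {R : Type} [CommRing R] {V : Type} [AddCommGroup V] [Module R V]
variable (ρ : Representation R M2pos V)

/-- The function on the boundary induced from a function on the component of `∞`. -/
def bdInduced (f : ℝ → V) (b : BSBoundary) : V := ρ (ofSL (cuspRep b.cusp)) (f (bdCoord b))

variable {ρ}

/-- Two elements that send `∞` to the same cusp differ by some `±T^k`, which shifts the coordinate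
by `k`. -/
theorem exists_cuspRep_smul_bdInfty (g : SL(2, ℤ)) :
    ∃ k : ℤ, (g = cuspRep (ofSL g • bdInfty 0).cusp * ModularGroup.T ^ k ∨
      g = cuspRep (ofSL g • bdInfty 0).cusp * (-1 * ModularGroup.T ^ k)) ∧
      ∀ x, ofSL g • bdInfty x = ofSL (cuspRep (ofSL g • bdInfty 0).cusp) • bdInfty (x + k) := by
  set h := cuspRep (ofSL g • bdInfty 0).cusp with hh
  have h1 : (ofSL (h⁻¹ * g) • bdInfty 0).cusp = OnePoint.infty := by
    have h2 := bdCoord_spec (ofSL g • bdInfty 0)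
    rw [← hh] at h2
    rw [map_mul, mul_smul, ← h2, ofSL_inv_smul_smul]
    rfl
  rw [cusp_smul_bdInfty_eq_infty_iff] at h1
  obtain ⟨k, hk⟩ := exists_eq_zpow_T (δ := h⁻¹ * g) h1
  have hx : ∀ x, ofSL (h⁻¹ * g) • bdInfty x = bdInfty (x + k) := fun x => by
    rcases hk with hk | hk
    · rw [hk, smul_zpow_T]
    · rw [hk, map_mul, mul_smul, smul_zpow_T, smul_neg_one_bdInfty]
  refine ⟨k, ?_, fun x => ?_⟩
  · rcases hk with hk | hk
    · exact Or.inl (by rw [← hk]; group)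
    · exact Or.inr (by rw [← hk]; group)
  · rw [← hx, ← mul_smul, ← map_mul, mul_inv_cancel_left]

theorem ofSL_zpow_T_apply_add (ρ : Representation R M2pos V) (k : ℤ) (v : V) :
    ρ (ofSL (ModularGroup.T ^ (k + 1))) v = ρ transT (ρ (ofSL (ModularGroup.T ^ k)) v) := by
  rw [add_comm, zpow_one_add, map_mul, map_mul]
  rfl

theorem ofSL_inv_apply_apply (ρ : Representation R M2pos V) (g : SL(2, ℤ)) (v : V) :
    ρ (ofSL g⁻¹) (ρ (ofSL g) v) = v := by
  rw [← Module.End.mul_apply, ← map_mul, ← map_mul, inv_mul_cancel, map_one, map_one]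
  rfl

theorem sub_of_add_one {f : ℝ → V} {c : V} (hf : ∀ x, f (x + 1) = ρ transT (f x) + c) (k : ℤ)
    (x y : ℝ) : f (x + k) - f (y + k) = ρ (ofSL (ModularGroup.T ^ k)) (f x - f y) := by
  induction k using Int.induction_on with
  | zero => simp
  | succ k ih =>
    rw [ofSL_zpow_T_apply_add, ← ih]
    push_cast
    rw [← add_assoc, ← add_assoc, hf, hf, map_sub]
    abel
  | pred k ih =>
    have h1 := ofSL_zpow_T_apply_add ρ (-k - 1) (f x - f y)
    rw [sub_add_cancel, ← ih] at h1
    have h2 : f (x + ((-k : ℤ) : ℝ)) - f (y + ((-k : ℤ) : ℝ)) =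
        ρ transT (f (x + ((-k - 1 : ℤ) : ℝ)) - f (y + ((-k - 1 : ℤ) : ℝ))) := by
      have e : ∀ t : ℝ, t + ((-k : ℤ) : ℝ) = t + ((-k - 1 : ℤ) : ℝ) + 1 := fun t => by
        push_cast
        ring
      rw [e, e, hf, hf, map_sub]
      abel
    rw [h2] at h1
    have h3 := congrArg (ρ (ofSL ModularGroup.T⁻¹)) h1
    rwa [ofSL_inv_apply_apply, ofSL_inv_apply_apply] at h3

theorem apply_add_of_add_one {f : ℝ → V} (hf : ∀ x, f (x + 1) = ρ transT (f x)) (k : ℤ)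
    (x : ℝ) : f (x + k) = ρ (ofSL (ModularGroup.T ^ k)) (f x) := by
  induction k using Int.induction_on with
  | zero => simp
  | succ k ih =>
    rw [ofSL_zpow_T_apply_add, ← ih]
    push_cast
    rw [← add_assoc, hf]
  | pred k ih =>
    have h1 := ofSL_zpow_T_apply_add ρ (-k - 1) (f x)
    rw [sub_add_cancel, ← ih] at h1
    have e : x + ((-k : ℤ) : ℝ) = x + ((-k - 1 : ℤ) : ℝ) + 1 := by
      push_cast
      ring
    rw [e, hf] at h1
    have h3 := congrArg (ρ (ofSL ModularGroup.T⁻¹)) h1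
    rwa [ofSL_inv_apply_apply, ofSL_inv_apply_apply] at h3

/-- The induced function depends on the chosen `cuspRep`, but its differences within a component do
not: another choice changes `g` by `±T^k`, under which differences of `f` are equivariant. -/
theorem bdInduced_sub (hneg : ∀ v, ρ (ofSL (-1)) v = v) {f : ℝ → V} {c : V}
    (hf : ∀ x, f (x + 1) = ρ transT (f x) + c) (g : SL(2, ℤ)) (x y : ℝ) :
    bdInduced ρ f (ofSL g • bdInfty x) - bdInduced ρ f (ofSL g • bdInfty y) =
      ρ (ofSL g) (f x - f y) := by
  obtain ⟨k, hk, hx⟩ := exists_cuspRep_smul_bdInfty g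
  set h := cuspRep (ofSL g • bdInfty 0).cusp
  have h1 : ∀ t, bdInduced ρ f (ofSL g • bdInfty t) = ρ (ofSL h) (f (t + k)) := fun t => by
    rw [hx, bdInduced, bdCoord_smul, cusp_cuspRep_smul]
  rw [h1, h1, ← map_sub, sub_of_add_one hf, ← Module.End.mul_apply, ← map_mul, ← map_mul]
  rcases hk with hk | hk
  · rw [← hk]
  · rw [hk]
    simp only [map_mul, Module.End.mul_apply, hneg]

/-- When `f` is exactly `T`-equivariant the values, and not only the differences, are independent of
the choice. Such an `f` therefore yields an equivariant primitive, that is a coboundary. -/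
theorem bdInduced_apply (hneg : ∀ v, ρ (ofSL (-1)) v = v) {f : ℝ → V}
    (hf : ∀ x, f (x + 1) = ρ transT (f x)) (g : SL(2, ℤ)) (x : ℝ) :
    bdInduced ρ f (ofSL g • bdInfty x) = ρ (ofSL g) (f x) := by
  obtain ⟨k, hk, hx⟩ := exists_cuspRep_smul_bdInfty g
  set h := cuspRep (ofSL g • bdInfty 0).cusp
  have h1 : ∀ t, bdInduced ρ f (ofSL g • bdInfty t) = ρ (ofSL h) (f (t + k)) := fun t => by
    rw [hx, bdInduced, bdCoord_smul, cusp_cuspRep_smul]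
  rw [h1, apply_add_of_add_one hf, ← Module.End.mul_apply, ← map_mul, ← map_mul]
  rcases hk with hk | hk
  · rw [← hk]
  · rw [hk]
    simp only [map_mul, Module.End.mul_apply, hneg]

theorem exists_lift_simplex (σ : Simplex 1 BSBoundary) :
    ∃ (g : SL(2, ℤ)) (τ : Simplex 1 ℝ), ∀ t, σ t = ofSL g • bdInfty (τ t) := by
  obtain ⟨τ, hτ⟩ := exists_lift_bdChart σ (fun t => cusp_eq_of_simplex σ t (stdSimplex.vertex 0))
  exact ⟨_, τ, fun t => congrArg (fun σ : Simplex 1 BSBoundary => σ t) hτ⟩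

theorem bdInduced_mem (hneg : ∀ v, ρ (ofSL (-1)) v = v) {f : ℝ → V} {c : V}
    (hf : ∀ x, f (x + 1) = ρ transT (f x) + c) : dPrim (bdInduced ρ f) ∈ Z1 BSBoundary ρ := by
  refine ⟨fun γ σ => ?_, coboundary_dPrim _⟩
  obtain ⟨g, τ, hτ⟩ := exists_lift_simplex σ
  change bdInduced ρ f (ofSL γ • σ _) - bdInduced ρ f (ofSL γ • σ _) =
    ρ (ofSL γ) (bdInduced ρ f (σ _) - bdInduced ρ f (σ _))
  rw [hτ, hτ, bdInduced_sub hneg hf, ← mul_smul, ← mul_smul, ← map_mul, bdInduced_sub hneg hf,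
    map_mul, map_mul, Module.End.mul_apply]

theorem exists_cls_boundary (u : H1 BSBoundary ρ) :
    ∃ (ψ : BSBoundary → V) (h : dPrim ψ ∈ Z1 BSBoundary ρ), u = cls ρ ψ h := by
  obtain ⟨φ, rfl⟩ := mk_surjective u
  obtain ⟨ψ, hψ⟩ := exists_dPrim_boundary φ.2.2
  exact ⟨ψ, hψ ▸ φ.2, congrArg (H1.mk ρ) (Subtype.ext hψ)⟩

theorem sub_smul_of_mem {ψ : BSBoundary → V} (h : dPrim ψ ∈ Z1 BSBoundary ρ) (γ : SL(2, ℤ))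
    (x y : ℝ) : ψ (ofSL γ • bdInfty y) - ψ (ofSL γ • bdInfty x) =
      ρ (ofSL γ) (ψ (bdInfty y) - ψ (bdInfty x)) := by
  have h1 := h.1 γ ((bdChart 1).comp (affineSimplex (ContinuousMap.id ℝ) ![x, y]))
  have h2 : ∀ i : Fin 2, (bdChart 1).comp (affineSimplex (ContinuousMap.id ℝ) ![x, y])
      (stdSimplex.vertex i) = bdInfty ((![x, y] : Fin 2 → ℝ) i) := fun i => by
    rw [ContinuousMap.comp_apply, bdChart_apply, one_smul, affineSimplex_vertex]
    rfl
  change ψ (ofSL γ • _) - ψ (ofSL γ • _) = ρ (ofSL γ) (ψ _ - ψ _) at h1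
  rwa [h2, h2] at h1

/-- A linear map on cocycles that vanishes on coboundaries induces a map on `H¹`. -/
def H1.lift {X : Type} [TopologicalSpace X] [MulAction M2pos X] [ContinuousConstSMul M2pos X]
    {W : Type} [AddCommGroup W] [Module R W] (ρ : Representation R M2pos V)
    (f : Z1 X ρ →ₗ[R] W) (h : ∀ φ, φ.1 ∈ B1 X ρ → f φ = 0) : H1 X ρ →ₗ[R] W :=
  Submodule.liftQ _ f fun φ hφ => LinearMap.mem_ker.2 (h φ hφ)

theorem H1.lift_mk {X : Type} [TopologicalSpace X] [MulAction M2pos X]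
    [ContinuousConstSMul M2pos X] {W : Type} [AddCommGroup W] [Module R W]
    (f : Z1 X ρ →ₗ[R] W) (h : ∀ φ, φ.1 ∈ B1 X ρ → f φ = 0) (φ : Z1 X ρ) :
    H1.lift ρ f h (H1.mk ρ φ) = f φ := rfl

end Induced

/-! ### The pairing on the cohomology of the boundary -/

variable {n : ℕ} {R : Type} [CommRing R]

variable (n R) in
/-- The coefficient at `e_0^♭` of the value of a cocycle on the path from `0` to `1` in the boundary
component of `∞`. -/
def bdEval : Z1 BSBoundary (flatRep n R) →ₗ[R] R where
  toFun φ := ev n R ![1, 0] (φ.1 (boundaryPath 0))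
  map_add' _ _ := map_add (ev n R ![1, 0]) _ _
  map_smul' a _ := map_smul (ev n R ![1, 0]) a _

theorem bdEval_eq_zero {φ : Z1 BSBoundary (flatRep n R)} (h : φ.1 ∈ B1 BSBoundary (flatRep n R)) :
    bdEval n R φ = 0 := by
  obtain ⟨ψ, hψ, e⟩ := (mem_B1_iff _).1 h
  change ev n R ![1, 0] (φ.1 (boundaryPath 0)) = 0
  rw [e, dPrim_boundaryPath, ← transT_smul_bdInfty, hψ, map_sub, ev_transT, sub_self]

variable (n R) in
/-- The map induced by `bdEval` on cohomology. -/
def bdPairing : H1 BSBoundary (flatRep n R) →ₗ[R] R :=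
  H1.lift (flatRep n R) (bdEval n R) fun _ hφ => bdEval_eq_zero hφ

/-- Moving the base point from `0` to `x` adds the variation of `ψ` over the translated segment and
subtracts that over the original one; these have equal value at `(1, 0)` by `ev_transT`. -/
theorem bdPairing_mk (φ : Z1 BSBoundary (flatRep n R)) (x : ℝ) :
    bdPairing n R (H1.mk _ φ) = ev n R ![1, 0] (φ.1 (boundaryPath x)) := by
  rw [bdPairing, H1.lift_mk]
  change ev n R ![1, 0] (φ.1 (boundaryPath 0)) = _
  obtain ⟨ψ, hψ⟩ := exists_dPrim_boundary φ.2.2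
  have h1 : dPrim ψ ∈ Z1 BSBoundary (flatRep n R) := hψ ▸ φ.2
  have h2 := congrArg (ev n R ![1, 0]) (sub_smul_of_mem h1 ModularGroup.T 0 x)
  rw [ev_transT, transT_smul_bdInfty, transT_smul_bdInfty, map_sub, map_sub] at h2
  rw [hψ, dPrim_boundaryPath, dPrim_boundaryPath, map_sub, map_sub]
  linear_combination -h2

theorem bdPairing_cls {ψ : BSBoundary → Mflat n R} (h : dPrim ψ ∈ Z1 BSBoundary (flatRep n R)) :
    bdPairing n R (cls _ ψ h) = ev n R ![1, 0] (ψ (bdInfty 1) - ψ (bdInfty 0)) := by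
  rw [cls, bdPairing_mk _ 0]
  change ev n R ![1, 0] (dPrim ψ (boundaryPath 0)) = _
  rw [dPrim_boundaryPath, zero_add]

/-- On the component of `∞` one has `ψ(x + 1) = Tψ(x) + c` with a constant `c`, and vanishing of the
pairing says that `c` has value `0` at `(1, 0)`. Then `m c = TQ - Q`, so `mψ + Q` is `T`-equivariant
and induces an equivariant primitive of `m u`. -/
theorem exists_smul_eq_zero (hn : Even n) {u : H1 BSBoundary (flatRep n R)}
    (hu : bdPairing n R u = 0) : ∃ m : ℕ, m ≠ 0 ∧ m • u = 0 := by
  obtain ⟨ψ, hψ, rfl⟩ := exists_cls_boundary u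
  rw [bdPairing_cls] at hu
  set c := ψ (bdInfty 1) - flatRep n R transT (ψ (bdInfty 0))
  have hc : ∀ x, ψ (bdInfty (x + 1)) = flatRep n R transT (ψ (bdInfty x)) + c := fun x => by
    have h1 := sub_smul_of_mem hψ ModularGroup.T 0 x
    rw [transT_smul_bdInfty, transT_smul_bdInfty, map_sub, zero_add] at h1
    simp only [c]
    rw [sub_eq_iff_eq_add] at h1
    rw [h1]
    abel
  have hev : ev n R ![1, 0] c = 0 := by
    simp only [c]
    rw [map_sub, ev_transT, ← map_sub, hu]
  obtain ⟨m, hm, Q, hQ⟩ := exists_smul_eq_transT_sub hev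
  refine ⟨m, hm, ?_⟩
  have hf : ∀ x, m • ψ (bdInfty (x + 1)) + Q =
      flatRep n R transT (m • ψ (bdInfty x) + Q) := fun x => by
    rw [hc, smul_add, hQ, map_add, map_nsmul]
    abel
  have h2 := bdInduced_apply (ρ := flatRep n R) (flatRep_neg_one hn)
    (f := fun x => m • ψ (bdInfty x) + Q) hf
  rw [cls, ← map_nsmul, mk_eq_zero_iff, mem_B1_iff]
  refine ⟨bdInduced (flatRep n R) fun x => m • ψ (bdInfty x) + Q, fun γ b => ?_, ?_⟩
  · obtain ⟨x, hx⟩ := exists_cuspRep_smul b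
    rw [hx, ← mul_smul, ← map_mul, h2, h2, map_mul, map_mul, Module.End.mul_apply]
  · funext σ
    obtain ⟨g, τ, hτ⟩ := exists_lift_simplex σ
    change m • (ψ (σ _) - ψ (σ _)) = bdInduced _ _ (σ _) - bdInduced _ _ (σ _)
    rw [hτ, hτ, h2, h2, sub_smul_of_mem hψ, ← map_sub, ← map_nsmul]
    congr 1
    rw [smul_sub]
    abel

theorem bdPairing_injective {K : Type} [Field K] [CharZero K] (hn : Even n) :
    Function.Injective (bdPairing n K) := by
  rw [injective_iff_map_eq_zero]
  intro u hu
  obtain ⟨m, hm, h⟩ := exists_smul_eq_zero hn hu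
  rw [← Nat.cast_smul_eq_nsmul K] at h
  exact (smul_eq_zero.1 h).resolve_left (Nat.cast_ne_zero.2 hm)

/-- A class is given by any function with `f(x + 1) = Tf(x) + v`, continuous or not, and its pairing
is the value of `v` at `(1, 0)`. The choice `v = X₁^n` has value `1`. -/
theorem exists_bdPairing_eq_one (hn : Even n) :
    ∃ ω : H1 BSBoundary (flatRep n R), bdPairing n R ω = 1 := by
  set v : Mflat n R := flatVec n R 0
  let S : Equiv.Perm (Mflat n R) :=
    { toFun := fun w => flatRep n R transT w + v
      invFun := fun w => flatRep n R (ofSL ModularGroup.T⁻¹) (w - v)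
      left_inv := fun w => by
        simp only [add_sub_cancel_right]
        exact ofSL_inv_apply_apply _ _ _
      right_inv := fun w => by
        have h := ofSL_inv_apply_apply (flatRep n R) ModularGroup.T⁻¹ (w - v)
        rw [inv_inv] at h
        simp only [h, sub_add_cancel] }
  -- The recursion is solved by a step function: iterates of the affine bijection `w ↦ Tw + v`,
  -- indexed by the integral part.
  let f : ℝ → Mflat n R := fun x => (S ^ ⌊x⌋) 0
  have hf : ∀ x, f (x + 1) = flatRep n R transT (f x) + v := fun x => by
    simp only [f]
    rw [Int.floor_add_one, add_comm, zpow_one_add]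
    rfl
  refine ⟨cls _ _ (bdInduced_mem (flatRep_neg_one hn) hf), ?_⟩
  have h1 := bdInduced_sub (flatRep_neg_one hn) hf 1 1 0
  rw [map_one, one_smul, one_smul, map_one, Module.End.one_apply] at h1
  rw [bdPairing_cls, h1]
  have h2 := hf 0
  rw [zero_add] at h2
  rw [h2, map_sub, map_add, ev_transT, add_sub_cancel_left, ev_flatVec]
  simp

theorem bdPairing_baseChange {S : Type} [CommRing S] (f : R →+* S)
    (u : H1 BSBoundary (flatRep n R)) :
    bdPairing n S (baseChange BSBoundary n f u) = f (bdPairing n R u) := by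
  obtain ⟨φ, rfl⟩ := mk_surjective u
  exact ev_flatMap f _ _

/-- The pairing takes values in `ℤ` and its kernel is torsion, so a class of pairing `1` generates
modulo torsion. -/
theorem isBoundaryGenerator_iff (hn : Even n) (ω : H1 BSBoundary (flatRep n ℤ)) :
    IsBoundaryGenerator n ω ↔ bdPairing n ℤ ω = 1 := by
  constructor
  · rintro ⟨-, h⟩
    obtain ⟨φ, rfl⟩ := mk_surjective ω
    rw [bdPairing_mk φ 0, ← pairE0_eq_ev hn, h φ rfl]
  · intro h
    refine ⟨fun c => ?_, fun φ hφ x => ?_⟩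
    · obtain ⟨m, hm, h1⟩ := exists_smul_eq_zero hn (u := c - bdPairing n ℤ c • ω) (by
        rw [map_sub, map_smul, h]
        simp)
      exact ⟨bdPairing n ℤ c, m, Nat.cast_ne_zero.2 hm, by rwa [natCast_zsmul]⟩
    · rw [pairE0_eq_ev hn, ← bdPairing_mk, hφ, h]

/-- Along the path the variation is `(T - 1)ψ + c(T)`, and the first part has value `0` at `(1, 0)`.
-/
theorem bdPairing_resBoundary {ψ : HBS → Mflat n R} {c : SL(2, ℤ) → Mflat n R}
    (h : HasCocycle (flatRep n R) ψ c) :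
    bdPairing n R (resBoundary n R (cls _ ψ h.dPrim_mem)) =
      ev n R ![1, 0] (c ModularGroup.T) := by
  change ev n R ![1, 0] (dPrim ψ (inclBoundary.comp (boundaryPath 0))) = _
  have h1 := h ModularGroup.T (HBS.bd (bdInfty 0))
  rw [smul_bd, transT_smul_bdInfty] at h1
  rw [dPrim, ContinuousMap.comp_apply, ContinuousMap.comp_apply, boundaryPath_zero, boundaryPath_one]
  change ev n R ![1, 0] (ψ (HBS.bd _) - ψ (HBS.bd _)) = _
  rw [h1, map_sub, map_add, ev_transT]
  ring

end BoundaryCohomology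

/-! ### Restriction maps and base change -/

section Restriction

theorem HasCocycle.inner {R V : Type} [CommRing R] [AddCommGroup V] [Module R V]
    {ρ : Representation R M2pos V} {ψ : HBS → V} {c : SL(2, ℤ) → V} (h : HasCocycle ρ ψ c) :
    HasCocycle ρ (fun z => ψ (HBS.inner z)) c :=
  fun γ z => h γ (HBS.inner z)

variable {n : ℕ} {R : Type} [CommRing R]

theorem resInner_cls {ψ : HBS → Mflat n R} {c : SL(2, ℤ) → Mflat n R}
    (h : HasCocycle (flatRep n R) ψ c) :
    resInner n R (cls _ ψ h.dPrim_mem) =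
      cls _ (fun z => ψ (HBS.inner z)) h.inner.dPrim_mem := rfl

/-- Restriction does not change the group cocycle, and on both spaces a class is zero exactly when
that cocycle is a coboundary. -/
theorem resInner_injective : Function.Injective (resInner n R) := by
  rw [injective_iff_map_eq_zero]
  intro u hu
  obtain ⟨ψ, c, h, rfl⟩ := exists_cls_HBS u
  rw [resInner_cls h, cls_eq_zero_iff h.inner] at hu
  exact (cls_eq_zero_iff h).2 hu

theorem resInner_hecke (p : Nat.Primes) (u : H1 HBS (flatRep n R)) :
    resInner n R (hecke _ p u) = hecke _ p (resInner n R u) :=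
  pullback_hecke _ _ p u

theorem resBoundary_hecke (p : Nat.Primes) (u : H1 HBS (flatRep n R)) :
    resBoundary n R (hecke _ p u) = hecke _ p (resBoundary n R u) :=
  pullback_hecke _ _ p u

section BaseChange

variable {S : Type} [CommRing S] (f : R →+* S)
variable {X : Type} [TopologicalSpace X] [MulAction M2pos X] [ContinuousConstSMul M2pos X]

theorem baseChange_hecke (p : Nat.Primes) (u : H1 X (flatRep n R)) :
    baseChange X n f (hecke _ p u) = hecke _ p (baseChange X n f u) :=
  coeffMap_hecke _ _ _ p u

omit [TopologicalSpace X] [ContinuousConstSMul M2pos X] in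
theorem HasCocycle.baseChange {ψ : X → Mflat n R} {c : SL(2, ℤ) → Mflat n R}
    (h : HasCocycle (flatRep n R) ψ c) :
    HasCocycle (flatRep n S) (fun x => flatMap n f (ψ x)) (fun γ => flatMap n f (c γ)) :=
  fun γ x => by
    beta_reduce
    rw [h, map_add, flatMap_flatRep]

theorem baseChange_cls {ψ : X → Mflat n R} {c : SL(2, ℤ) → Mflat n R}
    (h : HasCocycle (flatRep n R) ψ c) :
    EisensteinClass.baseChange X n f (cls _ ψ h.dPrim_mem) =
      cls _ _ (h.baseChange f).dPrim_mem := by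
  refine congrArg (H1.mk _) (Subtype.ext ?_)
  funext σ
  exact map_sub (flatMap n f) _ _

theorem baseChange_resBoundary (u : H1 HBS (flatRep n R)) :
    EisensteinClass.baseChange BSBoundary n f (resBoundary n R u) =
      resBoundary n S (EisensteinClass.baseChange HBS n f u) := by
  obtain ⟨φ, rfl⟩ := mk_surjective u
  rfl

end BaseChange

/-- If a rational cocycle is the coboundary of a complex vector, it is also the coboundary of the
projection of that vector by a retraction `ℂ → ℚ`. -/
theorem baseChange_rat_injective :
    Function.Injective (baseChange HBS n (Rat.castHom ℂ)) := by
  rw [injective_iff_map_eq_zero]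
  intro u hu
  obtain ⟨ψ, c, h, rfl⟩ := exists_cls_HBS u
  obtain ⟨l, hl⟩ := exists_retraction
  rw [baseChange_cls _ h, cls_eq_zero_iff (h.baseChange _)] at hu
  obtain ⟨v, hv⟩ := hu
  refine (cls_eq_zero_iff h).2 ⟨flatProj n l v, fun γ => ?_⟩
  rw [← flatProj_flatRep, ← map_sub, ← hv, flatProj_flatMap l hl]

end Restriction

/-! ### The quadratic form of a point of the upper half plane -/

section QuadraticForm

theorem im_smulH (γ : M2pos) (z : ℍ) :
    (γ • z).im = γ.1.det * z.im / Complex.normSq (γ.1 1 0 * z + γ.1 1 1) := by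
  rw [smulH_def, UpperHalfPlane.im_smul_eq_div_normSq, abs_of_pos (toGL_det_pos γ)]
  congr 2
  · simp [Matrix.det_fin_two, toGL_apply]

theorem det_cast_pos (γ : M2pos) : (0 : ℝ) < γ.1.det := by
  have h : 0 < γ.1.det := γ.2
  exact_mod_cast h

/-- The positive definite binary quadratic form `|w₀ - w₁ x|² / Im x`. -/
def normQ (x : ℍ) (w : Fin 2 → ℤ) : ℝ := Complex.normSq (w 0 - w 1 * x) / x.im

theorem normQ_nonneg (x : ℍ) (w : Fin 2 → ℤ) : 0 ≤ normQ x w :=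
  div_nonneg (Complex.normSq_nonneg _) x.im_pos.le

theorem normQ_mul_im (x : ℍ) (w : Fin 2 → ℤ) :
    normQ x w * x.im = (w 0 - w 1 * x.re) ^ 2 + (w 1 * x.im) ^ 2 := by
  rw [normQ, div_mul_cancel₀ _ x.im_pos.ne', Complex.normSq_apply]
  simp
  ring

/-- The linear form `w₀ - w₁x` is multiplied by `det γ / (cx + d)` and `Im x` by `det γ / |cx +
d|²`. So the form is invariant under `SL₂(ℤ)`, and a Hecke matrix multiplies it by `p`. -/
theorem normQ_smul (γ : M2pos) (x : ℍ) (w : Fin 2 → ℤ) :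
    normQ (γ • x) (γ.1.mulVec w) = γ.1.det * normQ x w := by
  have hne := denomH_ne_zero γ x
  have h1 : ((γ.1.mulVec w 0 : ℤ) : ℂ) - (γ.1.mulVec w 1 : ℤ) * (γ • x : ℍ) =
      γ.1.det * (w 0 - w 1 * x) / (γ.1 1 0 * x + γ.1 1 1) := by
    rw [coe_smulH, Matrix.det_fin_two]
    simp only [Matrix.mulVec, dotProduct, Fin.sum_univ_two]
    push_cast
    field_simp
    ring
  have h2 : Complex.normSq (γ.1 1 0 * x + γ.1 1 1) ≠ 0 := by simpa using hne
  have h3 := (det_cast_pos γ).ne'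
  have h4 := x.im_pos.ne'
  have h5 : Complex.normSq (γ.1.det : ℂ) = (γ.1.det : ℝ) * γ.1.det := Complex.normSq_intCast _
  rw [normQ, normQ, h1, im_smulH, Complex.normSq_div, Complex.normSq_mul, h5]
  generalize Complex.normSq (γ.1 1 0 * x + γ.1 1 1) = D at h2
  field_simp

/-- Two points of the upper half plane at hyperbolic distance at most `arcosh (3 / 2)`. -/
def IsNear (x y : ℍ) : Prop := Complex.normSq (x - y) ≤ x.im * y.im

/-- The quotient `|x - y|² / (Im x · Im y)` is a function of the hyperbolic distance; the
determinant cancels, so Hecke matrices preserve nearness too. -/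
theorem IsNear.smul {x y : ℍ} (h : IsNear x y) (γ : M2pos) : IsNear (γ • x) (γ • y) := by
  have hx := denomH_ne_zero γ x
  have hy := denomH_ne_zero γ y
  have h1 : ((γ • x : ℍ) : ℂ) - (γ • y : ℍ) =
      γ.1.det * (x - y) / ((γ.1 1 0 * x + γ.1 1 1) * (γ.1 1 0 * y + γ.1 1 1)) := by
    rw [coe_smulH, coe_smulH, Matrix.det_fin_two, div_sub_div _ _ hx hy]
    push_cast
    ring
  have h5 : Complex.normSq (γ.1.det : ℂ) = (γ.1.det : ℝ) * γ.1.det := Complex.normSq_intCast _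
  have hx' := Complex.normSq_pos.2 hx
  have hy' := Complex.normSq_pos.2 hy
  rw [IsNear, h1, im_smulH, im_smulH, Complex.normSq_div, Complex.normSq_mul, Complex.normSq_mul,
    h5, div_mul_div_comm]
  have hd := det_cast_pos γ
  have h6 : (γ.1.det : ℝ) * γ.1.det * Complex.normSq (x - y) ≤
      (γ.1.det : ℝ) * γ.1.det * (x.im * y.im) := by
    gcongr
    exact h
  rw [mul_mul_mul_comm] at h6 ⊢
  refine div_le_div_of_nonneg_right (h6.trans_eq ?_) (mul_pos hx' hy').le
  ring

/-- The ratio `r` of the imaginary parts satisfies `(r - 1)² ≤ r`, so it is at most `(3 + √5)/2 <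
3`. -/
theorem IsNear.im_le {x y : ℍ} (h : IsNear x y) : y.im ≤ 3 * x.im := by
  rw [IsNear, Complex.normSq_apply] at h
  simp only [Complex.sub_re, Complex.sub_im, UpperHalfPlane.coe_re, UpperHalfPlane.coe_im] at h
  have hx := x.im_pos
  have hy := y.im_pos
  nlinarith [mul_self_nonneg (x.re - y.re)]

theorem IsNear.symm {x y : ℍ} (h : IsNear x y) : IsNear y x := by
  rw [IsNear, ← neg_sub, Complex.normSq_neg, mul_comm]
  exact h

theorem IsNear.re_sub_sq_le {x y : ℍ} (h : IsNear x y) : (x.re - y.re) ^ 2 ≤ x.im * y.im := by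
  rw [IsNear, Complex.normSq_apply] at h
  simp only [Complex.sub_re, Complex.sub_im, UpperHalfPlane.coe_re, UpperHalfPlane.coe_im] at h
  nlinarith [mul_self_nonneg (x.im - y.im)]

theorem exists_ofSL_smul_fd (x : ℍ) :
    ∃ γ : SL(2, ℤ), |(ofSL γ • x).re| ≤ 1 / 2 ∧ 3 ≤ 4 * (ofSL γ • x).im ^ 2 := by
  obtain ⟨γ, h⟩ := ModularGroup.exists_smul_mem_fd x
  exact ⟨γ, h.2, ModularGroup.three_le_four_mul_im_sq_of_mem_fd h⟩

/-- The primitive integral vectors of bounded norm. -/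
def shortVectors (x : ℍ) : Set (Fin 2 → ℤ) :=
  {w | (∃ γ : SL(2, ℤ), w = γ.1.mulVec ![1, 0]) ∧ normQ x w ≤ 2}

theorem sq_le_of_normQ_le {x : ℍ} {w : Fin 2 → ℤ} {B : ℝ} (h : normQ x w ≤ B) :
    (w 1 : ℝ) ^ 2 * x.im ≤ B ∧ (w 0 - w 1 * x.re) ^ 2 ≤ B * x.im := by
  have h1 := normQ_mul_im x w
  have h2 := x.im_pos
  have h3 : normQ x w * x.im ≤ B * x.im := by gcongr
  constructor
  · refine le_of_mul_le_mul_right ?_ h2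
    nlinarith [sq_nonneg (w 0 - w 1 * x.re)]
  · nlinarith [sq_nonneg (w 1 * x.im)]

/-- Over a region with bounded real part and imaginary part bounded above and away from `0`, one box
contains all short vectors, so only finitely many values of `primValue` enter there. -/
theorem mem_box_of_normQ_le {x : ℍ} {w : Fin 2 → ℤ} (h : normQ x w ≤ 2) {A B : ℝ}
    (hA : |x.re| ≤ A) (hB : x.im ≤ B) (hB' : 1 ≤ x.im * B) (hB1 : 1 ≤ B) {N : ℤ}
    (hN : 2 * B * (A + 1) ≤ N) :
    w ∈ Set.Icc (fun _ => -N) (fun _ => N) := by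
  obtain ⟨h1, h2⟩ := sq_le_of_normQ_le h
  have hA0 := (abs_nonneg _).trans hA
  have h3 : |(w 1 : ℝ)| ≤ 2 * B := by
    refine abs_le_of_sq_le_sq ?_ (by linarith)
    have h4 : (w 1 : ℝ) ^ 2 ≤ (w 1 : ℝ) ^ 2 * (x.im * B) := le_mul_of_one_le_right (sq_nonneg _) hB'
    nlinarith
  have h4 : |w 0 - w 1 * x.re| ≤ 2 * B := by
    refine abs_le_of_sq_le_sq ?_ (by linarith)
    nlinarith
  have h5 : |(w 0 : ℝ)| ≤ 2 * B + 2 * B * A := by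
    have h6 : (w 0 : ℝ) = (w 0 - w 1 * x.re) + w 1 * x.re := by ring
    rw [h6]
    refine (abs_add_le _ _).trans (add_le_add h4 ?_)
    rw [abs_mul]
    gcongr
  have h6 : |(w 0 : ℝ)| ≤ N := h5.trans (by linarith)
  have h7 : |(w 1 : ℝ)| ≤ N := h3.trans (by nlinarith)
  rw [abs_le] at h6 h7
  constructor <;> intro i <;> fin_cases i
  · exact_mod_cast h6.1
  · exact_mod_cast h7.1
  · exact_mod_cast h6.2
  · exact_mod_cast h7.2

theorem finite_shortVectors (x : ℍ) : (shortVectors x).Finite := by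
  have hx := x.im_pos
  obtain ⟨N, hN⟩ := exists_int_ge (2 * (1 + x.im + x.im⁻¹) * (|x.re| + 1))
  refine (Set.finite_Icc (fun _ => -N) (fun _ => N)).subset fun w hw => ?_
  refine mem_box_of_normQ_le hw.2 le_rfl ?_ ?_ ?_ hN
  · have := inv_pos.2 hx
    linarith
  · rw [mul_add, mul_inv_cancel₀ hx.ne']
    have : 0 < x.im * (1 + x.im) := by positivity
    linarith
  · have := inv_pos.2 hx
    linarith

theorem shortVectors_smul (γ : SL(2, ℤ)) (x : ℍ) (w : Fin 2 → ℤ) :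
    γ.1.mulVec w ∈ shortVectors (ofSL γ • x) ↔ w ∈ shortVectors x := by
  have h1 : normQ (ofSL γ • x) (γ.1.mulVec w) = normQ x w := by
    have h := normQ_smul (ofSL γ) x w
    have h2 : (ofSL γ).1.det = 1 := γ.2
    rw [h2, Int.cast_one, one_mul] at h
    exact h
  refine and_congr ⟨?_, ?_⟩ (by rw [h1])
  · rintro ⟨δ, hδ⟩
    refine ⟨γ⁻¹ * δ, ?_⟩
    rw [Matrix.SpecialLinearGroup.coe_mul, ← Matrix.mulVec_mulVec, ← hδ, Matrix.mulVec_mulVec,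
      ← Matrix.SpecialLinearGroup.coe_mul, inv_mul_cancel]
    simp
  · rintro ⟨δ, rfl⟩
    exact ⟨γ * δ, by rw [Matrix.SpecialLinearGroup.coe_mul, ← Matrix.mulVec_mulVec]⟩

/-- The bound `2` is large enough: at a point of the fundamental domain the vector `(1, 0)` has norm
`1 / Im ≤ 2/√3`. -/
theorem shortVectors_nonempty (x : ℍ) : (shortVectors x).Nonempty := by
  obtain ⟨γ, -, h⟩ := exists_ofSL_smul_fd x
  refine ⟨γ⁻¹.1.mulVec ![1, 0], ?_⟩
  rw [← shortVectors_smul γ, Matrix.mulVec_mulVec, ← Matrix.SpecialLinearGroup.coe_mul,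
    mul_inv_cancel]
  refine ⟨⟨1, rfl⟩, ?_⟩
  have hy := (ofSL γ • x).im_pos
  set y := ofSL γ • x
  refine le_of_mul_le_mul_right ?_ hy
  rw [normQ_mul_im]
  simp
  nlinarith

/-- A short vector satisfies `w₁² Im x ≤ 2`, so high in the cusp `w₁ = 0` and only `±(1, 0)` remain.
The set of short vectors, and any average over it, is therefore constant there. -/
theorem mem_shortVectors_iff_of_lt_im {x : ℍ} (hx : 2 < x.im) (w : Fin 2 → ℤ) :
    w ∈ shortVectors x ↔ (∃ γ : SL(2, ℤ), w = γ.1.mulVec ![1, 0]) ∧ w 1 = 0 := by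
  refine and_congr_right ?_
  rintro ⟨γ, rfl⟩
  have h0 : γ.1.mulVec ![1, 0] 0 = γ.1 0 0 := by simp [Matrix.mulVec, dotProduct]
  have h1 : γ.1.mulVec ![1, 0] 1 = γ.1 1 0 := by simp [Matrix.mulVec, dotProduct]
  constructor
  · intro h
    by_contra h2
    have h3 := (sq_le_of_normQ_le h).1
    have h4 : (1 : ℤ) ≤ (γ.1.mulVec ![1, 0] 1) ^ 2 := by
      have := sq_pos_of_ne_zero h2
      omega
    have h5 : (1 : ℝ) ≤ ((γ.1.mulVec ![1, 0] 1 : ℤ) : ℝ) ^ 2 := by exact_mod_cast h4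
    nlinarith
  · intro h
    have h2 := γ.2
    rw [Matrix.det_fin_two, ← h1, h, mul_zero, sub_zero] at h2
    have h3 : γ.1 0 0 ^ 2 = 1 := by
      rcases Int.eq_one_or_neg_one_of_mul_eq_one h2 with h3 | h3 <;> simp [h3]
    refine le_of_mul_le_mul_right ?_ x.im_pos
    rw [normQ_mul_im, h, h0]
    have h4 : ((γ.1 0 0 : ℤ) : ℝ) ^ 2 = 1 := by exact_mod_cast h3
    simp [h4]
    linarith

end QuadraticForm

/-! ### Functions of bounded variation with a given cocycle -/

section BoundedFunction

/-! ### Group cocycles that vanish at `T`, as functions on primitive vectors -/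

section Group

variable {R V : Type} [CommRing R] [AddCommGroup V] [Module R V] {ρ : Representation R M2pos V}

/-- The subgroup on which a cocycle is the coboundary of a given vector. -/
def coboundarySubgroup (c : SL(2, ℤ) → V) (hc : ∀ γ δ, c (γ * δ) = c γ + ρ (ofSL γ) (c δ)) (v : V) :
    Subgroup SL(2, ℤ) where
  carrier := {γ | c γ = v - ρ (ofSL γ) v}
  one_mem' := by
    have h := hc 1 1
    simp only [mul_one, map_one, Module.End.one_apply, left_eq_add] at h
    simp [h]
  mul_mem' {γ δ} hγ hδ := by
    change c γ = _ at hγ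
    change c δ = _ at hδ
    change c (γ * δ) = _
    rw [hc, hγ, hδ, map_sub, map_mul, map_mul, Module.End.mul_apply]
    abel
  inv_mem' {γ} hγ := by
    change c γ = _ at hγ
    change c γ⁻¹ = _
    have h := hc 1 1
    simp only [mul_one, map_one, Module.End.one_apply, left_eq_add] at h
    have h1 := hc γ⁻¹ γ
    rw [inv_mul_cancel, h, hγ, map_sub, ofSL_inv_apply_apply] at h1
    rw [← sub_eq_zero, h1]
    abel

theorem eq_sub_of_generators {c : SL(2, ℤ) → V}
    (hc : ∀ γ δ, c (γ * δ) = c γ + ρ (ofSL γ) (c δ)) {v : V}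
    (hS : c ModularGroup.S = v - ρ (ofSL ModularGroup.S) v)
    (hT : c ModularGroup.T = v - ρ transT v) (γ : SL(2, ℤ)) : c γ = v - ρ (ofSL γ) v := by
  have h : (⊤ : Subgroup SL(2, ℤ)) ≤ coboundarySubgroup c hc v := by
    rw [← SpecialLinearGroup.SL2Z_generators, Subgroup.closure_le]
    rintro _ (rfl | rfl)
    · exact hS
    · exact hT
  exact h (Subgroup.mem_top γ)

/-- The function on primitive vectors defined by a cocycle that vanishes on the stabilizer of
`(1, 0)`. -/
def primValue (c : SL(2, ℤ) → V) (w : Fin 2 → ℤ) : V :=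
  open Classical in
  if h : ∃ γ : SL(2, ℤ), w = γ.1.mulVec ![1, 0] then c h.choose else 0

/-- The stabilizer of the vector `(1, 0)` consists of the powers of `T`, without sign, and `c`
vanishes on them; so the chosen `γ` does not matter. -/
theorem primValue_mulVec {c : SL(2, ℤ) → V} (hc : ∀ γ δ, c (γ * δ) = c γ + ρ (ofSL γ) (c δ))
    (hT : c ModularGroup.T = 0) (γ : SL(2, ℤ)) : primValue c (γ.1.mulVec ![1, 0]) = c γ := by
  have h : ∃ δ : SL(2, ℤ), γ.1.mulVec ![1, 0] = δ.1.mulVec ![1, 0] := ⟨γ, rfl⟩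
  rw [primValue, dif_pos h]
  have h1 := h.choose_spec
  set δ := h.choose
  have h2 : (γ⁻¹ * δ).1.mulVec ![1, 0] = ![1, 0] := by
    rw [Matrix.SpecialLinearGroup.coe_mul, ← Matrix.mulVec_mulVec, ← h1, Matrix.mulVec_mulVec,
      ← Matrix.SpecialLinearGroup.coe_mul, inv_mul_cancel]
    simp
  have h3 : (γ⁻¹ * δ).1 1 0 = 0 := by
    simpa [Matrix.mulVec, dotProduct] using congrFun h2 1
  have h4 : (γ⁻¹ * δ).1 0 0 = 1 := by
    simpa [Matrix.mulVec, dotProduct] using congrFun h2 0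
  obtain ⟨k, hk⟩ := exists_eq_zpow_T h3
  have h5 : γ⁻¹ * δ = ModularGroup.T ^ k := by
    rcases hk with hk | hk
    · exact hk
    · exfalso
      rw [hk, Matrix.SpecialLinearGroup.coe_mul, ModularGroup.coe_T_zpow] at h4
      simp at h4
  have h6 : c (ModularGroup.T ^ k) = 0 := by
    have h7 : ModularGroup.T ^ k ∈ coboundarySubgroup c hc 0 := by
      refine Subgroup.zpow_mem _ ?_ k
      change c _ = _
      rw [hT, map_zero, sub_zero]
    simpa using (show c _ = _ from h7)
  rw [← mul_inv_cancel_left γ δ, h5, hc, h6, map_zero, add_zero]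

theorem primValue_smul {c : SL(2, ℤ) → V} (hc : ∀ γ δ, c (γ * δ) = c γ + ρ (ofSL γ) (c δ))
    (hT : c ModularGroup.T = 0) (γ : SL(2, ℤ)) {x : ℍ} {w : Fin 2 → ℤ} (hw : w ∈ shortVectors x) :
    primValue c (γ.1.mulVec w) = ρ (ofSL γ) (primValue c w) + c γ := by
  obtain ⟨⟨δ, rfl⟩, -⟩ := hw
  rw [Matrix.mulVec_mulVec, ← Matrix.SpecialLinearGroup.coe_mul, primValue_mulVec hc hT,
    primValue_mulVec hc hT, hc, add_comm]

end Group

/-! ### Averages over short vectors -/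

section Average

variable {V : Type} [AddCommGroup V] [Module ℂ V] {ρ : Representation ℂ M2pos V}

/-- The average of `primValue` over the primitive vectors of bounded norm. -/
def shortAverage (c : SL(2, ℤ) → V) (x : ℍ) : V :=
  ((finite_shortVectors x).toFinset.card : ℂ)⁻¹ •
    ∑ w ∈ (finite_shortVectors x).toFinset, primValue c w

theorem card_shortVectors_ne_zero (x : ℍ) : ((finite_shortVectors x).toFinset.card : ℂ) ≠ 0 := by
  rw [Nat.cast_ne_zero, Finset.card_ne_zero, Set.Finite.toFinset_nonempty]
  exact shortVectors_nonempty x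

/-- The group permutes the short vectors and shifts each value of `primValue` by `c γ`, so the
average is shifted by `c γ` as well. This is an explicit function for the cocycle `c`, with values
that can be estimated. -/
theorem hasCocycle_shortAverage {c : SL(2, ℤ) → V}
    (hc : ∀ γ δ, c (γ * δ) = c γ + ρ (ofSL γ) (c δ)) (hT : c ModularGroup.T = 0) :
    HasCocycle ρ (shortAverage c) c := by
  intro γ x
  have hinj : Function.Injective (γ.1.mulVec : (Fin 2 → ℤ) → Fin 2 → ℤ) := fun v w h => by
    have h1 := congrArg (γ⁻¹.1.mulVec) h
    rw [Matrix.mulVec_mulVec, Matrix.mulVec_mulVec, ← Matrix.SpecialLinearGroup.coe_mul,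
      inv_mul_cancel] at h1
    simpa using h1
  have h1 : (finite_shortVectors (ofSL γ • x)).toFinset =
      (finite_shortVectors x).toFinset.map ⟨γ.1.mulVec, hinj⟩ := by
    ext w
    simp only [Set.Finite.mem_toFinset, Finset.mem_map, Function.Embedding.coeFn_mk]
    constructor
    · intro h
      refine ⟨γ⁻¹.1.mulVec w, ?_, ?_⟩
      · rw [← shortVectors_smul γ, Matrix.mulVec_mulVec, ← Matrix.SpecialLinearGroup.coe_mul,
          mul_inv_cancel]
        simpa using h
      · rw [Matrix.mulVec_mulVec, ← Matrix.SpecialLinearGroup.coe_mul, mul_inv_cancel]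
        simp
    · rintro ⟨w, hw, rfl⟩
      exact (shortVectors_smul γ x w).2 hw
  have h2 : ∑ w ∈ (finite_shortVectors x).toFinset, primValue c (γ.1.mulVec w) =
      ρ (ofSL γ) (∑ w ∈ (finite_shortVectors x).toFinset, primValue c w) +
        ((finite_shortVectors x).toFinset.card : ℂ) • c γ := by
    rw [Finset.sum_congr rfl fun w hw => primValue_smul hc hT γ ((Set.Finite.mem_toFinset _).1 hw),
      Finset.sum_add_distrib, map_sum, Finset.sum_const, Nat.cast_smul_eq_nsmul]
  rw [shortAverage, h1, Finset.card_map, Finset.sum_map]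
  simp only [Function.Embedding.coeFn_mk]
  rw [h2, smul_add, smul_smul, inv_mul_cancel₀ (card_shortVectors_ne_zero x), one_smul,
    shortAverage, map_smul]

theorem shortAverage_congr (c : SL(2, ℤ) → V) {x y : ℍ} (h : shortVectors x = shortVectors y) :
    shortAverage c x = shortAverage c y := by
  have h1 : (finite_shortVectors x).toFinset = (finite_shortVectors y).toFinset := by
    ext w
    simp [h]
  rw [shortAverage, h1, shortAverage]

end Average

/-! ### Estimates for the variation -/

variable {n m : ℕ}

theorem exists_norm_ev_le (hm : n = m + m) (P : Mflat n ℂ) :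
    ∃ C : ℝ, 0 ≤ C ∧ ∀ w, ‖ev n ℂ w P‖ ≤ C * ((w 0 : ℝ) ^ 2 + (w 1 : ℝ) ^ 2) ^ m := by
  obtain ⟨a, rfl⟩ := exists_eq_sum_flatVec P
  refine ⟨∑ ν : Fin (n + 1), ‖a ν‖ * n.choose ν, by positivity, fun w => ?_⟩
  rw [map_sum, Finset.sum_mul]
  refine (norm_sum_le _ _).trans (Finset.sum_le_sum fun ν _ => ?_)
  rw [map_smul, ev_flatVec, smul_eq_mul, norm_mul, norm_mul, norm_mul, norm_pow, norm_pow,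
    Complex.norm_natCast, Complex.norm_intCast, Complex.norm_intCast, mul_assoc, mul_assoc]
  gcongr
  set t := max |(w 0 : ℝ)| |(w 1 : ℝ)|
  have ht : 0 ≤ t := (abs_nonneg _).trans (le_max_left _ _)
  calc |(w 0 : ℝ)| ^ (n - ν) * |(w 1 : ℝ)| ^ (ν : ℕ) ≤ t ^ (n - ν) * t ^ (ν : ℕ) := by
        gcongr
        · exact le_max_left _ _
        · exact le_max_right _ _
    _ = (t ^ 2) ^ m := by
        rw [← pow_add, Nat.sub_add_cancel (Nat.lt_succ_iff.1 ν.2), ← pow_mul, two_mul, hm]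
    _ ≤ ((w 0 : ℝ) ^ 2 + (w 1 : ℝ) ^ 2) ^ m := by
        gcongr
        rcases max_choice |(w 0 : ℝ)| |(w 1 : ℝ)| with h | h <;> simp only [t, h, sq_abs]
        · linarith [sq_nonneg (w 1 : ℝ)]
        · linarith [sq_nonneg (w 0 : ℝ)]

/-- A bound for the variation of `ψ` between nearby points, in terms of the invariant norms
on the coefficient module. -/
def VariationBound (m : ℕ) (ψ : ℍ → Mflat n ℂ) (M : ℝ) : Prop :=
  ∀ x y, IsNear x y → ∀ w, ‖ev n ℂ w (ψ y - ψ x)‖ ≤ M * normQ x w ^ m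

/-- Both sides of the bound are invariant when `x`, `y` and `w` are moved together, and the cocycle
cancels in `ψ y - ψ x`. So `x` may be taken in the fundamental domain. -/
theorem variationBound_of_fd {ψ : ℍ → Mflat n ℂ} {c : SL(2, ℤ) → Mflat n ℂ}
    (hψ : HasCocycle (flatRep n ℂ) ψ c) {M : ℝ}
    (h : ∀ x y, IsNear x y → |x.re| ≤ 1 / 2 → 3 ≤ 4 * x.im ^ 2 →
      ∀ w, ‖ev n ℂ w (ψ y - ψ x)‖ ≤ M * normQ x w ^ m) : VariationBound m ψ M := by
  intro x y hxy w
  obtain ⟨γ, h1, h2⟩ := exists_ofSL_smul_fd x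
  have h3 := h _ _ (hxy.smul (ofSL γ)) h1 h2 (γ.1.mulVec w)
  have h4 : normQ (ofSL γ • x) (γ.1.mulVec w) = normQ x w := by
    have h := normQ_smul (ofSL γ) x w
    have h2 : (ofSL γ).1.det = 1 := γ.2
    rwa [h2, Int.cast_one, one_mul] at h
  rw [h4, hψ, hψ, add_sub_add_right_eq_sub, ← map_sub, ev_flatRep, adj_ofSL] at h3
  have h5 : (ofSL γ⁻¹).1.mulVec (γ.1.mulVec w) = w := by
    change γ⁻¹.1.mulVec (γ.1.mulVec w) = w
    rw [Matrix.mulVec_mulVec, ← Matrix.SpecialLinearGroup.coe_mul, inv_mul_cancel]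
    simp
  rwa [h5] at h3

theorem norm_ev_shortAverage_le (c : SL(2, ℤ) → Mflat n ℂ) (x : ℍ) (w : Fin 2 → ℤ)
    {s : Finset (Fin 2 → ℤ)} (hs : shortVectors x ⊆ s) :
    ‖ev n ℂ w (shortAverage c x)‖ ≤ ∑ v ∈ s, ‖ev n ℂ w (primValue c v)‖ := by
  have h1 : (1 : ℝ) ≤ (finite_shortVectors x).toFinset.card := by
    rw [Nat.one_le_cast, Nat.one_le_iff_ne_zero]
    exact_mod_cast card_shortVectors_ne_zero x
  rw [shortAverage, map_smul, norm_smul, norm_inv, Complex.norm_natCast, map_sum]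
  refine (mul_le_of_le_one_left (norm_nonneg _) (inv_le_one_of_one_le₀ h1)).trans ?_
  refine (norm_sum_le _ _).trans (Finset.sum_le_sum_of_subset_of_nonneg ?_ fun _ _ _ => norm_nonneg _)
  intro v hv
  exact hs ((Set.Finite.mem_toFinset _).1 hv)

/-- For `x` in the fundamental domain there are two cases. High in the cusp the average is constant.
Below, the points range over a bounded region, where finitely many polynomials occur and `Q_x` is
comparable to the Euclidean norm. -/
theorem exists_variationBound (hm : n = m + m) {c : SL(2, ℤ) → Mflat n ℂ}
    (hc : ∀ γ δ, c (γ * δ) = c γ + flatRep n ℂ (ofSL γ) (c δ)) (hT : c ModularGroup.T = 0) :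
    ∃ M : ℝ, 0 ≤ M ∧ VariationBound m (shortAverage c) M := by
  -- The side comes from `mem_box_of_normQ_le` with `A = 12` and `B = 18`: `2 · 18 · 13 = 936 ≤
  -- 1000`.
  obtain ⟨s, hs⟩ : ∃ s : Finset (Fin 2 → ℤ), Set.Icc (fun _ => -1000) (fun _ => 1000) ⊆ (s : Set (Fin 2 → ℤ)) :=
    ⟨Finset.Icc (fun _ => -1000) (fun _ => 1000), (Finset.coe_Icc _ _).ge⟩
  choose C hC0 hC using fun v => exists_norm_ev_le hm (primValue c v)
  refine ⟨2 * ((∑ v ∈ s, C v) * 24 ^ m), by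
    have : 0 ≤ ∑ v ∈ s, C v := Finset.sum_nonneg fun v _ => hC0 v
    positivity, variationBound_of_fd (hasCocycle_shortAverage hc hT) ?_⟩
  intro x y hxy hre him w
  have hCs : 0 ≤ ∑ v ∈ s, C v := Finset.sum_nonneg fun v _ => hC0 v
  have hQ := normQ_nonneg x w
  have hx := x.im_pos
  have hy := y.im_pos
  have h1 := hxy.im_le
  have h2 := hxy.symm.im_le
  -- Nearby imaginary parts differ by a factor of at most `3`, so `Im x > 6` gives `Im y > 2`, as
  -- needed for constancy.
  rcases lt_or_ge 6 x.im with h6 | h6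
  · have h3 : shortVectors y = shortVectors x := by
      ext v
      rw [mem_shortVectors_iff_of_lt_im (by linarith), mem_shortVectors_iff_of_lt_im (by linarith)]
    rw [shortAverage_congr c h3, sub_self, map_zero, norm_zero]
    positivity
  -- Here `4/5 < √3/2`. Hence `4/15 ≤ Im y ≤ 18`, and `|Re x - Re y|² ≤ 6 · 18 ≤ 11²`.
  · have hx1 : 4 / 5 ≤ x.im := by nlinarith
    have hrey : |y.re| ≤ 12 := by
      have h3 := hxy.re_sub_sq_le
      have h4 : |x.re - y.re| ≤ 11 := by
        refine abs_le_of_sq_le_sq ?_ (by norm_num)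
        nlinarith
      have h5 : y.re = x.re - (x.re - y.re) := by ring
      rw [h5]
      refine (abs_sub _ _).trans ?_
      linarith
    have hbox : ∀ z : ℍ, |z.re| ≤ 12 → z.im ≤ 18 → 4 / 15 ≤ z.im → shortVectors z ⊆ s := by
      intro z h3 h4 h5 v hv
      have h6 := mem_box_of_normQ_le hv.2 (A := 12) (B := 18) (N := 1000) h3 h4 (by linarith)
        (by norm_num) (by norm_num)
      exact hs h6
    have hS : (w 0 : ℝ) ^ 2 + (w 1 : ℝ) ^ 2 ≤ 24 * normQ x w := by
      obtain ⟨h3, h4⟩ := sq_le_of_normQ_le (le_refl (normQ x w))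
      have h5 : x.re ^ 2 ≤ 1 / 4 := by
        have := sq_le_sq' (abs_le.1 hre).1 (abs_le.1 hre).2
        linarith
      have h7 : (w 1 : ℝ) ^ 2 ≤ 5 / 4 * normQ x w := by
        nlinarith [sq_nonneg (w 1 : ℝ)]
      have h8 : (w 0 - w 1 * x.re) ^ 2 ≤ 6 * normQ x w := by nlinarith
      have h9 : ((w 1 : ℝ) * x.re) ^ 2 ≤ 5 / 16 * normQ x w := by
        rw [mul_pow]
        nlinarith [sq_nonneg (w 1 : ℝ)]
      nlinarith [sq_nonneg ((w 0 : ℝ) - 2 * w 1 * x.re)]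
    have hone : ∀ z : ℍ, shortVectors z ⊆ s →
        ‖ev n ℂ w (shortAverage c z)‖ ≤ (∑ v ∈ s, C v) * 24 ^ m * normQ x w ^ m := by
      intro z hz
      refine (norm_ev_shortAverage_le c z w hz).trans ?_
      rw [mul_assoc, ← mul_pow, Finset.sum_mul]
      refine Finset.sum_le_sum fun v _ => (hC v w).trans ?_
      have := hC0 v
      gcongr
    rw [map_sub]
    refine (norm_sub_le _ _).trans ?_
    have e1 := hone y (hbox y hrey (by linarith) (by linarith))
    have e2 := hone x (hbox x (by linarith) (by linarith) (by linarith))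
    linarith

theorem card_option_fin (p : ℕ) : Fintype.card (Option (Fin p)) = p + 1 := by simp

/-- At `w`, the term of `α` is the variation of `ψ` between `αx` and `αy` evaluated at `αw`. These
points are still near, and `Q_{αx}(αw) = p Q_x(w)`, so each of the `p + 1` terms costs a factor
`p^m`. -/
theorem VariationBound.heckeFun {ψ : ℍ → Mflat n ℂ} {M : ℝ} (h : VariationBound m ψ M)
    (p : Nat.Primes) :
    VariationBound m (heckeFun (flatRep n ℂ) p ψ) ((p + 1) * (p : ℝ) ^ m * M) := by
  intro x y hxy w
  rw [EisensteinClass.heckeFun, EisensteinClass.heckeFun, ← Finset.sum_sub_distrib, map_sum]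
  refine (norm_sum_le _ _).trans ?_
  have h1 : ∀ i ∈ (Finset.univ : Finset (Option (Fin p))),
      ‖ev n ℂ w (flatRep n ℂ (adj (heckeRep p i)) (ψ (heckeRep p i • y)) -
        flatRep n ℂ (adj (heckeRep p i)) (ψ (heckeRep p i • x)))‖ ≤
      (p : ℝ) ^ m * M * normQ x w ^ m := by
    intro i _
    rw [← map_sub, ev_flatRep_adj]
    refine (h _ _ (hxy.smul _) _).trans_eq ?_
    rw [normQ_smul, heckeRep_det, mul_pow, Int.cast_natCast]
    ring
  refine (Finset.sum_le_sum h1).trans_eq ?_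
  rw [Finset.sum_const, Finset.card_univ, card_option_fin, nsmul_eq_mul]
  push_cast
  ring

theorem VariationBound.smul {ψ : ℍ → Mflat n ℂ} {M : ℝ} (h : VariationBound m ψ M) (a : ℂ) :
    VariationBound m (fun x => a • ψ x) (‖a‖ * M) := by
  intro x y hxy w
  have e : a • ψ y - a • ψ x = a • (ψ y - ψ x) := (smul_sub a (ψ y) (ψ x)).symm
  beta_reduce
  rw [e, map_smul, norm_smul, mul_assoc]
  exact mul_le_mul_of_nonneg_left (h x y hxy w) (norm_nonneg a)

end BoundedFunction

/-! ### Hecke eigenclasses that vanish on the boundary -/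

section NormArgument

variable {n m : ℕ}

theorem isNear_I_smul_T : IsNear UpperHalfPlane.I (transT • UpperHalfPlane.I) := by
  have h : ((transT • UpperHalfPlane.I : ℍ) : ℂ) = Complex.I + 1 := by
    rw [coe_smulH]
    simp [transT, ofSL, ModularGroup.T]
  have h1 : (transT • UpperHalfPlane.I).im = 1 := by
    rw [← UpperHalfPlane.coe_im, h]
    simp
  rw [IsNear, h, h1]
  simp

theorem smul_S_I : ofSL ModularGroup.S • UpperHalfPlane.I = UpperHalfPlane.I := by
  apply UpperHalfPlane.ext
  rw [coe_smulH]
  simp [ofSL, ModularGroup.S]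

theorem exists_invariant_of_cls_eq {ψ ψ' : ℍ → Mflat n ℂ} {h : dPrim ψ ∈ Z1 ℍ (flatRep n ℂ)}
    {h' : dPrim ψ' ∈ Z1 ℍ (flatRep n ℂ)} (e : cls _ ψ h = cls _ ψ' h') :
    ∃ η : ℍ → Mflat n ℂ, (∀ γ x, η (ofSL γ • x) = flatRep n ℂ (ofSL γ) (η x)) ∧
      ∀ x y, (ψ y - ψ x) - (ψ' y - ψ' x) = η y - η x := by
  obtain ⟨η, hη, e1⟩ := (mem_B1_iff _).1 ((mk_eq_mk_iff _ _).1 e)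
  refine ⟨η, hη, fun x y => ?_⟩
  obtain ⟨σ, h0, h1⟩ := exists_simplex x y
  have e2 : dPrim ψ σ - dPrim ψ' σ = dPrim η σ := congrFun e1 σ
  rw [dPrim, dPrim, dPrim, h0, h1] at e2
  exact e2

/-- A vector in a finite-dimensional space of polynomials that is approximated, at all integral
vectors, by elements of a subspace lies in that subspace. -/
theorem mem_of_forall_tendsto (W : Submodule ℂ (Mflat n ℂ)) {a : Mflat n ℂ}
    (b : ℕ → Mflat n ℂ) (hb : ∀ k, b k ∈ W)
    (h : ∀ w, Filter.Tendsto (fun k => ev n ℂ w (b k)) Filter.atTop (nhds (ev n ℂ w a))) :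
    a ∈ W := by
  let E : Mflat n ℂ →ₗ[ℂ] ((Fin 2 → ℤ) → ℂ) := LinearMap.pi (ev n ℂ)
  have : Module.Finite ℂ (Mflat n ℂ) := Module.Finite.of_basis (flatBasis n ℂ)
  -- Evaluation at all integral vectors is injective, and a finite-dimensional subspace of the
  -- product space is closed under pointwise limits.
  have hcl : IsClosed ((W.map E : Submodule ℂ ((Fin 2 → ℤ) → ℂ)) : Set ((Fin 2 → ℤ) → ℂ)) :=
    Submodule.closed_of_finiteDimensional _
  have h1 : E a ∈ W.map E := hcl.mem_of_tendsto (tendsto_pi_nhds.2 h)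
    (Filter.Eventually.of_forall fun k => ⟨b k, hb k, rfl⟩)
  obtain ⟨v, hv, e⟩ := h1
  have h2 : v - a = 0 := eq_zero_of_ev_eq_zero fun w => by
    rw [map_sub, sub_eq_zero]
    exact congrFun e w
  rwa [← sub_eq_zero.1 h2]

/-- Functions in one class differ in variation by an equivariant `η`, and `η(i)` is fixed by `S`
because `S i = i`. As the variation of `ψ'` from `i` to `Ti` tends to zero, that of `ψ` is a limit
of vectors `η(i) - Tη(i)`, hence itself `v - Tv` with `Sv = v`. -/
theorem exists_ofSL_S_eq (ψ : ℍ → Mflat n ℂ) {h : dPrim ψ ∈ Z1 ℍ (flatRep n ℂ)}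
    {M θ : ℝ} (hθ0 : 0 ≤ θ) (hθ : θ < 1)
    (hψ : ∀ k : ℕ, ∃ (ψ' : ℍ → Mflat n ℂ) (h' : dPrim ψ' ∈ Z1 ℍ (flatRep n ℂ)),
      cls _ ψ' h' = cls _ ψ h ∧ VariationBound m ψ' (θ ^ k * M)) :
    ∃ v : Mflat n ℂ, flatRep n ℂ (ofSL ModularGroup.S) v = v ∧
      ψ (transT • UpperHalfPlane.I) - ψ UpperHalfPlane.I = v - flatRep n ℂ transT v := by
  let W : Submodule ℂ (Mflat n ℂ) :=
    (LinearMap.ker (flatRep n ℂ (ofSL ModularGroup.S) - LinearMap.id)).map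
      (LinearMap.id - flatRep n ℂ transT)
  have key : ψ (transT • UpperHalfPlane.I) - ψ UpperHalfPlane.I ∈ W := by
    have h1 : ∀ k : ℕ, ∃ v, flatRep n ℂ (ofSL ModularGroup.S) v = v ∧ ∀ w,
        ‖ev n ℂ w (v - flatRep n ℂ transT v) -
          ev n ℂ w (ψ (transT • UpperHalfPlane.I) - ψ UpperHalfPlane.I)‖ ≤
        θ ^ k * (M * normQ UpperHalfPlane.I w ^ m) := by
      intro k
      obtain ⟨ψ', h', e, hb⟩ := hψ k
      obtain ⟨η, hη, e1⟩ := exists_invariant_of_cls_eq e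
      refine ⟨η UpperHalfPlane.I, ?_, fun w => ?_⟩
      · rw [← hη, smul_S_I]
      · rw [← map_sub, ← hη, ← mul_assoc, ← norm_neg, ← map_neg]
        refine (hb _ _ isNear_I_smul_T w).trans_eq' ?_
        rw [sub_eq_iff_eq_add.1 (e1 UpperHalfPlane.I (transT • UpperHalfPlane.I))]
        congr 2
        abel
    choose b hb hb' using h1
    refine mem_of_forall_tendsto W (fun k => b k - flatRep n ℂ transT (b k))
      (fun k => ⟨b k, by simp [hb k], rfl⟩) fun w => ?_
    rw [tendsto_iff_norm_sub_tendsto_zero]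
    refine squeeze_zero (fun k => norm_nonneg _) (fun k => hb' k w) ?_
    simpa using (tendsto_pow_atTop_nhds_zero_of_lt_one hθ0 hθ).mul_const
      (M * normQ UpperHalfPlane.I w ^ m)
  obtain ⟨v, hv, e⟩ := key
  exact ⟨v, sub_eq_zero.1 hv, e.symm⟩

/-- On an eigenclass, `lam⁻¹` times the Hecke operator fixes the class while it rescales the bound
of the representing function; this is iterated. -/
theorem exists_cls_eq_variationBound {p : Nat.Primes} {lam : ℂ} (hlam : lam ≠ 0)
    {ψ : ℍ → Mflat n ℂ} {c : SL(2, ℤ) → Mflat n ℂ} (hψ : HasCocycle (flatRep n ℂ) ψ c)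
    (he : hecke (flatRep n ℂ) p (cls _ ψ hψ.dPrim_mem) = lam • cls _ ψ hψ.dPrim_mem) {M : ℝ}
    (hM : VariationBound m ψ M) (k : ℕ) :
    ∃ (ψ' : ℍ → Mflat n ℂ) (h' : dPrim ψ' ∈ Z1 ℍ (flatRep n ℂ)),
      cls _ ψ' h' = cls _ ψ hψ.dPrim_mem ∧
      VariationBound m ψ' ((‖lam‖⁻¹ * ((p + 1) * (p : ℝ) ^ m)) ^ k * M) := by
  induction k with
  | zero => exact ⟨ψ, hψ.dPrim_mem, rfl, by simpa using hM⟩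
  | succ k ih =>
    obtain ⟨ψ', h', e, hb⟩ := ih
    obtain ⟨c', hc'⟩ := hasCocycle_of_mem (dPrim_heckeFun_mem p h')
    refine ⟨_, (hc'.smul lam⁻¹).dPrim_mem, ?_, ?_⟩
    · rw [cls_smul _ hc', ← hecke_cls p h', e, he, smul_smul, inv_mul_cancel₀ hlam, one_smul]
    · have h1 := (hb.heckeFun p).smul lam⁻¹
      rw [norm_inv] at h1
      convert h1 using 1
      ring

/-- On the boundary path from `0` to `1`, `ψ` has the same variation as an equivariant function `η`.
Comparing the two at `T · 0 = 1` expresses `c(T)` through `ψ - η` at `0`. -/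
theorem exists_eq_sub_of_resBoundary_eq_zero {R : Type} [CommRing R] {ψ : HBS → Mflat n R}
    {c : SL(2, ℤ) → Mflat n R} (h : HasCocycle (flatRep n R) ψ c)
    (h0 : resBoundary n R (cls _ ψ h.dPrim_mem) = 0) :
    ∃ v, c ModularGroup.T = v - flatRep n R transT v := by
  obtain ⟨η, hη, e⟩ := (mem_B1_iff _).1 ((mk_eq_zero_iff _).1 h0)
  have h1 : dPrim ψ (inclBoundary.comp (boundaryPath 0)) = dPrim η (boundaryPath 0) :=
    congrFun e (boundaryPath 0)
  rw [dPrim, dPrim, ContinuousMap.comp_apply, ContinuousMap.comp_apply, boundaryPath_zero,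
    boundaryPath_one, zero_add, ← zero_add (1 : ℝ), ← transT_smul_bdInfty, hη] at h1
  change ψ (HBS.bd _) - ψ (HBS.bd _) = _ at h1
  rw [← smul_bd, h] at h1
  refine ⟨ψ (HBS.bd (bdInfty 0)) - η (bdInfty 0), ?_⟩
  rw [← sub_eq_zero] at h1 ⊢
  rw [← h1, map_sub]
  abel

/-- With `n = 2m` this is `(p + 1)p^m < 1 + p^(n+1)` at `p = 2`: the normalised Hecke operator
contracts the bound. The single prime `2` is enough. -/
theorem two_pow_ineq (hm : 1 ≤ m) : ((2 : ℝ) + 1) * 2 ^ m < 1 + 2 ^ (m + m + 1) := by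
  have h : (2 : ℝ) ≤ 2 ^ m := by simpa using pow_le_pow_right₀ (one_le_two (α := ℝ)) hm
  rw [pow_succ, pow_add]
  nlinarith

/-- The eigenvalue of `T_p'` on Eisenstein classes. -/
def eisEigenvalue (n : ℕ) (p : Nat.Primes) : ℕ := 1 + (p : ℕ) ^ (n + 1)

theorem eisEigenvalue_pos (n : ℕ) (p : Nat.Primes) : 0 < eisEigenvalue n p :=
  Nat.add_pos_left one_pos _

/-- The prime number `2`. -/
def primeTwo : Nat.Primes := ⟨2, Nat.prime_two⟩

/-- A class that vanishes on the boundary and is a Hecke eigenclass for the eigenvalues of the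
Eisenstein series is zero. -/
theorem eq_zero_of_resBoundary_eq_zero (hn : 2 ≤ n) (heven : Even n) {u : H1 HBS (flatRep n ℂ)}
    (h0 : resBoundary n ℂ u = 0)
    (hu : ∀ p, hecke (flatRep n ℂ) p u = (eisEigenvalue n p : ℂ) • u) : u = 0 := by
  obtain ⟨m, hm⟩ := heven
  obtain ⟨ψ, c, h, rfl⟩ := exists_cls_HBS u
  obtain ⟨v, hv⟩ := exists_eq_sub_of_resBoundary_eq_zero h h0
  -- Subtracting the constant `v` from `ψ` keeps the class and makes the cocycle vanish at `T`, as
  -- `shortAverage` requires.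
  have h1 := (h.sub_const v).inner
  have hT : (fun γ => c γ - (v - flatRep n ℂ (ofSL γ) v)) ModularGroup.T = 0 := sub_eq_zero.2 hv
  set c' := fun γ => c γ - (v - flatRep n ℂ (ofSL γ) v)
  have h2 := hasCocycle_shortAverage h1.mul hT
  obtain ⟨M, -, hM⟩ := exists_variationBound hm h1.mul hT
  have h3 : resInner n ℂ (cls _ ψ h.dPrim_mem) = cls _ (shortAverage c') h2.dPrim_mem := by
    rw [← cls_eq_cls_of_hasCocycle h1 h2, ← resInner_cls (h.sub_const v)]
    exact congrArg _ (cls_congr (dPrim_sub_const ψ v).symm)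
  have h4 : hecke (flatRep n ℂ) primeTwo (cls _ (shortAverage c') h2.dPrim_mem) =
      (eisEigenvalue n primeTwo : ℂ) • cls _ (shortAverage c') h2.dPrim_mem := by
    rw [← h3, ← resInner_hecke, hu, map_smul]
  have hlam : (eisEigenvalue n primeTwo : ℂ) ≠ 0 :=
    Nat.cast_ne_zero.2 (eisEigenvalue_pos n _).ne'
  have h5 := exists_cls_eq_variationBound hlam h2 h4 hM
  obtain ⟨x, hxS, hxT⟩ := exists_ofSL_S_eq (shortAverage c') (by positivity) (by
    rw [Complex.norm_natCast, inv_mul_lt_one₀ (Nat.cast_pos.2 (eisEigenvalue_pos n _))]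
    have := two_pow_ineq (m := m) (by omega)
    simpa [eisEigenvalue, primeTwo, hm] using this) h5
  -- The vector `ψ(i) + x` trivialises the cocycle at both generators: at `S` because `S` fixes `i`
  -- and `x`, at `T` by the choice of `x`.
  have h6 : cls _ (shortAverage c') h2.dPrim_mem = 0 := by
    refine (cls_eq_zero_iff h2).2 ⟨shortAverage c' UpperHalfPlane.I + x,
      eq_sub_of_generators h2.mul ?_ ?_⟩
    · have h7 := h2 ModularGroup.S UpperHalfPlane.I
      rw [smul_S_I] at h7
      rw [map_add, hxS, ← sub_eq_iff_eq_add'.2 h7]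
      abel
    · rw [h2 ModularGroup.T] at hxT
      rw [map_add]
      have h8 : c' ModularGroup.T = (c' ModularGroup.T + flatRep n ℂ transT
        (shortAverage c' UpperHalfPlane.I) - shortAverage c' UpperHalfPlane.I) +
        shortAverage c' UpperHalfPlane.I -
          flatRep n ℂ transT (shortAverage c' UpperHalfPlane.I) := by abel
      rw [h8, add_comm (c' _), hxT]
      abel
  exact resInner_injective (by rw [h3, h6, map_zero])

end NormArgument

/-! ### The Hecke relation of the Eisenstein series -/

section HeckeRelation

open ArithmeticFunction (sigma)

/-- With `k = p^a u` and `p ∤ u`, multiplicativity leaves the recursion `σ_s(p^(i+1)) = 1 + p^s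
σ_s(p^i)`. -/
theorem sigma_prime_mul {p : ℕ} (hp : p.Prime) (s k : ℕ) :
    sigma s (p * k) + (if p ∣ k then p ^ s * sigma s (k / p) else 0) =
      (1 + p ^ s) * sigma s k := by
  rcases eq_or_ne k 0 with rfl | hk
  · simp
  obtain ⟨a, u, hu, rfl⟩ := Nat.exists_eq_pow_mul_and_not_dvd hk p hp.ne_one
  have hcop : ∀ i, (p ^ i).Coprime u := fun i =>
    Nat.Coprime.pow_left i ((Nat.Prime.coprime_iff_not_dvd hp).2 hu)
  have hmul : ∀ i, sigma s (p ^ i * u) = sigma s (p ^ i) * sigma s u := fun i =>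
    ArithmeticFunction.isMultiplicative_sigma.map_mul_of_coprime (hcop i)
  have hsucc : ∀ i, sigma s (p ^ (i + 1)) = 1 + p ^ s * sigma s (p ^ i) := fun i => by
    rw [ArithmeticFunction.sigma_apply_prime_pow hp, ArithmeticFunction.sigma_apply_prime_pow hp,
      Finset.sum_range_succ', Finset.mul_sum, add_comm]
    congr 1
    · simp
    · refine Finset.sum_congr rfl fun j _ => ?_
      rw [← pow_add]
      congr 1
      ring
  rw [← mul_assoc, ← pow_succ', hmul, hmul]
  cases a with
  | zero =>
    rw [hsucc, if_neg (by simpa using hu)]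
    simp
  | succ a =>
    have h1 : p ^ (a + 1) * u / p = p ^ a * u := by
      rw [pow_succ', mul_assoc, Nat.mul_div_cancel_left _ hp.pos]
    have h2 : p ∣ p ^ (a + 1) * u := (dvd_pow_self p a.succ_ne_zero).mul_right u
    rw [if_pos h2, h1, hmul, hsucc (a + 1)]
    rw [hsucc a]
    ring

theorem sum_exp_eq {p : ℕ} (hp : p ≠ 0) (k : ℕ) :
    ∑ j ∈ Finset.range p, Complex.exp (2 * Real.pi * Complex.I * k * j / p) =
      if p ∣ k then (p : ℂ) else 0 := by
  have hp' : (p : ℂ) ≠ 0 := Nat.cast_ne_zero.2 hp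
  have h1 : ∀ j : ℕ, Complex.exp (2 * Real.pi * Complex.I * k * j / p) =
      Complex.exp (2 * Real.pi * Complex.I * k / p) ^ j := fun j => by
    rw [← Complex.exp_nat_mul]
    congr 1
    ring
  simp only [h1]
  have h2 : Complex.exp (2 * Real.pi * Complex.I * k / p) = 1 ↔ p ∣ k := by
    rw [Complex.exp_eq_one_iff]
    constructor
    · rintro ⟨m, hm⟩
      rw [div_eq_iff hp'] at hm
      have h3 : (k : ℂ) = m * p := by
        refine mul_left_cancel₀ Complex.two_pi_I_ne_zero ?_
        linear_combination hm
      have h4 : (k : ℤ) = m * p := by exact_mod_cast h3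
      exact Int.natCast_dvd_natCast.1 ⟨m, by rw [h4, mul_comm]⟩
    · rintro ⟨m, rfl⟩
      refine ⟨m, ?_⟩
      push_cast
      field_simp
  split_ifs with h
  · rw [h2.2 h]
    simp
  · rw [geom_sum_eq (fun h3 => h (h2.1 h3)), ← Complex.exp_nat_mul]
    have h3 : (p : ℂ) * (2 * Real.pi * Complex.I * k / p) = (k : ℤ) * (2 * Real.pi * Complex.I) := by
      push_cast
      field_simp
    rw [h3, Complex.exp_int_mul_two_pi_mul_I, sub_self, zero_div]

/-- The terms of the `q`-expansion of the Eisenstein series without its constant term. -/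
def sigmaTerm (s : ℕ) (z : ℂ) (k : ℕ) : ℂ :=
  sigma s k * Complex.exp (2 * Real.pi * Complex.I * k * z)

theorem sigmaTerm_zero (s : ℕ) (z : ℂ) : sigmaTerm s z 0 = 0 := by simp [sigmaTerm]

theorem norm_sigmaTerm (s : ℕ) (z : ℂ) (k : ℕ) :
    ‖sigmaTerm s z k‖ = sigma s k * Real.exp (-2 * Real.pi * k * z.im) := by
  rw [sigmaTerm, norm_mul, Complex.norm_exp, Complex.norm_natCast]
  congr 2
  simp

theorem summable_sigmaTerm {s : ℕ} (z : ℍ) : Summable (sigmaTerm s z) := by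
  have h := EisensteinSeries.summable_sigma_mul_cexp_pow (k := s + 1) (by omega) z
  rw [Nat.add_sub_cancel] at h
  refine h.congr fun k => ?_
  rw [sigmaTerm, ← Complex.exp_nat_mul]
  congr 2
  ring

theorem tsum_sigmaTerm_prime_mul {p : ℕ} (hp : p ≠ 0) (s : ℕ) (z : ℂ) :
    ∑' k, sigmaTerm s (p * z) k =
      ∑' k, if p ∣ k then sigma s (k / p) * Complex.exp (2 * Real.pi * Complex.I * k * z) else 0 := by
  have hinj : Function.Injective (fun k : ℕ => p * k) := fun a b h =>
    Nat.eq_of_mul_eq_mul_left (Nat.pos_of_ne_zero hp) h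
  refine Eq.trans (tsum_congr fun k => ?_) (hinj.tsum_eq fun k hk => ?_)
  · rw [if_pos (dvd_mul_right p k), Nat.mul_div_cancel_left _ (Nat.pos_of_ne_zero hp), sigmaTerm]
    congr 2
    push_cast
    ring
  · by_contra h
    exact hk (if_neg fun ⟨m, hm⟩ => h ⟨m, hm.symm⟩)

theorem summable_sigmaTerm_prime_mul {p : ℕ} (hp : p ≠ 0) (s : ℕ) (z : ℍ) :
    Summable fun k : ℕ => if p ∣ k then
      sigma s (k / p) * Complex.exp (2 * Real.pi * Complex.I * k * z) else 0 := by
  have hinj : Function.Injective (fun k : ℕ => p * k) := fun a b h =>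
    Nat.eq_of_mul_eq_mul_left (Nat.pos_of_ne_zero hp) h
  have him : 0 < ((p : ℂ) * z).im := by
    rw [← nsmul_eq_mul, Complex.smul_im, nsmul_eq_mul]
    have := Nat.pos_of_ne_zero hp
    have := z.im_pos
    simp only [UpperHalfPlane.coe_im]
    positivity
  rw [← hinj.summable_iff]
  · refine (summable_sigmaTerm (s := s) ⟨(p : ℂ) * z, him⟩).congr fun k => ?_
    rw [Function.comp_apply, if_pos (dvd_mul_right p k),
      Nat.mul_div_cancel_left _ (Nat.pos_of_ne_zero hp), sigmaTerm]
    congr 2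
    push_cast
    ring
  · intro k hk
    exact if_neg fun ⟨m, hm⟩ => hk ⟨m, hm.symm⟩

/-- Summing over `j` kills the terms whose index is prime to `p`, by `sum_exp_eq`; the surviving
indices `pk` are renumbered by `k`. -/
theorem sum_tsum_sigmaTerm {p : ℕ} (hp : p ≠ 0) (s : ℕ) (z : ℍ) :
    HasSum (fun k : ℕ => p * (sigma s (p * k) * Complex.exp (2 * Real.pi * Complex.I * k * z)))
      (∑ j ∈ Finset.range p, ∑' k, sigmaTerm s ((z + j) / p) k) := by
  have hp' : (p : ℂ) ≠ 0 := Nat.cast_ne_zero.2 hp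
  have hinj : Function.Injective (fun k : ℕ => p * k) := fun a b h =>
    Nat.eq_of_mul_eq_mul_left (Nat.pos_of_ne_zero hp) h
  have him : ∀ j : ℕ, 0 < (((z : ℂ) + j) / p).im := fun j => by
    rw [Complex.div_natCast_im, Complex.add_im, Complex.natCast_im, add_zero]
    exact div_pos z.im_pos (Nat.cast_pos.2 (Nat.pos_of_ne_zero hp))
  have h1 := hasSum_sum (s := Finset.range p) fun j _ =>
    (summable_sigmaTerm (s := s) ⟨((z : ℂ) + j) / p, him j⟩).hasSum
  have h2 : ∀ k : ℕ, ∑ j ∈ Finset.range p, sigmaTerm s (((z : ℂ) + j) / p) k =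
      if p ∣ k then p * (sigma s k * Complex.exp (2 * Real.pi * Complex.I * k * z / p)) else 0 := by
    intro k
    have h3 : ∀ j ∈ Finset.range p, sigmaTerm s (((z : ℂ) + j) / p) k =
        (sigma s k * Complex.exp (2 * Real.pi * Complex.I * k * z / p)) *
          Complex.exp (2 * Real.pi * Complex.I * k * j / p) := fun j _ => by
      rw [sigmaTerm, mul_assoc ((sigma s k : ℕ) : ℂ), ← Complex.exp_add]
      congr 2
      ring
    rw [Finset.sum_congr rfl h3, ← Finset.mul_sum, sum_exp_eq hp]
    split_ifs
    · ring
    · ring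
  simp only [h2] at h1
  rw [← hinj.hasSum_iff fun k hk => if_neg fun ⟨m, hm⟩ => hk ⟨m, hm.symm⟩] at h1
  refine h1.congr_fun fun k => ?_
  rw [Function.comp_apply, if_pos (dvd_mul_right p k)]
  congr 3
  push_cast
  field_simp

/-- The coefficients of the two sides agree by `sigma_prime_mul`. -/
theorem hecke_tsum_sigmaTerm {p : ℕ} (hp : p.Prime) (s : ℕ) (z : ℍ) :
    (p : ℂ) ^ s * ∑' k, sigmaTerm s (p * z) k +
      (p : ℂ)⁻¹ * ∑ j ∈ Finset.range p, ∑' k, sigmaTerm s ((z + j) / p) k =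
      (1 + (p : ℂ) ^ s) * ∑' k, sigmaTerm s z k := by
  have hp' : (p : ℂ) ≠ 0 := Nat.cast_ne_zero.2 hp.ne_zero
  rw [tsum_sigmaTerm_prime_mul hp.ne_zero]
  have h1 := (summable_sigmaTerm_prime_mul hp.ne_zero s z).hasSum.mul_left ((p : ℂ) ^ s)
  have h2 := (sum_tsum_sigmaTerm hp.ne_zero s z).mul_left ((p : ℂ)⁻¹)
  have h3 := (summable_sigmaTerm (s := s) z).hasSum.mul_left (1 + (p : ℂ) ^ s)
  refine (h1.add h2).unique (h3.congr_fun fun k => ?_)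
  have h4 : ((sigma s (p * k) : ℕ) : ℂ) +
      (if p ∣ k then (p : ℂ) ^ s * (sigma s (k / p) : ℕ) else 0) =
      (1 + (p : ℂ) ^ s) * (sigma s k : ℕ) := by
    have h5 := congrArg (Nat.cast : ℕ → ℂ) (sigma_prime_mul hp s k)
    push_cast at h5
    exact h5
  rw [sigmaTerm, ← mul_assoc (1 + (p : ℂ) ^ s), ← h4, inv_mul_cancel_left₀ hp']
  split_ifs <;> ring

variable {n : ℕ} (hn : 2 ≤ n) (heven : Even n)

theorem exists_eisenstein_eq : ∃ C : ℂ, ∀ z : ℍ,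
    eisenstein n hn heven z = 1 + C * ∑' k, sigmaTerm (n + 1) z k := by
  refine ⟨2 / riemannZeta (-1 - n), fun z => ?_⟩
  change 1 + 2 / riemannZeta (-1 - n) * ∑' k : ℕ+, sigmaTerm (n + 1) z k = _
  -- The sum may start at `k = 0`, since that term vanishes.
  rw [PNat.coe_injective.tsum_eq (f := sigmaTerm (n + 1) z)]
  intro k hk
  have h : k ≠ 0 := fun h => hk (by rw [h, sigmaTerm_zero])
  exact ⟨⟨k, Nat.pos_of_ne_zero h⟩, rfl⟩

theorem heckeRep_none_coe (p : Nat.Primes) (z : ℍ) : ((heckeRep p none • z : ℍ) : ℂ) = p * z := by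
  rw [coe_smulH]
  simp [heckeRep]

theorem heckeRep_some_coe (p : Nat.Primes) (j : Fin p) (z : ℍ) :
    ((heckeRep p (some j) • z : ℍ) : ℂ) = (z + (j : ℕ)) / p := by
  rw [coe_smulH]
  simp [heckeRep]

/-- The constant terms match as `p^(n+1) + p⁻¹ · p`. The weights `p^(n+1)` and `p⁻¹` are those that
`(w₀ - w₁z)^n dz` acquires under the Hecke matrices. -/
theorem eisenstein_hecke (p : Nat.Primes) (z : ℍ) :
    (p : ℂ) ^ (n + 1) * eisenstein n hn heven (heckeRep p none • z) +
      (p : ℂ)⁻¹ * ∑ j : Fin p, eisenstein n hn heven (heckeRep p (some j) • z) =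
      eisEigenvalue n p * eisenstein n hn heven z := by
  obtain ⟨C, hC⟩ := exists_eisenstein_eq hn heven
  have hp' : (p : ℂ) ≠ 0 := Nat.cast_ne_zero.2 p.2.ne_zero
  have h := hecke_tsum_sigmaTerm p.2 (n + 1) z
  simp only [hC, heckeRep_none_coe, heckeRep_some_coe]
  rw [Finset.sum_add_distrib, ← Finset.mul_sum,
    Fin.sum_univ_eq_sum_range (fun j : ℕ => ∑' k, sigmaTerm (n + 1) (((z : ℂ) + j) / (p : ℕ)) k)]
  simp only [Finset.sum_const, Finset.card_univ, Fintype.card_fin, nsmul_eq_mul, mul_one]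
  rw [eisEigenvalue]
  push_cast
  rw [mul_add (p : ℂ)⁻¹, inv_mul_cancel₀ hp']
  linear_combination C * h

/-- The Eisenstein series tends to `1` at `i∞`. -/
theorem exists_norm_eisenstein_sub_one_le : ∃ K : ℝ, ∀ z : ℍ, 1 ≤ z.im →
    ‖eisenstein n hn heven z - 1‖ ≤ K * Real.exp (-2 * Real.pi * (z.im - 1)) := by
  obtain ⟨C, hC⟩ := exists_eisenstein_eq hn heven
  refine ⟨‖C‖ * ∑' k, ‖sigmaTerm (n + 1) UpperHalfPlane.I k‖, fun z hz => ?_⟩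
  rw [hC, add_sub_cancel_left, norm_mul, mul_assoc]
  refine mul_le_mul_of_nonneg_left ?_ (norm_nonneg C)
  have hs := (summable_sigmaTerm (s := n + 1) UpperHalfPlane.I).norm
  have hz' := (summable_sigmaTerm (s := n + 1) z).norm
  refine (norm_tsum_le_tsum_norm hz').trans ?_
  rw [← tsum_mul_right]
  refine hz'.tsum_le_tsum (fun k => ?_) (hs.mul_right _)
  rcases Nat.eq_zero_or_pos k with rfl | hk
  · simp [sigmaTerm_zero]
  rw [norm_sigmaTerm, norm_sigmaTerm, mul_assoc ((sigma (n + 1) k : ℕ) : ℝ), ← Real.exp_add]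
  refine mul_le_mul_of_nonneg_left (Real.exp_le_exp.2 ?_) (Nat.cast_nonneg _)
  simp only [UpperHalfPlane.coe_im, UpperHalfPlane.I_im]
  have h1 : (1 : ℝ) ≤ k := by exact_mod_cast hk
  have h2 : 0 ≤ Real.pi * ((k - 1) * (z.im - 1)) :=
    mul_nonneg Real.pi_pos.le (mul_nonneg (by linarith) (by linarith))
  nlinarith

end HeckeRelation

/-! ### The cocycle of the Eisenstein series -/

section EisensteinCocycle

variable {n : ℕ}

theorem eq_of_hasDerivAt_zero {D : ℂ → ℂ} (h : ∀ z : ℍ, HasDerivAt D 0 z) (x y : ℍ) :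
    D x = D y := by
  have hd : ∀ z ∈ {z : ℂ | 0 < z.im}, HasDerivWithinAt D 0 {z : ℂ | 0 < z.im} z :=
    fun z hz => (h ⟨z, hz⟩).hasDerivWithinAt
  have h1 := (convex_halfSpace_im_gt 0).norm_image_sub_le_of_norm_hasDerivWithin_le (C := 0) hd
    (fun z _ => by simp) y.im_pos x.im_pos
  rw [zero_mul, norm_le_zero_iff, sub_eq_zero] at h1
  exact h1

/-- The Eichler--Shimura cochain of a modular form is the coboundary of a polynomial-valued
function with holomorphic values at integral vectors. -/
theorem exists_esCochain_eq_dPrim (n : ℕ) {k : ℤ} (f : ModularForm 𝒮ℒ k) :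
    ∃ (ψ : ℍ → Mflat n ℂ) (G : (Fin 2 → ℤ) → ℂ → ℂ), esCochain n f = dPrim ψ ∧
      (∀ w (z : ℍ), ev n ℂ w (ψ z) = G w z) ∧
      ∀ w (z : ℍ), HasDerivAt (G w) (f z * (w 0 - w 1 * z) ^ n) z := by
  obtain ⟨F, hF, h⟩ := esCochain_eq (n := n) f
  refine ⟨fun z => ∑ ν : Fin (n + 1), F ν z • flatVec n ℂ ν,
    fun w z => ∑ ν : Fin (n + 1), F ν z * (n.choose ν * (w 0 : ℂ) ^ (n - ν) * (w 1 : ℂ) ^ (ν : ℕ)),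
    ?_, fun w z => ?_, fun w z => ?_⟩
  · funext σ
    apply Subtype.ext
    rw [h, Finset.sum_range, dPrim, ← Finset.sum_sub_distrib, Submodule.coe_sum]
    refine Finset.sum_congr rfl fun ν _ => ?_
    exact sub_smul _ _ _
  · rw [map_sum]
    exact Finset.sum_congr rfl fun ν _ => by rw [map_smul, ev_flatVec, smul_eq_mul]
  · have h1 := HasDerivAt.fun_sum (u := Finset.univ) fun (ν : Fin (n + 1)) _ =>
      (hF ν z z.im_pos).mul_const (n.choose ν * (w 0 : ℂ) ^ (n - ν) * (w 1 : ℂ) ^ (ν : ℕ))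
    refine h1.congr_deriv (Eq.symm ?_)
    rw [sub_eq_neg_add, ← neg_mul, add_pow, Finset.sum_range, Finset.mul_sum]
    refine Finset.sum_congr rfl fun ν _ => ?_
    rw [esIntegrand, UpperHalfPlane.ofComplex_apply]
    ring

/-- Compare derivatives of the values at each `w`. For `z ↦ pz` the integrand `(w₀ - w₁z)^n dz` at
`αw` is multiplied by `p^(n+1)`, for `z ↦ (z + j)/p` by `p⁻¹`, so the hypothesis on `f` is what
makes the difference constant. -/
theorem heckeFun_sub_eq {f : ℍ → ℂ} {ψ : ℍ → Mflat n ℂ} {G : (Fin 2 → ℤ) → ℂ → ℂ}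
    (hG : ∀ w (z : ℍ), ev n ℂ w (ψ z) = G w z)
    (hG' : ∀ w (z : ℍ), HasDerivAt (G w) (f z * (w 0 - w 1 * z) ^ n) z) {p : Nat.Primes} {N : ℕ}
    (hf : ∀ z : ℍ, (p : ℂ) ^ (n + 1) * f (heckeRep p none • z) +
      (p : ℂ)⁻¹ * ∑ j : Fin p, f (heckeRep p (some j) • z) = N * f z) (x y : ℍ) :
    heckeFun (flatRep n ℂ) p ψ y - heckeFun (flatRep n ℂ) p ψ x = N • (ψ y - ψ x) := by
  have hp' : (p : ℂ) ≠ 0 := Nat.cast_ne_zero.2 p.2.ne_zero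
  rw [← sub_eq_zero]
  refine eq_zero_of_ev_eq_zero fun w => ?_
  let D : ℂ → ℂ := fun z => G ((heckeRep p none).1.mulVec w) (p * z) +
    ∑ j : Fin p, G ((heckeRep p (some j)).1.mulVec w) ((z + (j : ℕ)) / p) - N * G w z
  have hev : ∀ z : ℍ, ev n ℂ w (heckeFun (flatRep n ℂ) p ψ z) - N * ev n ℂ w (ψ z) = D z := by
    intro z
    rw [heckeFun, map_sum, Fintype.sum_option]
    simp only [ev_flatRep_adj, hG, heckeRep_none_coe, heckeRep_some_coe, D]
  have hD : ∀ z : ℍ, HasDerivAt D 0 z := by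
    intro z
    have e0 : HasDerivAt (fun z : ℂ => (p : ℂ) * z) p (z : ℂ) := by
      simpa using (hasDerivAt_id (z : ℂ)).const_mul (p : ℂ)
    have h0 := hG' ((heckeRep p none).1.mulVec w) (heckeRep p none • z)
    rw [heckeRep_none_coe] at h0
    have h0' := h0.comp (z : ℂ) e0
    have e1 : ∀ j : Fin p, HasDerivAt (fun z : ℂ => (z + (j : ℕ)) / p) (p : ℂ)⁻¹ (z : ℂ) := by
      intro j
      simpa using ((hasDerivAt_id (z : ℂ)).add_const ((j : ℕ) : ℂ)).div_const (p : ℂ)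
    have h1 : ∀ j : Fin p, HasDerivAt
        (fun z => G ((heckeRep p (some j)).1.mulVec w) ((z + (j : ℕ)) / p))
        (f (heckeRep p (some j) • z) * (w 0 - w 1 * z) ^ n * (p : ℂ)⁻¹) z := by
      intro j
      have h2 := hG' ((heckeRep p (some j)).1.mulVec w) (heckeRep p (some j) • z)
      rw [heckeRep_some_coe] at h2
      have h3 := h2.comp (z : ℂ) (e1 j)
      refine h3.congr_deriv ?_
      congr 3
      simp only [heckeRep, Matrix.mulVec, dotProduct, Fin.sum_univ_two, Matrix.of_apply,
        Matrix.cons_val', Matrix.cons_val_zero, Matrix.cons_val_one, Matrix.cons_val_fin_one]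
      push_cast
      field_simp
      ring
    have h2 := (h0'.add (HasDerivAt.fun_sum (u := Finset.univ) fun j _ => h1 j)).sub
      ((hG' w z).const_mul (N : ℂ))
    refine h2.congr_deriv ?_
    rw [← mul_assoc (N : ℂ), ← hf, ← Finset.sum_mul, ← Finset.sum_mul]
    simp only [heckeRep, Matrix.mulVec, dotProduct, Fin.sum_univ_two, Matrix.of_apply,
      Matrix.cons_val', Matrix.cons_val_zero, Matrix.cons_val_one, Matrix.cons_val_fin_one]
    push_cast
    have h3 : ((p : ℂ) * w 0 + 0 * w 1 - (0 * w 0 + 1 * w 1) * (p * z)) = p * (w 0 - w 1 * z) := by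
      ring
    rw [h3, mul_pow]
    ring
  have h1 := eq_of_hasDerivAt_zero hD y x
  rw [← hev, ← hev] at h1
  rw [map_sub, map_sub, map_nsmul, map_sub, nsmul_eq_mul]
  linear_combination h1

/-- The number is the integral of the Eisenstein series from `z` to `z + 1`. It is the same at every
height, and the integrand tends to `1` at `i∞`. -/
theorem ev_period_eq_one (hn : 2 ≤ n) (heven : Even n) {ψ : ℍ → Mflat n ℂ}
    {G : (Fin 2 → ℤ) → ℂ → ℂ} (hG : ∀ w (z : ℍ), ev n ℂ w (ψ z) = G w z)
    (hG' : ∀ w (z : ℍ), HasDerivAt (G w) (eisenstein n hn heven z * (w 0 - w 1 * z) ^ n) z)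
    {c : SL(2, ℤ) → Mflat n ℂ} (hc : HasCocycle (flatRep n ℂ) ψ c) :
    ev n ℂ ![1, 0] (c ModularGroup.T) = 1 := by
  obtain ⟨K, hK⟩ := exists_norm_eisenstein_sub_one_le hn heven
  have hd : ∀ z : ℍ, HasDerivAt (fun z => G ![1, 0] z - z) (eisenstein n hn heven z - 1) z := by
    intro z
    have h1 := (hG' ![1, 0] z).sub (hasDerivAt_id (z : ℂ))
    exact h1.congr_deriv (by simp)
  have hK0 : 0 ≤ K := by
    have h1 := (norm_nonneg _).trans (hK UpperHalfPlane.I le_rfl)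
    simpa using h1
  -- The segment is taken at height `|y| + 1`, which is at least `1` for every real `y`, and the
  -- mean value inequality is applied to the primitive minus `z`.
  have hbound : ∀ y : ℝ, ‖ev n ℂ ![1, 0] (c ModularGroup.T) - 1‖ ≤
      K * Real.exp (-2 * Real.pi * |y|) := by
    intro y
    have hpos : 0 < |y| + 1 := by positivity
    let z : ℍ := ⟨⟨0, |y| + 1⟩, hpos⟩
    have hz : ((transT • z : ℍ) : ℂ) = z + 1 := by
      rw [coe_smulH]
      simp [transT, ofSL, ModularGroup.T]
    have h1 := (convex_halfSpace_im_ge (|y| + 1)).norm_image_sub_le_of_norm_hasDerivWithin_le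
      (f := fun z => G ![1, 0] z - z) (C := K * Real.exp (-2 * Real.pi * |y|))
      (x := (z : ℂ)) (y := z + 1)
      (f' := fun z => eisenstein n hn heven (UpperHalfPlane.ofComplex z) - 1)
      (fun x hx => by
        have hx' : 0 < x.im := hpos.trans_le hx
        rw [UpperHalfPlane.ofComplex_apply_of_im_pos hx']
        exact (hd ⟨x, hx'⟩).hasDerivWithinAt)
      (fun x hx => by
        have hx0 : |y| + 1 ≤ x.im := hx
        have hx' : 0 < x.im := hpos.trans_le hx
        rw [UpperHalfPlane.ofComplex_apply_of_im_pos hx']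
        refine (hK ⟨x, hx'⟩ ((le_add_of_nonneg_left (abs_nonneg y)).trans hx)).trans ?_
        refine mul_le_mul_of_nonneg_left (Real.exp_le_exp.2 ?_) hK0
        have h2 : |y| ≤ x.im - 1 := by linarith
        have h3 := mul_le_mul_of_nonneg_left h2 Real.pi_pos.le
        change -2 * Real.pi * (x.im - 1) ≤ -2 * Real.pi * |y|
        linarith) (le_refl (|y| + 1)) (by
        change |y| + 1 ≤ ((z : ℂ) + 1).im
        rw [Complex.add_im, Complex.one_im, add_zero])
    rw [add_sub_cancel_left, norm_one, mul_one] at h1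
    refine h1.trans_eq' ?_
    have h2 := congrArg (ev n ℂ ![1, 0]) (hc ModularGroup.T z)
    rw [map_add, ev_transT, hG, hG, hz] at h2
    rw [← sub_eq_iff_eq_add'.2 h2]
    congr 1
    ring
  have hlim : Filter.Tendsto (fun y : ℝ => K * Real.exp (-2 * Real.pi * |y|)) Filter.atTop
      (nhds 0) := by
    rw [← mul_zero K]
    refine Filter.Tendsto.const_mul K (Real.tendsto_exp_atBot.comp ?_)
    refine Filter.Tendsto.const_mul_atTop_of_neg ?_ Filter.tendsto_abs_atTop_atTop
    linarith [Real.pi_pos]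
  have h0 := ge_of_tendsto' hlim hbound
  rw [norm_le_zero_iff, sub_eq_zero] at h0
  exact h0

/-- The cocycle of the Eisenstein series. -/
theorem exists_eisensteinCocycle (hn : 2 ≤ n) (heven : Even n) :
    ∃ (ψ : ℍ → Mflat n ℂ) (c : SL(2, ℤ) → Mflat n ℂ) (hc : HasCocycle (flatRep n ℂ) ψ c),
      eichlerShimura n (eisenstein n hn heven) = cls _ ψ hc.dPrim_mem ∧
      (∀ p x y, heckeFun (flatRep n ℂ) p ψ y - heckeFun (flatRep n ℂ) p ψ x =
        eisEigenvalue n p • (ψ y - ψ x)) ∧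
      ev n ℂ ![1, 0] (c ModularGroup.T) = 1 := by
  obtain ⟨ψ, G, hes, hG, hG'⟩ := exists_esCochain_eq_dPrim n (eisenstein n hn heven)
  have hmem : dPrim ψ ∈ Z1 ℍ (flatRep n ℂ) :=
    hes ▸ ⟨esCochain_invariant (eisenstein n hn heven), esCochain_closed (eisenstein n hn heven)⟩
  obtain ⟨c, hc⟩ := hasCocycle_of_mem hmem
  exact ⟨ψ, c, hc, congrArg (H1.mk _) (Subtype.ext hes),
    fun p x y => heckeFun_sub_eq hG hG' (eisenstein_hecke hn heven p) x y,
    ev_period_eq_one hn heven hG hG' hc⟩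

end EisensteinCocycle

/-! ### Rationality and the Hecke-equivariant section -/

section Rationality

theorem hecke_cls_of_heckeFun_sub {X : Type} [TopologicalSpace X] [MulAction M2pos X]
    [ContinuousConstSMul M2pos X] {R V : Type} [CommRing R] [AddCommGroup V] [Module R V]
    {ρ : Representation R M2pos V} {p : Nat.Primes} {N : ℕ} {ψ : X → V} (h : dPrim ψ ∈ Z1 X ρ)
    (hψ : ∀ x y, heckeFun ρ p ψ y - heckeFun ρ p ψ x = N • (ψ y - ψ x)) :
    hecke ρ p (cls ρ ψ h) = (N : R) • cls ρ ψ h := by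
  rw [hecke_cls p h, cls, cls, ← map_smul]
  refine congrArg (H1.mk ρ) (Subtype.ext ?_)
  funext σ
  change heckeFun ρ p ψ _ - heckeFun ρ p ψ _ = (N : R) • (ψ _ - ψ _)
  rw [hψ, Nat.cast_smul_eq_nsmul]

variable {n : ℕ}

theorem heckeFun_flatProj {X : Type} [MulAction M2pos X] (l : ℂ →+ ℚ) (p : Nat.Primes)
    (ψ : X → Mflat n ℂ) (x : X) :
    heckeFun (flatRep n ℚ) p (fun x => flatProj n l (ψ x)) x =
      flatProj n l (heckeFun (flatRep n ℂ) p ψ x) := by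
  rw [heckeFun, heckeFun, map_sum]
  exact Finset.sum_congr rfl fun i _ => (flatProj_flatRep l _ _).symm

theorem HasCocycle.flatProj {X : Type} [MulAction M2pos X] {ψ : X → Mflat n ℂ}
    {c : SL(2, ℤ) → Mflat n ℂ} (h : HasCocycle (flatRep n ℂ) ψ c) (l : ℂ →+ ℚ) :
    HasCocycle (flatRep n ℚ) (fun x => EisensteinClass.flatProj n l (ψ x))
      (fun γ => EisensteinClass.flatProj n l (c γ)) := fun γ x => by
  beta_reduce
  rw [h, map_add, flatProj_flatRep]

/-- A cocycle and a natural number `N` define the subgroup of the elements at which `N` times the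
cocycle is integral. -/
def integralSubgroup (c : SL(2, ℤ) → Mflat n ℚ)
    (hc : ∀ γ δ, c (γ * δ) = c γ + flatRep n ℚ (ofSL γ) (c δ)) (N : ℕ) : Subgroup SL(2, ℤ) where
  carrier := {γ | ∃ Q : Mflat n ℤ, N • c γ = flatMap n (Int.castRingHom ℚ) Q}
  one_mem' := by
    have h := hc 1 1
    simp only [mul_one, map_one, Module.End.one_apply, left_eq_add] at h
    exact ⟨0, by rw [h, smul_zero, map_zero]⟩
  mul_mem' {γ δ} hγ hδ := by
    obtain ⟨P, hP⟩ := hγ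
    obtain ⟨Q, hQ⟩ := hδ
    exact ⟨P + flatRep n ℤ (ofSL γ) Q, by
      rw [hc, smul_add, ← map_nsmul, hP, hQ, map_add, flatMap_flatRep]⟩
  inv_mem' {γ} hγ := by
    obtain ⟨P, hP⟩ := hγ
    refine ⟨-flatRep n ℤ (ofSL γ⁻¹) P, ?_⟩
    have h := hc 1 1
    simp only [mul_one, map_one, Module.End.one_apply, left_eq_add] at h
    have h1 := hc γ⁻¹ γ
    rw [inv_mul_cancel, h] at h1
    rw [eq_neg_of_add_eq_zero_left h1.symm, smul_neg, ← map_nsmul, hP, map_neg, flatMap_flatRep]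

/-- Since `S` and `T` generate the group, clearing the denominators of two values clears all of
them. -/
theorem exists_integral_cocycle {c : SL(2, ℤ) → Mflat n ℚ}
    (hc : ∀ γ δ, c (γ * δ) = c γ + flatRep n ℚ (ofSL γ) (c δ)) :
    ∃ (N : ℕ) (d : SL(2, ℤ) → Mflat n ℤ), N ≠ 0 ∧
      (∀ γ δ, d (γ * δ) = d γ + flatRep n ℤ (ofSL γ) (d δ)) ∧
      ∀ γ, N • c γ = flatMap n (Int.castRingHom ℚ) (d γ) := by
  obtain ⟨N₁, hN₁, P₁, h₁⟩ := exists_smul_mem_range_flatMap (c ModularGroup.S)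
  obtain ⟨N₂, hN₂, P₂, h₂⟩ := exists_smul_mem_range_flatMap (c ModularGroup.T)
  have h : (⊤ : Subgroup SL(2, ℤ)) ≤ integralSubgroup c hc (N₁ * N₂) := by
    rw [← SpecialLinearGroup.SL2Z_generators, Subgroup.closure_le]
    rintro _ (rfl | rfl)
    · exact ⟨N₂ • P₁, by rw [map_nsmul, ← h₁, smul_smul, mul_comm]⟩
    · exact ⟨N₁ • P₂, by rw [map_nsmul, ← h₂, smul_smul]⟩
  choose d hd using fun γ => h (Subgroup.mem_top γ)
  refine ⟨N₁ * N₂, d, mul_ne_zero hN₁ hN₂, fun γ δ => ?_, hd⟩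
  apply flatMap_injective (f := Int.castRingHom ℚ) (Int.castRingHom ℚ).injective_int
  rw [map_add, flatMap_flatRep, ← hd, ← hd, ← hd, hc, smul_add, map_nsmul]

theorem flatMap_rat_flatMap_int (P : Mflat n ℤ) :
    flatMap n (Rat.castHom ℂ) (flatMap n (Int.castRingHom ℚ) P) =
      flatMap n (Int.castRingHom ℂ) P := by
  apply Subtype.ext
  change MvPolynomial.map _ (MvPolynomial.map _ P.1) = MvPolynomial.map _ P.1
  rw [MvPolynomial.map_map]
  congr 2

/-- One integer makes the group cocycle integral, and `stabBound` realises it by an integral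
function on `ℍ^BS`. Over `ℂ` the two functions have the same cocycle, hence the same class. -/
theorem isRational_baseChange (e : H1 HBS (flatRep n ℚ)) :
    IsRational n (baseChange HBS n (Rat.castHom ℂ) e) := by
  obtain ⟨ψ, c, h, rfl⟩ := exists_cls_HBS e
  obtain ⟨N, d, hN, hd, hcd⟩ := exists_integral_cocycle h.mul
  obtain ⟨ψ', h'⟩ := exists_hasCocycle (flatRep n ℤ) d hd
  refine ⟨stabBound * N, mul_ne_zero stabBound_ne_zero hN, cls _ ψ' h'.dPrim_mem, ?_⟩
  have h1 := (h.baseChange (Rat.castHom ℂ)).smul ((stabBound * N : ℕ) : ℂ)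
  rw [baseChange_cls _ h, baseChange_cls _ h', ← cls_smul _ (h.baseChange (Rat.castHom ℂ))]
  have h2 := h'.baseChange (Int.castRingHom ℂ)
  have h3 : (fun γ => ((stabBound * N : ℕ) : ℂ) • flatMap n (Rat.castHom ℂ) (c γ)) =
      fun γ => flatMap n (Int.castRingHom ℂ) (stabBound • d γ) := by
    funext γ
    rw [Nat.cast_smul_eq_nsmul, map_nsmul, ← flatMap_rat_flatMap_int, ← hcd, map_nsmul, mul_smul]
  rw [h3] at h1
  exact cls_eq_cls_of_hasCocycle h1 h2

theorem eq_zero_of_resBoundary_eq_zero_rat (hn : 2 ≤ n) (heven : Even n)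
    {u : H1 HBS (flatRep n ℚ)} (h0 : resBoundary n ℚ u = 0)
    (hu : ∀ p, hecke (flatRep n ℚ) p u = (eisEigenvalue n p : ℚ) • u) : u = 0 := by
  apply baseChange_rat_injective
  rw [map_zero]
  refine eq_zero_of_resBoundary_eq_zero hn heven ?_ fun p => ?_
  · rw [← baseChange_resBoundary, h0, map_zero]
  · rw [← baseChange_hecke, hu, Nat.cast_smul_eq_nsmul, map_nsmul, Nat.cast_smul_eq_nsmul]

/-- A Hecke eigenclass for the eigenvalues of the Eisenstein series whose restriction to
the boundary is normalized. -/
structure IsEisensteinClass {R : Type} [CommRing R] (n : ℕ) (e : H1 HBS (flatRep n R)) : Prop where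
  hecke_eq : ∀ p, hecke (flatRep n R) p e = (eisEigenvalue n p : R) • e
  bdPairing_eq : bdPairing n R (resBoundary n R e) = 1

/-- The group cocycle found on `ℍ` is realised on `ℍ^BS`, and the eigenvalue equation is checked
after the injective restriction to `ℍ`. It serves both for the Eisenstein series and for its
rational projection. -/
theorem exists_isEisensteinClass {K : Type} [Field K] [CharZero K] {ψ : ℍ → Mflat n K}
    {c : SL(2, ℤ) → Mflat n K} (hc : HasCocycle (flatRep n K) ψ c)
    (hψ : ∀ p x y, heckeFun (flatRep n K) p ψ y - heckeFun (flatRep n K) p ψ x =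
      eisEigenvalue n p • (ψ y - ψ x)) (hT : ev n K ![1, 0] (c ModularGroup.T) = 1) :
    ∃ e : H1 HBS (flatRep n K), IsEisensteinClass n e ∧
      resInner n K e = cls _ ψ hc.dPrim_mem := by
  obtain ⟨ψ', h⟩ := exists_hasCocycle_field (flatRep n K) c hc.mul
  have h1 : resInner n K (cls _ ψ' h.dPrim_mem) = cls _ ψ hc.dPrim_mem := by
    rw [resInner_cls h]
    exact cls_eq_cls_of_hasCocycle h.inner hc
  refine ⟨cls _ ψ' h.dPrim_mem, ⟨fun p => resInner_injective ?_, ?_⟩, h1⟩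
  · rw [resInner_hecke, map_smul, h1]
    exact hecke_cls_of_heckeFun_sub hc.dPrim_mem (hψ p)
  · rw [bdPairing_resBoundary h, hT]

theorem IsEisensteinClass.baseChange {e : H1 HBS (flatRep n ℚ)} (he : IsEisensteinClass n e) :
    IsEisensteinClass n (baseChange HBS n (Rat.castHom ℂ) e) where
  hecke_eq p := by
    rw [← baseChange_hecke, he.hecke_eq, Nat.cast_smul_eq_nsmul, map_nsmul, Nat.cast_smul_eq_nsmul]
  bdPairing_eq := by rw [← baseChange_resBoundary, bdPairing_baseChange, he.bdPairing_eq, map_one]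

/-- The difference pairs to zero with the boundary, so it vanishes there by injectivity of the
pairing, and the norm argument applies. -/
theorem IsEisensteinClass.eq (hn : 2 ≤ n) (heven : Even n) {e e' : H1 HBS (flatRep n ℂ)}
    (he : IsEisensteinClass n e) (he' : IsEisensteinClass n e') : e = e' := by
  rw [← sub_eq_zero]
  refine eq_zero_of_resBoundary_eq_zero hn heven (bdPairing_injective heven ?_) fun p => ?_
  · rw [map_sub, map_sub, he.bdPairing_eq, he'.bdPairing_eq, sub_self, map_zero]
  · rw [map_sub, he.hecke_eq, he'.hecke_eq, smul_sub]

/-- The section of the restriction map given by a normalized Eisenstein class. -/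
def eisSection (e : H1 HBS (flatRep n ℚ)) :
    H1 BSBoundary (flatRep n ℚ) →ₗ[ℚ] H1 HBS (flatRep n ℚ) :=
  (bdPairing n ℚ).smulRight e

theorem eisSection_apply (e : H1 HBS (flatRep n ℚ)) (c : H1 BSBoundary (flatRep n ℚ)) :
    eisSection e c = bdPairing n ℚ c • e := rfl

theorem IsEisensteinClass.resBoundary_eisSection (heven : Even n) {e : H1 HBS (flatRep n ℚ)}
    (he : IsEisensteinClass n e) (c : H1 BSBoundary (flatRep n ℚ)) :
    resBoundary n ℚ (eisSection e c) = c := by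
  apply bdPairing_injective heven
  rw [eisSection_apply, map_smul, map_smul, he.bdPairing_eq, smul_eq_mul, mul_one]

/-- The boundary cohomology is spanned by the restriction of `e`, so the Hecke eigenvalue there is
read off from `e` and needs no separate computation. -/
theorem IsEisensteinClass.isHeckeSection (heven : Even n) {e : H1 HBS (flatRep n ℚ)}
    (he : IsEisensteinClass n e) : IsHeckeSection n (eisSection e) := by
  refine ⟨he.resBoundary_eisSection heven, fun p c => ?_⟩
  have h1 : hecke (flatRep n ℚ) p (eisSection e c) =
      (eisEigenvalue n p : ℚ) • eisSection e c := by
    rw [eisSection_apply, map_smul, he.hecke_eq, smul_comm]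
  have h2 : hecke (flatRep n ℚ) p c = (eisEigenvalue n p : ℚ) • c := by
    rw [← he.resBoundary_eisSection heven c, ← resBoundary_hecke, h1, map_smul]
  rw [h1, h2, map_smul]

/-- For a section `s` commuting with the Hecke operators, `s (res e) - e` is an eigenclass that
vanishes on the boundary, hence zero. As `res e` spans the boundary cohomology, `s` is determined.
-/
theorem IsEisensteinClass.eq_eisSection (hn : 2 ≤ n) (heven : Even n)
    {e : H1 HBS (flatRep n ℚ)} (he : IsEisensteinClass n e)
    {s : H1 BSBoundary (flatRep n ℚ) →ₗ[ℚ] H1 HBS (flatRep n ℚ)} (hs : IsHeckeSection n s) :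
    s = eisSection e := by
  have h1 : s (resBoundary n ℚ e) = e := by
    rw [← sub_eq_zero]
    refine eq_zero_of_resBoundary_eq_zero_rat hn heven ?_ fun p => ?_
    · rw [map_sub, hs.1, sub_self]
    · rw [map_sub, ← hs.2, ← resBoundary_hecke, he.hecke_eq, map_smul, map_smul, smul_sub]
  ext c
  have h2 : c = bdPairing n ℚ c • resBoundary n ℚ e := by
    rw [← map_smul]
    exact (he.resBoundary_eisSection heven c).symm
  rw [h2, map_smul, h1, ← h2, eisSection_apply]

end Rationality

end EisensteinClass
end

theorem proposition2 (n : ℕ) (hn : 2 ≤ n) (heven : Even n) :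
    ∃ Eis : H1 HBS (flatRep n ℂ),
      -- `Eis` is the class `r(E_{n+2})`, via `H¹(Y^BS, M_n^♭ ⊗ ℂ) = H¹(Y, M_n^♭ ⊗ ℂ)`
      (∀ c : H1 HBS (flatRep n ℂ),
        resInner n ℂ c = eichlerShimura n (eisenstein n hn heven) ↔ c = Eis) ∧
      -- it is rational
      IsRational n Eis ∧
      -- it is the image of the natural generator of the cohomology of the boundary under the
      -- unique Hecke-equivariant section of the restriction map
      ∃ s : H1 BSBoundary (flatRep n ℚ) →ₗ[ℚ] H1 HBS (flatRep n ℚ),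
        IsHeckeSection n s ∧ (∀ s', IsHeckeSection n s' → s' = s) ∧
        (∃ ω, IsBoundaryGenerator n ω) ∧
        ∀ ω, IsBoundaryGenerator n ω →
          baseChange HBS n (Rat.castHom ℂ)
            (s (baseChange BSBoundary n (Int.castRingHom ℚ) ω)) = Eis := by
  obtain ⟨ψ, c, hc, hr, hψ, hT⟩ := exists_eisensteinCocycle hn heven
  obtain ⟨l, hl⟩ := exists_retraction
  obtain ⟨Eis, hEis, hEis'⟩ := exists_isEisensteinClass hc hψ hT
  -- The rational class comes from the coefficientwise retraction of the complex function; `l 1 = 1`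
  -- preserves the boundary value.
  obtain ⟨e, he, -⟩ := exists_isEisensteinClass (hc.flatProj l)
    (fun p x y => by
      rw [heckeFun_flatProj, heckeFun_flatProj, ← map_sub, hψ, map_nsmul, map_sub])
    (by
      rw [ev_flatProj, hT]
      exact_mod_cast hl 1)
  -- Both are normalised eigenclasses over `ℂ`, so uniqueness identifies them; this is the
  -- rationality of the Eisenstein class.
  have hbase : baseChange HBS n (Rat.castHom ℂ) e = Eis := he.baseChange.eq hn heven hEis
  refine ⟨Eis, fun u => ?_, hbase ▸ isRational_baseChange e, eisSection e,
    he.isHeckeSection heven, fun s' hs' => he.eq_eisSection hn heven hs', ?_, fun ω hω => ?_⟩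
  · rw [hr, ← hEis']
    exact resInner_injective.eq_iff
  · obtain ⟨ω, hω⟩ := exists_bdPairing_eq_one (R := ℤ) heven
    exact ⟨ω, (isBoundaryGenerator_iff heven ω).2 hω⟩
  · rw [eisSection_apply, bdPairing_baseChange, (isBoundaryGenerator_iff heven ω).1 hω, map_one,
      one_smul, hbase]
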